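/- Conventions. A space is a compactly generated weak Hausdorff space; products, colimits, pullbacks and geometric realizations are formed in the category $\mathcal U$ of these spaces, and $\mathcal T$ is the category of based spaces. Let $\mathcal I$ be the category with objects the finite sets $\mathbf n=\{1,\dots,n\}$, $n\ge 0$, and morphisms the injective maps; it is symmetric monoidal under concatenation $\sqcup$. Let $S^n$ be the one-point compactification of $\mathbb R^n$, based at $\infty$, and for an injective map $\alpha\colon\mathbf m\to\mathbf n$ let $S^{n-\alpha}$ be the one-point compactification of $\mathbb R^{\mathbf n\setminus\alpha(\mathbf m)}$; thus $\alpha$ specifies a homeomorphism $S^{n-\alpha}\wedge S^m\cong S^n$. $\mathcal I$-spaces. An $\mathcal I$-space is a functor $X\colon\mathcal I\to\mathcal U$, and morphisms are natural transformations. The category of $\mathcal I$-spaces is symmetric monoidal under $$(X\boxtimes Y)(n)=\operatorname{colim}_{\mathbf n_1\sqcup\mathbf n_2\to\mathbf n}X(n_1)\times Y(n_2),$$ with the constant one-point $\mathcal I$-space as unit; its (commutative) monoids are called (commutative) $\mathcal I$-space monoids. The $\mathcal I$-space $BF$. Let $F(n)$ be the topological monoid (under composition, with the compact-open topology) of base point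 preserving self homotopy equivalences of $S^n$. A map $\alpha\colon\mathbf m\to\mathbf n$ in $\mathcal I$ induces the homomorphism $F(m)\to F(n)$, $f\mapsto S^{n-\alpha}\wedge f$. The bar constructions $BF(n)=B(*,F(n),*)$ form an $\mathcal I$-space, which is a commutative $\mathcal I$-space monoid with multiplication induced by $F(m)\times F(n)\to F(m+n)$, $(f,g)\mapsto f\wedge g$. The category $\mathcal I\mathcal U/BF$ of $\mathcal I$-spaces over $BF$ is symmetric monoidal: the product $f\boxtimes g$ of $f\colon X\to BF$ and $g\colon Y\to BF$ is the composite $X\boxtimes Y\to BF\boxtimes BF\to BF$, and the unit is the unit $*\to BF$ of the monoid $BF$. Symmetric spectra. Let $\mathcal I_S$ be the category, enriched in $\mathcal T$, with the objects of $\mathcal I$, with $\mathcal I_S(\mathbf m,\mathbf n)=\bigvee_{\alpha}S^{n-\alpha}$, where $\alpha$ runs through the injective maps $\mathbf m\to\mathbf n$, and with the composition given by the canonical homeomorphisms $S^{n-\alpha}\wedge S^{m-\beta}\cong S^{n-\alpha\beta}$. A symmetric spectrum is a based continuous functor $\mathcal I_S\to\mathcal T$, that is, it consists of based spaces $E(n)$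 and of structure maps $S^{n-\alpha}\wedge E(m)\to E(n)$ for the injective maps $\alpha\colon\mathbf m\to\mathbf n$, subject to associativity and unit conditions. The category $Sp^\Sigma$ of symmetric spectra is symmetric monoidal under the smash product $$(D\wedge E)(n)=\operatorname{colim}_{\alpha\colon\mathbf n_1\sqcup\mathbf n_2\to\mathbf n}S^{n-\alpha}\wedge D(n_1)\wedge E(n_2),$$ with the sphere spectrum $S(n)=S^n$ as unit; its (commutative) monoids are the (commutative) symmetric ring spectra. The Thom spectrum functor. Let $V(n)=B(*,F(n),S^n)\to BF(n)$ be the map induced by $S^n\to *$, with the section induced by the inclusion of the base point of $S^n$. The Thom space $T(f)$ of a map $f\colon X\to BF(n)$ is the quotient of the pullback $f^*V(n)$ by the image of the section (the one-point space if $X=\emptyset$). For an $\mathcal I$-space $f\colon X\to BF$ over $BF$, the symmetric Thom spectrum $T(f)$ has the spaces $T(f)(n)=T(f_n)$ and the structure maps $S^{n-\alpha}\wedge T(f_m)\to T(f_n)$ induced by $\alpha_*\colon X(m)\to X(n)$ and by the map $S^{n-\alpha}\times V(m)\to V(n)$ that is induced by $F(m)\to F(n)$ and $S^{n-\alpha}\wedge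 S^m\cong S^n$. This defines a functor $T\colon\mathcal I\mathcal U/BF\to Sp^\Sigma$. Theorem. The symmetric Thom spectrum functor $T\colon\mathcal I\mathcal U/BF\to Sp^\Sigma$ is strong symmetric monoidal: there are an isomorphism $S\cong T(*\to BF)$ and isomorphisms $T(f)\wedge T(g)\cong T(f\boxtimes g)$, natural in $f$ and $g$, that are compatible with the associativity, unit and symmetry isomorphisms. Consequently, if $X$ is an $\mathcal I$-space monoid and $f\colon X\to BF$ is a morphism of $\mathcal I$-space monoids, then $T(f)$ is a symmetric ring spectrum, with unit $S\cong T(*\to BF)\to T(f)$ and multiplication $T(f)\wedge T(f)\cong T(f\boxtimes f)\to T(f)$ induced by the unit and the multiplication of $X$, and $T(f)$ is commutative if $X$ is commutative. -/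

import Mathlib

open CategoryTheory MonoidalCategory Topology

namespace SymThom

noncomputable section

/-! ### Compactly generated weak Hausdorff spaces -/

/-- The family of all compact Hausdorff spaces. -/
abbrev CH (K : CompHaus.{0}) : Type := K.toTop

/-- `f` is continuous on every compact Hausdorff test space `K → A`. Equivalently, `f` is
continuous for the compactly generated topology on `A`. In particular, for compactly
generated weak Hausdorff `X`, `Y`, `Z`, a map `X × Y → Z` is `KCont` exactly if it is a
continuous map out of the product of `X` and `Y` in compactly generated spaces. -/
abbrev KCont {A B : Type} [TopologicalSpace A] [TopologicalSpace B] (f : A → B) : Prop :=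
  ContinuousGeneratedBy CH f

/-- Compactly generated weak Hausdorff spaces: the topology is coinduced by the maps from
compact Hausdorff spaces, and the images of these maps are closed. -/
class CGWH (X : Type) [TopologicalSpace X] : Prop where
  compactlyGenerated : CompactlyGeneratedSpace X
  isClosed_range : ∀ (K : CompHaus.{0}) (f : C(K, X)), IsClosed (Set.range f)

instance (K : CompHaus.{0}) : CompactSpace (CH K) := K.is_compact

instance (K : CompHaus.{0}) : T2Space (CH K) := K.is_hausdorff

theorem locallyCompact_of_compact (K : Type) [TopologicalSpace K] [CompactSpace K]
    [T2Space K] : LocallyCompactSpace K := inferInstance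

instance (K : CompHaus.{0}) : LocallyCompactSpace (CH K) := locallyCompact_of_compact _

instance (K L : CompHaus.{0}) : IsGeneratedBy CH (CH K × CH L) :=
  inferInstanceAs (IsGeneratedBy CH (CH (CompHaus.of (K × L))))

instance CGWH.isGeneratedBy (X : Type) [TopologicalSpace X] [h : CGWH X] :
    IsGeneratedBy CH X := by
  have := h.compactlyGenerated
  constructor
  exact continuous_from_uCompactlyGeneratedSpace.{0} _ fun S g ↦
    (IsGeneratedBy.equiv_symm_comp_continuous_iff (X := CH) (Y := S) g).2 g.continuous

section
variable {A B C D : Type} [TopologicalSpace A] [TopologicalSpace B] [TopologicalSpace C]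
  [TopologicalSpace D]

theorem KCont.continuous [CGWH A] {f : A → B} (h : KCont f) : Continuous f :=
  (IsGeneratedBy.continuous_iff CH f).2 h

theorem kcont (f : A → B) (h : Continuous f) : KCont f := h.continuousGeneratedBy

theorem KCont.comp {g : B → C} {f : A → B} (hg : KCont g) (hf : KCont f) :
    KCont (fun a ↦ g (f a)) :=
  ContinuousGeneratedBy.comp hg hf

theorem KCont.prodMk {g : A → B} {f : A → C} (hg : KCont g) (hf : KCont f) :
    KCont (fun a ↦ (g a, f a)) := fun _ k ↦ (hg k).prodMk (hf k)

theorem KCont.subtypeMk {p : B → Prop} {f : A → B} (hf : KCont f) (h : ∀ a, p (f a)) :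
    KCont (fun a ↦ (⟨f a, h a⟩ : Subtype p)) := fun _ k ↦ (hf k).subtype_mk _

theorem KCont.comp_prod {g : B × C → D} {f : A → B} {f' : A → C} (hg : KCont g)
    (hf : KCont f) (hf' : KCont f') : KCont (fun a ↦ g (f a, f' a)) :=
  KCont.comp hg (hf.prodMk hf')

theorem KCont.sigma {ι : Type} {A : ι → Type} [∀ i, TopologicalSpace (A i)]
    {f : (Σ i, A i) → B} (h : ∀ i, KCont (fun a : A i ↦ f ⟨i, a⟩)) : KCont f := by
  intro K k
  rw [continuous_iff_continuousAt]
  intro x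
  obtain ⟨i, a⟩ : Σ i, A i := k x
  have hcl : IsClopen (k ⁻¹' Set.range (Sigma.mk (k x).1 : A (k x).1 → Σ i, A i)) :=
    (isClopen_range_sigmaMk (i := (k x).1)).preimage k.continuous
  set U := k ⁻¹' Set.range (Sigma.mk (k x).1 : A (k x).1 → Σ i, A i) with hU
  have hxU : x ∈ U := ⟨(k x).2, rfl⟩
  have hK : CompactSpace U := isCompact_iff_compactSpace.1 hcl.1.isCompact
  have hmem : ∀ u : U, ∃ a : A (k x).1, Sigma.mk (k x).1 a = k u := fun u ↦ u.2
  choose a ha using hmem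
  have hca : Continuous a := by
    rw [(Topology.IsEmbedding.sigmaMk (i := (k x).1)).continuous_iff]
    have : (Sigma.mk (k x).1 ∘ a) = fun u : U ↦ k u := funext ha
    rw [this]
    exact k.continuous.comp continuous_subtype_val
  have h1 : Continuous (fun u : U ↦ f (k u)) := by
    have h0 := h (k x).1
    have := @h0 (CompHaus.of U) ⟨a, hca⟩
    convert this using 1
    funext u
    exact congrArg f (ha u).symm
  have h2 : ContinuousOn (f ∘ k) U := continuousOn_iff_continuous_domRestrict.2 h1
  exact h2.continuousAt (hcl.2.mem_nhds hxU)

theorem KCont.sum {f : A ⊕ B → C} (h : KCont (fun a : A ↦ f (.inl a)))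
    (h' : KCont (fun b : B ↦ f (.inr b))) : KCont f := by
  let T : Bool → Type := fun b ↦ cond b A B
  let _ : ∀ b, TopologicalSpace (T b) := fun b ↦ by cases b <;> (dsimp [T]; infer_instance)
  let u : A ⊕ B → Σ b, T b := fun p ↦ p.elim (fun a ↦ ⟨true, a⟩) fun b ↦ ⟨false, b⟩
  let g : (Σ b, T b) → C := fun p ↦ match p with
    | ⟨true, a⟩ => f (.inl a)
    | ⟨false, b⟩ => f (.inr b)
  have hg : KCont g := KCont.sigma fun b ↦ by cases b; exacts [h', h]
  have hu : Continuous u := by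
    refine continuous_sum_dom.2 ⟨?_, ?_⟩
    · exact continuous_sigmaMk (σ := T) (i := true)
    · exact continuous_sigmaMk (σ := T) (i := false)
  convert KCont.comp hg (kcont u hu) using 1
  funext p
  cases p <;> rfl

end

/-- The coincidence set of two maps from compact Hausdorff spaces is closed. -/
theorem CGWH.isClosed_eq {Z : Type} [TopologicalSpace Z] [hZ : CGWH Z] (K L : CompHaus.{0})
    (f : C(K, Z)) (g : C(L, Z)) : IsClosed {p : K × L | f p.1 = g p.2} := by
  have key : ∀ (K : Type) [TopologicalSpace K] [CompactSpace K] [T2Space K] (f : C(K, Z)),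
      IsClosed {p : K × K | f p.1 = f p.2} := by
    intro K _ _ _ f
    have hpt : ∀ z : Z, IsClosed {z} := fun z ↦ by
      have := hZ.isClosed_range (CompHaus.of PUnit) (ContinuousMap.const _ z)
      convert this using 1
      ext y
      simp [eq_comm]
    have him : ∀ s : Set K, IsClosed s → IsClosed (f '' s) := fun s hs ↦ by
      have : CompactSpace s := isCompact_iff_compactSpace.1 hs.isCompact
      have := hZ.isClosed_range (CompHaus.of s) (f.comp ⟨Subtype.val, continuous_subtype_val⟩)
      convert this using 1
      ext z
      simp
    rw [← isOpen_compl_iff, isOpen_prod_iff]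
    intro a b hab
    obtain ⟨U, V, hU, hV, hAU, hBV, hd⟩ := normal_separation
      ((hpt (f a)).preimage f.continuous) ((hpt (f b)).preimage f.continuous)
      (by
        rw [Set.disjoint_left]
        intro x hx hx'
        exact hab (by simp_all))
    refine ⟨f ⁻¹' (f '' Uᶜ)ᶜ, f ⁻¹' (f '' Vᶜ)ᶜ,
      (him _ hU.isClosed_compl).isOpen_compl.preimage f.continuous,
      (him _ hV.isClosed_compl).isOpen_compl.preimage f.continuous, ?_, ?_, ?_⟩
    · rintro ⟨x, hx, hxa⟩
      exact hx (hAU (by simpa using hxa))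
    · rintro ⟨x, hx, hxa⟩
      exact hx (hBV (by simpa using hxa))
    · rintro ⟨x, y⟩ ⟨hx, hy⟩ hxy
      have h1 : y ∈ U := by
        by_contra h
        exact hx ⟨y, h, (show f x = f y from hxy).symm⟩
      have h2 : y ∈ V := by
        by_contra h
        exact hy ⟨y, h, rfl⟩
      exact Set.disjoint_left.1 hd h1 h2
  have h := key (K ⊕ L) ⟨Sum.elim f g, by fun_prop⟩
  have hc : Continuous (fun p : K × L ↦ ((Sum.inl p.1, Sum.inr p.2) : (K ⊕ L) × (K ⊕ L))) := by
    fun_prop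
  exact h.preimage hc

/-- A compactly generated space whose points are separated by maps to compactly generated
weak Hausdorff spaces is weak Hausdorff. -/
theorem CGWH.of_separating {B : Type} [TopologicalSpace B] [hB : IsGeneratedBy CH B]
    (h : ∀ b b' : B, (∀ (Z : Type) [TopologicalSpace Z] [CGWH Z] (f : B → Z), Continuous f →
      f b = f b') → b = b') : CGWH B where
  compactlyGenerated := uCompactlyGeneratedSpace_of_isOpen fun s hs ↦
    (IsGeneratedBy.isOpen_iff CH).2 fun K f ↦ hs K f
  isClosed_range K g := by
    rw [IsGeneratedBy.isClosed_iff CH]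
    intro L l
    have h1 : l ⁻¹' Set.range g = Prod.snd '' {p : CH K × CH L | g p.1 = l p.2} := by
      ext y
      simp
    have h2 : IsClosed {p : CH K × CH L | g p.1 = l p.2} := by
      have : {p : CH K × CH L | g p.1 = l p.2} =
          {p | ∀ (Z : Type) (_ : TopologicalSpace Z) (_ : CGWH Z) (f : B → Z)
            (_ : Continuous f), f (g p.1) = f (l p.2)} := by
        ext p
        exact ⟨fun hp Z _ _ f _ ↦ congrArg f hp, fun hp ↦ h _ _ fun Z i j f hf ↦ hp Z i j f hf⟩
      rw [this]
      simp only [Set.ofPred_forall]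
      refine isClosed_iInter fun Z ↦ isClosed_iInter fun _ ↦ isClosed_iInter fun _ ↦
        isClosed_iInter fun f ↦ isClosed_iInter fun hf ↦ ?_
      exact CGWH.isClosed_eq K L ⟨f ∘ g, hf.comp g.continuous⟩ ⟨f ∘ l, hf.comp l.continuous⟩
    rw [h1]
    exact isClosedMap_snd_of_compactSpace _ h2

/-- Compact Hausdorff spaces are compactly generated weak Hausdorff. -/
instance CGWH.of_compact {X : Type} [TopologicalSpace X] [CompactSpace X] [T2Space X] :
    CGWH X where
  compactlyGenerated := inferInstance
  isClosed_range _ f := (isCompact_range f.continuous).isClosed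

/-! ### Quotients in compactly generated weak Hausdorff spaces -/

section Quotient
variable {A : Type} [TopologicalSpace A] (r : A → A → Prop)

/-- Two points are identified if every map to a compactly generated weak Hausdorff space
that respects `r` identifies them. -/
def KQuot.setoid : Setoid A where
  r a b := ∀ (Z : Type) [TopologicalSpace Z] [CGWH Z] (f : A → Z), KCont f →
    (∀ a b, r a b → f a = f b) → f a = f b
  iseqv :=
    { refl := fun _ _ _ _ _ _ _ ↦ rfl
      symm := fun h Z _ _ f hf hr ↦ (h Z f hf hr).symm
      trans := fun h h' Z _ _ f hf hr ↦ (h Z f hf hr).trans (h' Z f hf hr) }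

/-- The quotient of `A` (with its compactly generated topology) by the relation `r`, formed in
the category of compactly generated weak Hausdorff spaces: the universal compactly
generated weak Hausdorff space receiving a map from `A` that identifies `r`-related points.
All colimits of compactly generated weak Hausdorff spaces below are of this form, with `A` a
disjoint union. -/
def KQuot : Type := Quotient (KQuot.setoid r)

namespace KQuot

variable {r}

/-- The class of a point. -/
def mk (a : A) : KQuot r := Quotient.mk (KQuot.setoid r) a

instance : TopologicalSpace (KQuot r) :=
  TopologicalSpace.coinduced
    (fun a : WithGeneratedByTopology CH A ↦ (mk (WithGeneratedByTopology.equiv a) : KQuot r))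
    inferInstance

variable {Z B : Type} [TopologicalSpace Z] [TopologicalSpace B]

theorem sound {a b : A} (h : r a b) : (mk a : KQuot r) = mk b :=
  Quotient.sound fun _ _ _ _ _ hr ↦ hr a b h

theorem ind {p : KQuot r → Prop} (h : ∀ a, p (mk a)) (q : KQuot r) : p q := Quotient.ind h q

theorem kcont_mk : KCont (mk : A → KQuot r) := by
  have h : Continuous (fun a : WithGeneratedByTopology CH A ↦
      (mk (WithGeneratedByTopology.equiv a) : KQuot r)) := continuous_coinduced_rng
  exact (WithGeneratedByTopology.continuous_from_iff _).1 h

theorem continuous_dom {f : KQuot r → Z} (h : KCont (fun a ↦ f (mk a))) : Continuous f := by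
  rw [continuous_coinduced_dom]
  exact (WithGeneratedByTopology.continuous_from_iff _).2 h

instance : IsGeneratedBy CH (KQuot r) := IsGeneratedBy.coinduced _

instance : CGWH (KQuot r) := CGWH.of_separating fun b b' ↦ by
  induction b using ind with | h a
  induction b' using ind with | h a'
  intro h
  refine Quotient.sound ?_
  intro Z _ _ f hf hr
  exact h Z (Quotient.lift f fun a b hab ↦ hab Z f hf hr) (continuous_dom hf)

/-- The universal property of the quotient. -/
def lift [CGWH Z] (f : A → Z) (hf : KCont f) (hr : ∀ a b, r a b → f a = f b) : KQuot r → Z :=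
  Quotient.lift f fun _ _ hab ↦ hab Z f hf hr

theorem lift_mk [CGWH Z] (f : A → Z) (hf : KCont f) (hr : ∀ a b, r a b → f a = f b) (a : A) :
    lift f hf hr (mk a) = f a := rfl

theorem continuous_lift [CGWH Z] (f : A → Z) (hf : KCont f) (hr : ∀ a b, r a b → f a = f b) :
    Continuous (lift f hf hr) := continuous_dom hf

/-- Quotients are compatible with products. -/
theorem kcont_prod {f : KQuot r × B → Z} (h : KCont (fun p : A × B ↦ f (mk p.1, p.2))) :
    KCont f := by
  have h' : KCont (fun p : B × A ↦ f (mk p.2, p.1)) :=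
    (KCont.comp h (kcont (fun p : B × A ↦ (p.2, p.1)) (by fun_prop)) :)
  let F : ContinuousMapGeneratedBy CH A (ContinuousMapGeneratedBy CH B Z) :=
    ContinuousMapGeneratedBy.curryEquiv ⟨fun p : B × A ↦ f (mk p.2, p.1), h'⟩
  have hs : ∀ q : KQuot r, KCont (fun b ↦ f (q, b)) := by
    intro q
    induction q using ind with | h a
    exact (KCont.comp h (kcont (fun b ↦ (a, b)) (by fun_prop)) :)
  let G : KQuot r → ContinuousMapGeneratedBy CH B Z := fun q ↦ ⟨fun b ↦ f (q, b), hs q⟩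
  have hG : KCont G := kcont _ (continuous_dom F.prop)
  have h3 := (ContinuousMapGeneratedBy.curryEquiv.symm
    (⟨G, hG⟩ : ContinuousMapGeneratedBy CH (KQuot r) (ContinuousMapGeneratedBy CH B Z))).prop
  exact (KCont.comp h3 (kcont (fun p : KQuot r × B ↦ (p.2, p.1)) (by fun_prop)) :)

theorem kcont_prod_right {f : B × KQuot r → Z}
    (h : KCont (fun p : B × A ↦ f (p.1, mk p.2))) : KCont f := by
  have h1 := KCont.comp h (kcont (fun p : A × B ↦ (p.2, p.1)) (by fun_prop))
  have h2 := kcont_prod (f := fun p : KQuot r × B ↦ f (p.2, p.1)) h1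
  exact (KCont.comp h2 (kcont (fun p : B × KQuot r ↦ (p.2, p.1)) (by fun_prop)) :)

end KQuot
end Quotient

/-! ### Spheres -/

/-- `Sⁿ`, the one-point compactification of `ℝⁿ`. -/
def Sphere (n : ℕ) : Type := OnePoint (Fin n → ℝ)

namespace Sphere

variable {l m n : ℕ}

instance : TopologicalSpace (Sphere n) := inferInstanceAs (TopologicalSpace (OnePoint _))
instance : CompactSpace (Sphere n) := inferInstanceAs (CompactSpace (OnePoint _))
instance : T2Space (Sphere n) := inferInstanceAs (T2Space (OnePoint (Fin n → ℝ)))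

/-- A finite point of the sphere. -/
def of (v : Fin n → ℝ) : Sphere n := OnePoint.some v

/-- The base point of the sphere. -/
def infty : Sphere n := OnePoint.infty

/-- Addition of vectors, extended to `Sⁿ` by `∞ + x = x + ∞ = ∞`. It is not continuous,
but for `x` and `y` in complementary coordinate subspheres `Sᴬ` and `Sᴮ`, the point `x + y` is
the smash product `x ∧ y` in `Sᴬ ∧ Sᴮ ≅ Sⁿ`, and we only use it for such `x` and `y`. -/
instance : AddCommMonoid (Sphere n) := inferInstanceAs (AddCommMonoid (WithTop (Fin n → ℝ)))

theorem of_add_of (v w : Fin n → ℝ) : of v + of w = of (v + w) := rfl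
theorem infty_add (s : Sphere n) : infty + s = infty := rfl
theorem add_infty (s : Sphere n) : s + infty = infty := by rw [add_comm, infty_add]
theorem of_zero : (of 0 : Sphere n) = 0 := rfl

theorem cases {p : Sphere n → Prop} (h : p infty) (h' : ∀ v, p (of v)) (s : Sphere n) : p s :=
  OnePoint.rec (C := p) h h' s

theorem of_injective {v w : Fin n → ℝ} (h : of v = of w) : v = w := Option.some_injective _ h

theorem infty_ne_of (v : Fin n → ℝ) : infty ≠ of v := OnePoint.infty_ne_coe v

theorem of_ne_infty (v : Fin n → ℝ) : of v ≠ infty := OnePoint.coe_ne_infty v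

/-- Reindexing of vectors along an injective map, by inserting zero coordinates. -/
def extend (α : Fin m ↪ Fin n) : (Fin m → ℝ) →+ (Fin n → ℝ) where
  toFun v := Function.extend α v 0
  map_zero' := by
    funext j
    by_cases h : ∃ i, α i = j
    · obtain ⟨i, rfl⟩ := h
      simp [α.injective.extend_apply]
    · simp [Function.extend_apply' _ _ _ h]
  map_add' v w := by
    funext j
    by_cases h : ∃ i, α i = j
    · obtain ⟨i, rfl⟩ := h
      simp [α.injective.extend_apply]
    · simp [Function.extend_apply' _ _ _ h]

theorem extend_apply (α : Fin m ↪ Fin n) (v : Fin m → ℝ) (i : Fin m) :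
    extend α v (α i) = v i := α.injective.extend_apply _ _ _

theorem extend_apply' (α : Fin m ↪ Fin n) (v : Fin m → ℝ) (j : Fin n)
    (h : j ∉ Set.range α) : extend α v j = 0 := Function.extend_apply' _ _ _ h

/-- The based map `α_* : Sᵐ → Sⁿ` that reindexes the coordinates along `α`. -/
def push (α : Fin m ↪ Fin n) : Sphere m →+ Sphere n := AddMonoidHom.withTopMap (extend α)

theorem push_of (α : Fin m ↪ Fin n) (v : Fin m → ℝ) : push α (of v) = of (extend α v) := rfl
theorem push_infty (α : Fin m ↪ Fin n) : push α infty = infty := rfl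

theorem push_refl (s : Sphere n) : push (.refl _) s = s := by
  induction s using cases with
  | h => rfl
  | h' v =>
    rw [push_of]
    congr 1
    funext i
    exact extend_apply (.refl _) v i

theorem push_trans (α : Fin l ↪ Fin m) (β : Fin m ↪ Fin n) (s : Sphere l) :
    push (α.trans β) s = push β (push α s) := by
  induction s using cases with
  | h => rfl
  | h' v =>
    simp only [push_of]
    congr 1
    funext j
    by_cases h : j ∈ Set.range β
    · obtain ⟨i, rfl⟩ := h
      rw [extend_apply]
      by_cases h : i ∈ Set.range α
      · obtain ⟨k, rfl⟩ := h
        rw [extend_apply]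
        exact extend_apply (α.trans β) v k
      · rw [extend_apply' _ _ _ h, extend_apply']
        rintro ⟨k, hk⟩
        exact h ⟨k, β.injective hk⟩
    · rw [extend_apply' _ _ _ h, extend_apply']
      rintro ⟨k, hk⟩
      exact h ⟨α k, hk⟩

theorem continuous_push (α : Fin m ↪ Fin n) : Continuous (push α) := by
  have hc : Continuous (extend α) := by
    refine continuous_pi fun j ↦ ?_
    by_cases h : j ∈ Set.range α
    · obtain ⟨i, rfl⟩ := h
      simp only [extend_apply]
      fun_prop
    · simp only [extend_apply' _ _ _ h]
      fun_prop
  refine OnePoint.continuous_map hc ?_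
  have : IsClosedEmbedding (extend α) := by
    refine IsClosedEmbedding.of_continuous_injective_isClosedMap hc ?_ ?_
    · intro v w h
      funext i
      rw [← extend_apply α v i, h, extend_apply]
    · refine (Topology.IsInducing.isClosedMap (f := extend α) ?_ ?_)
      · refine Topology.IsInducing.of_comp (g := fun (w : Fin n → ℝ) i ↦ w (α i)) hc
          (by fun_prop) ?_
        convert Topology.IsInducing.id using 1
        funext v i
        exact extend_apply α v i
      · have : Set.range (extend α) = {w | ∀ j, j ∉ Set.range α → w j = 0} := by
          ext w
          constructor
          · rintro ⟨v, rfl⟩ j hj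
            exact extend_apply' α v j hj
          · intro h
            refine ⟨fun i ↦ w (α i), funext fun j ↦ ?_⟩
            by_cases hj : j ∈ Set.range α
            · obtain ⟨i, rfl⟩ := hj
              rw [extend_apply]
            · rw [extend_apply' _ _ _ hj, h j hj]
        rw [this]
        simp only [Set.ofPred_forall]
        exact isClosed_iInter fun j ↦ isClosed_iInter fun _ ↦
          isClosed_eq (continuous_apply j) continuous_const
  rw [Filter.coclosedCompact_eq_cocompact, Filter.coclosedCompact_eq_cocompact]
  exact this.tendsto_cocompact

/-- `s` lies in the subsphere `Sᴬ` of points whose coordinates outside `A` vanish. -/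
def SuppOn (A : Set (Fin n)) (s : Sphere n) : Prop := ∀ v, s = of v → ∀ i, i ∉ A → v i = 0

variable {A B : Set (Fin n)}

theorem SuppOn.infty : SuppOn A infty := fun v h ↦ absurd h (infty_ne_of v)

theorem suppOn_of {v : Fin n → ℝ} : SuppOn A (of v) ↔ ∀ i, i ∉ A → v i = 0 :=
  ⟨fun h ↦ h v rfl, fun h _ hw ↦ of_injective hw ▸ h⟩

theorem SuppOn.zero : SuppOn A (0 : Sphere n) := suppOn_of (v := 0).2 fun _ _ ↦ rfl

theorem SuppOn.mono {s : Sphere n} (h : SuppOn A s) (hAB : A ⊆ B) : SuppOn B s :=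
  fun v hv i hi ↦ h v hv i fun hA ↦ hi (hAB hA)

theorem SuppOn.add {s t : Sphere n} (hs : SuppOn A s) (ht : SuppOn A t) : SuppOn A (s + t) := by
  induction s using cases with
  | h => exact .infty
  | h' v =>
    induction t using cases with
    | h => rw [add_infty]; exact .infty
    | h' w =>
      rw [suppOn_of] at hs ht
      rw [of_add_of, suppOn_of]
      intro i hi
      simp [hs i hi, ht i hi]

theorem SuppOn.push {s : Sphere m} {A : Set (Fin m)} (hs : SuppOn A s) (α : Fin m ↪ Fin n) :
    SuppOn (α '' A) (push α s) := by
  induction s using cases with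
  | h => exact .infty
  | h' v =>
    rw [suppOn_of] at hs
    rw [push_of, suppOn_of]
    intro j hj
    by_cases h : j ∈ Set.range α
    · obtain ⟨i, rfl⟩ := h
      rw [extend_apply]
      exact hs i fun hi ↦ hj ⟨i, hi, rfl⟩
    · exact extend_apply' _ _ _ h

theorem suppOn_push (s : Sphere m) (α : Fin m ↪ Fin n) : SuppOn (Set.range α) (Sphere.push α s) := by
  have : SuppOn Set.univ s := fun _ _ i hi ↦ absurd trivial hi
  simpa using this.push α

theorem isClosed_suppOn (A : Set (Fin n)) : IsClosed {s | SuppOn A s} := by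
  refine (OnePoint.isClosed_iff_of_mem (X := Fin n → ℝ) (s := {s | SuppOn A s})
    (SuppOn.infty (A := A))).2 ?_
  have : (OnePoint.some ⁻¹' {s | SuppOn A s} : Set (Fin n → ℝ)) =
      {w | ∀ i, i ∉ A → w i = 0} := Set.ext fun v ↦ suppOn_of
  rw [this]
  simp only [Set.ofPred_forall]
  exact isClosed_iInter fun j ↦ isClosed_iInter fun _ ↦
    isClosed_eq (continuous_apply j) continuous_const

theorem continuous_add_of_disjoint (h : Disjoint A B) :
    Continuous fun p : {s // SuppOn A s} × {s // SuppOn B s} ↦ p.1.1 + p.2.1 := by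
  rw [continuous_def]
  intro U hU
  by_cases hi : infty ∈ U
  · rw [← isClosed_compl_iff]
    obtain ⟨-, hK⟩ := (OnePoint.isOpen_iff_of_mem (X := Fin n → ℝ) hi).1 hU
    set K : Set (Fin n → ℝ) := (OnePoint.some ⁻¹' U)ᶜ
    classical
    let g : (Fin n → ℝ) → Sphere n × Sphere n :=
      fun v ↦ (of fun i ↦ if i ∈ A then v i else 0, of fun i ↦ if i ∈ B then v i else 0)
    have hof : Continuous (of : (Fin n → ℝ) → Sphere n) := OnePoint.continuous_coe
    have hif : ∀ A : Set (Fin n), Continuous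
        (fun v : Fin n → ℝ ↦ fun i ↦ if i ∈ A then v i else 0) := fun A ↦
      continuous_pi fun i ↦ by
        by_cases h : i ∈ A <;> simp only [h, if_true, if_false] <;> fun_prop
    have hg : Continuous g := (hof.comp (hif A)).prodMk (hof.comp (hif B))
    have hC : IsClosed (g '' (K ∩ {v | ∀ i, i ∉ A ∪ B → v i = 0})) := by
      refine (IsCompact.image ?_ hg).isClosed
      refine hK.inter_right ?_
      simp only [Set.ofPred_forall]
      exact isClosed_iInter fun j ↦ isClosed_iInter fun _ ↦
        isClosed_eq (continuous_apply j) continuous_const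
    convert hC.preimage (f := fun p : {s // SuppOn A s} × {s // SuppOn B s} ↦ (p.1.1, p.2.1))
      (by fun_prop) using 1
    ext ⟨⟨s, hs⟩, ⟨t, ht⟩⟩
    simp only [Set.mem_compl_iff, Set.mem_preimage]
    constructor
    · intro hst
      induction s using cases with
      | h => exact absurd (by rwa [infty_add]) hst
      | h' v =>
        induction t using cases with
        | h => exact absurd (by rwa [add_infty]) hst
        | h' w =>
          rw [suppOn_of] at hs ht
          refine ⟨v + w, ⟨hst, fun i hi ↦ ?_⟩, ?_⟩
          · simp only [Set.mem_union, not_or] at hi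
            simp [hs i hi.1, ht i hi.2]
          · refine Prod.ext (congrArg of (funext fun i ↦ ?_)) (congrArg of (funext fun i ↦ ?_))
            · by_cases hA : i ∈ A
              · have hB : i ∉ B := Set.disjoint_left.1 h hA
                simp [hA, ht i hB]
              · simp [hA, hs i hA]
            · by_cases hB : i ∈ B
              · have hA : i ∉ A := Set.disjoint_right.1 h hB
                simp [hB, hs i hA]
              · simp [hB, ht i hB]
    · rintro ⟨v, ⟨hvK, hv⟩, hgv⟩ hst
      apply hvK
      have h1 := congrArg Prod.fst hgv
      have h2 := congrArg Prod.snd hgv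
      dsimp only [g] at h1 h2
      rw [← h1, ← h2, of_add_of] at hst
      have hvv : ((fun i ↦ if i ∈ A then v i else 0) + fun i ↦ if i ∈ B then v i else 0) = v := ?_
      · rwa [hvv] at hst
      funext i
      by_cases hA : i ∈ A
      · have hB : i ∉ B := Set.disjoint_left.1 h hA
        simp [hA, hB]
      · by_cases hB : i ∈ B
        · simp [hA, hB]
        · simp [hA, hB, hv i (by simp [hA, hB])]
  · have hU' : IsOpen ((fun p : (Fin n → ℝ) × (Fin n → ℝ) ↦ p.1 + p.2) ⁻¹'
        (OnePoint.some ⁻¹' U)) :=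
      ((OnePoint.isOpen_iff_of_notMem (X := Fin n → ℝ) hi).1 hU).preimage (by fun_prop)
    have hop := (OnePoint.isOpenMap_coe (X := Fin n → ℝ)).prodMap
      (OnePoint.isOpenMap_coe (X := Fin n → ℝ)) _ hU'
    convert hop.preimage (f := fun p : {s // SuppOn A s} × {s // SuppOn B s} ↦
      ((p.1.1, p.2.1) : OnePoint (Fin n → ℝ) × OnePoint (Fin n → ℝ))) (by fun_prop) using 1
    ext ⟨⟨s, hs⟩, ⟨t, ht⟩⟩
    simp only [Set.mem_preimage, Set.mem_image, Prod.exists]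
    constructor
    · intro hst
      induction s using cases with
      | h => exact absurd hst (by rwa [infty_add])
      | h' v =>
        induction t using cases with
        | h => exact absurd hst (by rwa [add_infty])
        | h' w => exact ⟨v, w, hst, rfl⟩
    · rintro ⟨v, w, hvw, hst⟩
      have h1 := congrArg Prod.fst hst
      have h2 := congrArg Prod.snd hst
      dsimp only [Prod.map] at h1 h2
      subst h1 h2
      exact hvw

end Sphere

/-- For `α : ι → Fin n`, the sphere `S^{n-α}`: the one-point compactification of `ℝ^{n-α}`,
where `n - α` is the complement of the image of `α`, and `ℝ^{n-α}` is regarded as the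
subspace of `ℝⁿ` of the vectors whose coordinates in the image of `α` vanish. -/
abbrev CoSphere {ι : Type} {n : ℕ} (α : ι ↪ Fin n) : Type :=
  {s : Sphere n // Sphere.SuppOn (Set.range α)ᶜ s}

namespace CoSphere
variable {ι κ : Type} {l m n : ℕ}

instance (α : ι ↪ Fin n) : CompactSpace (CoSphere α) :=
  isCompact_iff_compactSpace.1 (Sphere.isClosed_suppOn _).isCompact

instance (α : ι ↪ Fin n) : Inhabited (CoSphere α) := ⟨⟨Sphere.infty, .infty⟩⟩

/-- The base point of `S^{n-α}`. -/
def infty (α : ι ↪ Fin n) : CoSphere α := ⟨Sphere.infty, .infty⟩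

/-- The origin of `S^{n-α}`; if `α` is bijective, this is the non-base point of `S⁰`. -/
def zero (α : ι ↪ Fin n) : CoSphere α := ⟨0, .zero⟩

/-- The canonical homeomorphism `S^{n-α} ∧ S^{m-β} ≅ S^{n-αβ}`, `s ∧ t ↦ s ∧ α_* t`. -/
def comp (α : Fin m ↪ Fin n) {β : ι ↪ Fin m} (s : CoSphere α) (t : CoSphere β) :
    CoSphere (β.trans α) :=
  ⟨s.1 + Sphere.push α t.1, by
    refine (s.2.mono ?_).add ((t.2.push α).mono ?_)
    · rw [Set.compl_subset_compl]
      rintro _ ⟨i, rfl⟩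
      exact ⟨β i, rfl⟩
    · rintro _ ⟨i, hi, rfl⟩ ⟨j, hj⟩
      exact hi ⟨j, α.injective hj⟩⟩

theorem continuous_add {α : ι ↪ Fin n} {A : Set (Fin n)} (hA : A ⊆ Set.range α) :
    Continuous fun p : CoSphere α × {s // Sphere.SuppOn A s} ↦ p.1.1 + p.2.1 :=
  Sphere.continuous_add_of_disjoint (disjoint_compl_left.mono_right hA)

end CoSphere

/-- The map `S^{n-α} × Sᵐ → Sⁿ` inducing the homeomorphism `S^{n-α} ∧ Sᵐ ≅ Sⁿ` specified by
`α`. -/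
def Sphere.smash {m n : ℕ} (α : Fin m ↪ Fin n) (p : CoSphere α × Sphere m) : Sphere n :=
  p.1.1 + Sphere.push α p.2

namespace Sphere
variable {l m n : ℕ}

theorem continuous_smash (α : Fin m ↪ Fin n) : Continuous (smash α) := by
  have h := (CoSphere.continuous_add (α := α) subset_rfl).comp
    (continuous_fst.prodMk (((continuous_push α).comp continuous_snd).subtype_mk
      fun p : CoSphere α × Sphere m ↦ suppOn_push p.2 α))
  exact h

/-- The restriction of a vector to the coordinates outside the image of `α`. -/
def off (α : Fin m ↪ Fin n) (v : Fin n → ℝ) : Fin n → ℝ :=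
  open Classical in fun j ↦ if j ∈ Set.range α then 0 else v j

theorem suppOn_off (α : Fin m ↪ Fin n) (v : Fin n → ℝ) :
    SuppOn (Set.range α)ᶜ (of (off α v)) :=
  suppOn_of.2 fun _ hi ↦ if_pos (not_not.1 hi)

theorem off_add (α : Fin m ↪ Fin n) (v : Fin n → ℝ) :
    of (off α v) + push α (of fun i ↦ v (α i)) = of v := by
  rw [push_of, of_add_of]
  congr 1
  funext j
  by_cases h : j ∈ Set.range α
  · obtain ⟨i, rfl⟩ := h
    simp [off, extend_apply]
  · rw [Pi.add_apply, extend_apply' _ _ _ h, off, if_neg h, add_zero]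

theorem exists_smash (α : Fin m ↪ Fin n) (s : Sphere n) :
    ∃ p : CoSphere α × Sphere m, smash α p = s := by
  induction s using cases with
  | h => exact ⟨(CoSphere.infty α, infty), rfl⟩
  | h' v => exact ⟨(⟨_, suppOn_off α v⟩, of fun i ↦ v (α i)), off_add α v⟩

/-- The map `S^{n-α} ∧ f` on `Sⁿ ≅ S^{n-α} ∧ Sᵐ`. -/
def suspend (α : Fin m ↪ Fin n) (f : Sphere m → Sphere m) : Sphere n → Sphere n :=
  OnePoint.rec infty fun v ↦ of (off α v) + push α (f (of fun i ↦ v (α i)))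

theorem suspend_smash (α : Fin m ↪ Fin n) (f : Sphere m → Sphere m) (hf : f infty = infty)
    (p : CoSphere α × Sphere m) : suspend α f (smash α p) = smash α (p.1, f p.2) := by
  obtain ⟨⟨s, hs⟩, x⟩ := p
  induction s using cases with
  | h => rfl
  | h' v =>
    induction x using cases with
    | h =>
      simp only [smash, hf, push_infty, add_infty]
      rfl
    | h' w =>
      rw [suppOn_of] at hs
      have h1 : off α (v + extend α w) = v := by
        funext j
        by_cases h : j ∈ Set.range α
        · rw [off, if_pos h, hs j (not_not.2 h)]
        · rw [off, if_neg h, Pi.add_apply, extend_apply' _ _ _ h, add_zero]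
      have h2 : (fun i ↦ (v + extend α w) (α i)) = w := by
        funext i
        rw [Pi.add_apply, extend_apply, hs (α i) (not_not.2 ⟨i, rfl⟩), zero_add]
      change of (off α (v + extend α w)) + push α (f (of fun i ↦ (v + extend α w) (α i))) = _
      rw [h1, h2]
      rfl

theorem continuous_suspend (α : Fin m ↪ Fin n) {T : Type*} [TopologicalSpace T]
    (f : T → Sphere m → Sphere m) (hf : Continuous fun p : T × Sphere m ↦ f p.1 p.2)
    (h : ∀ t, f t infty = infty) :
    Continuous fun p : T × Sphere n ↦ suspend α (f p.1) p.2 := by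
  have hq : IsQuotientMap (Prod.map (id : T → T) (smash α)) := by
    refine IsClosedMap.isQuotientMap ?_ ?_ ?_
    · exact (isProperMap_id.prodMap (continuous_smash α).isProperMap).isClosedMap
    · exact continuous_id.prodMap (continuous_smash α)
    · exact Function.surjective_id.prodMap (exists_smash α)
  rw [hq.continuous_iff]
  have : ((fun p : T × Sphere n ↦ suspend α (f p.1) p.2) ∘ Prod.map id (smash α)) =
      fun p ↦ smash α (p.2.1, f p.1 p.2.2) :=
    funext fun p ↦ suspend_smash α (f p.1) (h p.1) p.2
  rw [this]
  exact (continuous_smash α).comp ((by fun_prop : Continuous fun p : T × CoSphere α × Sphere m ↦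
    p.2.1).prodMk (hf.comp (by fun_prop : Continuous fun p : T × CoSphere α × Sphere m ↦
      (p.1, p.2.2))))

end Sphere

/-! ### The monoids `F(n)` -/

/-- The monoid of base point preserving self homotopy equivalences of `Sⁿ`. -/
@[ext]
structure F (n : ℕ) where
  /-- the underlying map -/
  toMap : C(Sphere n, Sphere n)
  map_infty : toMap Sphere.infty = Sphere.infty
  exists_inverse : ∃ g : C(Sphere n, Sphere n), g Sphere.infty = Sphere.infty ∧
    (toMap.comp g).HomotopicRel (.id _) {Sphere.infty} ∧
    (g.comp toMap).HomotopicRel (.id _) {Sphere.infty}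

namespace F
variable {l m n : ℕ}

theorem homotopicRel_comp {f g : C(Sphere n, Sphere n)} (h : f.HomotopicRel g {Sphere.infty})
    (k : C(Sphere n, Sphere n)) (hk : k Sphere.infty = Sphere.infty) :
    (f.comp k).HomotopicRel (g.comp k) {Sphere.infty} := by
  obtain ⟨H⟩ := h
  refine ⟨⟨⟨⟨fun p ↦ H (p.1, k p.2), by fun_prop⟩, fun x ↦ ?_, fun x ↦ ?_⟩, ?_⟩⟩
  · exact H.apply_zero _
  · exact H.apply_one _
  · rintro t _ rfl
    exact H.eq_fst t (by simp [hk])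

/-- Multiplication is composition. -/
instance : Monoid (F n) where
  one := ⟨.id _, rfl, .id _, rfl, .refl _, .refl _⟩
  mul f g := ⟨f.toMap.comp g.toMap, by simp [f.map_infty, g.map_infty], by
    obtain ⟨f', hf', h1, h2⟩ := f.exists_inverse
    obtain ⟨g', hg', h3, h4⟩ := g.exists_inverse
    refine ⟨g'.comp f', by simp [hf', hg'], ?_, ?_⟩
    · exact .trans (homotopicRel_comp (h3.comp_continuousMap f.toMap) f' hf') h1
    · exact .trans (homotopicRel_comp (h2.comp_continuousMap g') g.toMap g.map_infty) h4⟩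
  mul_assoc _ _ _ := rfl
  one_mul _ := rfl
  mul_one _ := rfl

/-- The compact-open topology. -/
instance : TopologicalSpace (F n) := .induced toMap inferInstance

instance : SMul (F n) (Sphere n) := ⟨fun f x ↦ f.toMap x⟩

theorem smul_def (f : F n) (x : Sphere n) : f • x = f.toMap x := rfl

theorem ext_smul {f g : F n} (h : ∀ x : Sphere n, f • x = g • x) : f = g :=
  F.ext (ContinuousMap.ext h)

theorem smul_infty (f : F n) : f • (Sphere.infty : Sphere n) = Sphere.infty := f.map_infty

theorem mul_smul' (f g : F n) (x : Sphere n) : (f * g) • x = f • g • x := rfl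

/-- The map `S^{n-α} ∧ f`, as a continuous map. -/
def suspendMap (α : Fin m ↪ Fin n) (f : C(Sphere m, Sphere m))
    (h : f Sphere.infty = Sphere.infty) : C(Sphere n, Sphere n) :=
  ⟨Sphere.suspend α f, (Sphere.continuous_suspend α (fun _ : Unit ↦ f) (by fun_prop)
    fun _ ↦ h).comp (by fun_prop : Continuous fun x ↦ ((), x))⟩

theorem suspendMap_comp (α : Fin m ↪ Fin n) (f g : C(Sphere m, Sphere m))
    (hf : f Sphere.infty = Sphere.infty) (hg : g Sphere.infty = Sphere.infty)
    (hfg : (f.comp g) Sphere.infty = Sphere.infty) :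
    suspendMap α (f.comp g) hfg = (suspendMap α f hf).comp (suspendMap α g hg) := by
  ext x
  obtain ⟨p, rfl⟩ := Sphere.exists_smash α x
  change Sphere.suspend α (f.comp g) _ = Sphere.suspend α f (Sphere.suspend α g _)
  rw [Sphere.suspend_smash α _ hfg, Sphere.suspend_smash α _ hg, Sphere.suspend_smash α _ hf]
  rfl

theorem suspendMap_homotopicRel (α : Fin m ↪ Fin n) (f : C(Sphere m, Sphere m))
    (hf : f Sphere.infty = Sphere.infty)
    (h : f.HomotopicRel (.id _) {Sphere.infty}) :
    (suspendMap α f hf).HomotopicRel (.id _) {Sphere.infty} := by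
  obtain ⟨H⟩ := h
  have hH : ∀ t, H (t, Sphere.infty) = Sphere.infty := fun t ↦ by
    rw [H.eq_fst t rfl, hf]
  refine ⟨⟨⟨⟨fun p ↦ Sphere.suspend α (fun x ↦ H (p.1, x)) p.2,
    Sphere.continuous_suspend α (fun t x ↦ H (t, x)) H.continuous hH⟩, fun x ↦ ?_,
    fun x ↦ ?_⟩, ?_⟩⟩
  · change Sphere.suspend α (fun x ↦ H (0, x)) x = Sphere.suspend α f x
    simp
  · obtain ⟨p, rfl⟩ := Sphere.exists_smash α x
    change Sphere.suspend α (fun x ↦ H (1, x)) _ = _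
    rw [Sphere.suspend_smash α _ (hH 1)]
    simp
  · rintro t _ rfl
    rfl

/-- The monoid homomorphism `F(m) → F(n)`, `f ↦ S^{n-α} ∧ f`, induced by `α`. -/
def map (α : Fin m ↪ Fin n) : F m →* F n where
  toFun f := ⟨suspendMap α f.toMap f.map_infty, rfl, by
    obtain ⟨g, hg, h1, h2⟩ := f.exists_inverse
    refine ⟨suspendMap α g hg, rfl, ?_, ?_⟩
    · rw [← suspendMap_comp _ _ _ _ _ (by simp [hg, f.map_infty])]
      exact suspendMap_homotopicRel _ _ _ h1
    · rw [← suspendMap_comp _ _ _ _ _ (by simp [hg, f.map_infty])]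
      exact suspendMap_homotopicRel _ _ _ h2⟩
  map_one' := ext_smul fun x ↦ by
    obtain ⟨p, rfl⟩ := Sphere.exists_smash α x
    exact Sphere.suspend_smash α _ rfl p
  map_mul' f g := F.ext (suspendMap_comp α _ _ f.map_infty g.map_infty
    (by simp [g.map_infty, f.map_infty]))

theorem map_smul_smash (α : Fin m ↪ Fin n) (f : F m) (p : CoSphere α × Sphere m) :
    map α f • Sphere.smash α p = Sphere.smash α (p.1, (f • p.2 : Sphere m)) :=
  Sphere.suspend_smash α _ f.map_infty p

theorem continuous_map (α : Fin m ↪ Fin n) : Continuous (map α) := by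
  refine continuous_induced_rng.2 (ContinuousMap.continuous_of_continuous_uncurry _ ?_)
  have : Continuous (toMap : F m → _) := continuous_induced_dom
  exact Sphere.continuous_suspend α (fun (f : F m) x ↦ f.toMap x)
    (ContinuousEval.continuous_eval.comp (this.prodMap continuous_id)) fun f ↦ f.map_infty

theorem map_refl (f : F n) : map (.refl _) f = f := ext_smul fun x ↦ by
  obtain ⟨⟨⟨s, hs⟩, y⟩, rfl⟩ := Sphere.exists_smash (.refl _) x
  rw [map_smul_smash]
  induction s using Sphere.cases with
  | h => simp [Sphere.smash, Sphere.infty_add, smul_infty]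
  | h' v =>
    have : v = 0 := funext fun i ↦ Sphere.suppOn_of.1 hs i (not_not.2 ⟨i, rfl⟩)
    subst this
    simp [Sphere.smash, Sphere.of_zero, Sphere.push_refl]

theorem map_trans (α : Fin l ↪ Fin m) (β : Fin m ↪ Fin n) (f : F l) :
    map (α.trans β) f = map β (map α f) := ext_smul fun x ↦ by
  obtain ⟨⟨s, y⟩, rfl⟩ := Sphere.exists_smash β x
  obtain ⟨⟨t, z⟩, rfl⟩ := Sphere.exists_smash α y
  have key : ∀ z, Sphere.smash β (s, Sphere.smash α (t, z)) =
      Sphere.smash (α.trans β) (CoSphere.comp β s t, z) := fun z ↦ by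
    simp only [Sphere.smash, CoSphere.comp, map_add, Sphere.push_trans, add_assoc]
  rw [map_smul_smash, map_smul_smash, key, key, map_smul_smash]

theorem map_comm {m' : ℕ} (α : Fin m ↪ Fin n) (β : Fin m' ↪ Fin n)
    (h : Disjoint (Set.range α) (Set.range β)) (f : F m) (g : F m') :
    Commute (map α f) (map β g) := ext_smul fun x ↦ by
  obtain ⟨⟨⟨s, hs⟩, y⟩, rfl⟩ := Sphere.exists_smash α x
  induction s using Sphere.cases with
  | h => simp [Sphere.smash, Sphere.infty_add, smul_infty]
  | h' v =>
    rw [Sphere.suppOn_of] at hs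
    obtain ⟨t, z, htα, htβ, htz⟩ : ∃ (t : Sphere n) (z : Sphere m'),
        Sphere.SuppOn (Set.range α)ᶜ t ∧ Sphere.SuppOn (Set.range β)ᶜ t ∧
        Sphere.of v = t + Sphere.push β z := by
      refine ⟨_, _, Sphere.suppOn_of.2 fun i hi ↦ ?_, Sphere.suppOn_off β v,
        (Sphere.off_add β v).symm⟩
      rw [Sphere.off, hs i hi, ite_self]
    have hz : ∀ z : Sphere m', Sphere.SuppOn (Set.range α)ᶜ (t + Sphere.push β z) := fun z ↦
      htα.add ((Sphere.suppOn_push z β).mono (Set.subset_compl_iff_disjoint_left.2 h))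
    have hy : ∀ y : Sphere m, Sphere.SuppOn (Set.range β)ᶜ (t + Sphere.push α y) := fun y ↦
      htβ.add ((Sphere.suppOn_push y α).mono (Set.subset_compl_iff_disjoint_right.2 h))
    have e : ∀ y z, Sphere.smash α (⟨t + Sphere.push β z, hz z⟩, y) =
        Sphere.smash β (⟨t + Sphere.push α y, hy y⟩, z) := fun y z ↦ by
      simp only [Sphere.smash]
      abel
    have e' : Sphere.smash α (⟨Sphere.of v, Sphere.suppOn_of.2 hs⟩, y) =
        Sphere.smash α (⟨t + Sphere.push β z, hz z⟩, y) := by simp only [Sphere.smash, htz]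
    simp only [mul_smul', e']
    rw [map_smul_smash, e, e, map_smul_smash, map_smul_smash, ← e, map_smul_smash, e]

end F

/-! ### The bar construction -/

set_option linter.unusedSectionVars false

section Bar

/-- A point `(t₁, g₁), …, (t_k, g_k)` of `Δᵏ × Gᵏ`, with the simplex written as
`0 ≤ t₁ ≤ ⋯ ≤ t_k ≤ 1`. -/
abbrev Sorted {G : Type} (l : List (unitInterval × G)) : Prop :=
  l.Pairwise fun p q ↦ p.1 ≤ q.1

/-- The disjoint union of the spaces `Δᵏ × Gᵏ` for `k ≥ 0`. (The topology on lists is that of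
the disjoint union of the finite powers.) -/
abbrev BarWord (G : Type) : Type := {l : List (unitInterval × G) // Sorted l}

variable (G X : Type) [Monoid G] [SMul G X]

/-- The identifications in the realization `∐ Δᵏ × Gᵏ × X / ∼` of the simplicial bar
construction `B(*, G, X)`. -/
inductive BarRel : List (unitInterval × G) × X → List (unitInterval × G) × X → Prop
  /-- the degeneracies, `(g₁, …, g_k) ↦ (g₁, …, 1, …, g_k)` -/
  | degeneracy (l₁ l₂ : List (unitInterval × G)) (t : unitInterval) (x : X) :
      BarRel (l₁ ++ (t, 1) :: l₂, x) (l₁ ++ l₂, x)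
  /-- the inner faces, `(g₁, …, g_k) ↦ (g₁, …, gᵢ gᵢ₊₁, …, g_k)` -/
  | face (l₁ l₂ : List (unitInterval × G)) (t : unitInterval) (g g' : G) (x : X) :
      BarRel (l₁ ++ (t, g) :: (t, g') :: l₂, x) (l₁ ++ (t, g * g') :: l₂, x)
  /-- the first face, which drops `g₁` -/
  | first (l : List (unitInterval × G)) (g : G) (x : X) : BarRel ((0, g) :: l, x) (l, x)
  /-- the last face, in which `g_k` acts on `X` -/
  | last (l : List (unitInterval × G)) (g : G) (x : X) :
      BarRel (l ++ [(1, g)], x) (l, g • x)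

variable [TopologicalSpace G] [TopologicalSpace X]

/-- The bar construction `B(*, G, X)` of a topological monoid `G` acting on a space `X`. -/
def Bar : Type :=
  KQuot fun p q : BarWord G × X ↦ BarRel G X (p.1.1, p.2) (q.1.1, q.2)

end Bar

namespace Bar

variable {G H M X Y : Type} [Monoid G] [Monoid H] [Monoid M] [SMul G X] [SMul H Y]
  [TopologicalSpace G] [TopologicalSpace H] [TopologicalSpace M]
  [TopologicalSpace X] [TopologicalSpace Y]

instance : TopologicalSpace (Bar G X) := inferInstanceAs (TopologicalSpace (KQuot _))
instance : CGWH (Bar G X) := inferInstanceAs (CGWH (KQuot _))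

/-- The class of a point. -/
def mk (l : BarWord G) (x : X) : Bar G X := KQuot.mk (l, x)

theorem ind {p : Bar G X → Prop} (h : ∀ l x, p (mk l x)) (b : Bar G X) : p b :=
  KQuot.ind (fun a ↦ h a.1 a.2) b

theorem kcont_mk : KCont fun p : BarWord G × X ↦ mk p.1 p.2 := KQuot.kcont_mk

theorem sound {l l' : BarWord G} {x x' : X} (h : BarRel G X (l.1, x) (l'.1, x')) :
    mk l x = mk l' x' := KQuot.sound h

theorem sorted_map {l : List (unitInterval × G)} (h : Sorted l) (φ : G → H) :
    Sorted (l.map (Prod.map id φ)) := by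
  rw [Sorted, List.pairwise_map]
  exact h

/-- The effect of a map on the labels of a point of the bar construction. -/
def mapWord (φ : G → H) (l : BarWord G) : BarWord H :=
  ⟨l.1.map (Prod.map id φ), sorted_map l.2 φ⟩

theorem continuous_list_map {A B : Type} [TopologicalSpace A] [TopologicalSpace B] {f : A → B}
    (hf : Continuous f) : Continuous (List.map f) := by
  rw [continuous_iff_continuousAt]
  refine List.tendsto_nhds ?_ ?_
  · simp only [List.map_nil, nhds_nil]
    exact Filter.tendsto_pure_pure _ _
  · intro l a ih
    exact ((hf.tendsto a).comp Filter.tendsto_fst).cons (ih.comp Filter.tendsto_snd)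

theorem continuous_mapWord {φ : G → H} (hφ : Continuous φ) : Continuous (mapWord φ) :=
  ((continuous_list_map (continuous_id.prodMap hφ)).comp continuous_subtype_val).subtype_mk _

theorem BarRel.map (φ : G →* H) (ξ : X → Y) (h : ∀ (g : G) (x : X), ξ (g • x) = φ g • ξ x)
    {p q : List (unitInterval × G) × X} (hpq : BarRel G X p q) :
    BarRel H Y (p.1.map (Prod.map id φ), ξ p.2) (q.1.map (Prod.map id φ), ξ q.2) := by
  cases hpq with
  | degeneracy l₁ l₂ t x => simpa using BarRel.degeneracy _ _ t _
  | face l₁ l₂ t g g' x => simpa using BarRel.face _ _ t _ _ _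
  | first l g x => simpa using BarRel.first _ _ _
  | last l g x => simpa [h] using BarRel.last _ (φ g) (ξ x)

/-- The map `B(*, G, X) → B(*, H, Y)` induced by a homomorphism `φ : G → H` and a
`φ`-equivariant map `ξ : X → Y`. -/
def map (φ : G →* H) (hφ : Continuous φ) (ξ : X → Y) (hξ : Continuous ξ)
    (h : ∀ (g : G) (x : X), ξ (g • x) = φ g • ξ x) : Bar G X → Bar H Y :=
  KQuot.lift (fun p ↦ mk (mapWord φ p.1) (ξ p.2))
    (KCont.comp kcont_mk (kcont _ ((continuous_mapWord hφ).prodMap hξ)))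
    fun _ _ hr ↦ sound (BarRel.map φ ξ h hr)

theorem map_mk (φ : G →* H) (hφ : Continuous φ) (ξ : X → Y) (hξ : Continuous ξ)
    (h : ∀ (g : G) (x : X), ξ (g • x) = φ g • ξ x) (l : BarWord G) (x : X) :
    map φ hφ ξ hξ h (mk l x) = mk (mapWord φ l) (ξ x) := rfl

theorem continuous_map (φ : G →* H) (hφ : Continuous φ) (ξ : X → Y) (hξ : Continuous ξ)
    (h : ∀ (g : G) (x : X), ξ (g • x) = φ g • ξ x) : Continuous (map φ hφ ξ hξ h) :=
  KQuot.continuous_lift _ _ _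

theorem mapWord_id (l : BarWord G) : mapWord id l = l := Subtype.ext (by simp [mapWord])

theorem mapWord_comp (φ : G → H) (ψ : H → M) (l : BarWord G) :
    mapWord ψ (mapWord φ l) = mapWord (ψ ∘ φ) l := Subtype.ext (by simp [mapWord])

/-- The trivial action on the one-point space. -/
instance : SMul G Unit := ⟨fun _ x ↦ x⟩

/-! ### Products -/

/-- The product of the labels at time `τ`. -/
def label (l : List (unitInterval × G)) (τ : unitInterval) : G :=
  open Classical in (l.map fun p ↦ if p.1 = τ then p.2 else 1).prod

theorem label_nil (τ : unitInterval) : label ([] : List (unitInterval × G)) τ = 1 := rfl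

theorem label_cons_self (l : List (unitInterval × G)) (t : unitInterval) (g : G) :
    label ((t, g) :: l) t = g * label l t := by simp [label]

theorem label_cons_ne (l : List (unitInterval × G)) {t τ : unitInterval} (g : G) (h : t ≠ τ) :
    label ((t, g) :: l) τ = label l τ := by simp [label, h]

theorem label_append (l l' : List (unitInterval × G)) (τ : unitInterval) :
    label (l ++ l') τ = label l τ * label l' τ := by simp [label]

theorem label_map (φ : G →* H) (l : List (unitInterval × G)) (τ : unitInterval) :
    label (l.map (Prod.map id φ)) τ = φ (label l τ) := by
  induction l with
  | nil => simp [label]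
  | cons p l ih =>
    obtain ⟨t, g⟩ := p
    by_cases h : t = τ
    · subst h
      rw [List.map_cons, Prod.map_apply, id, label_cons_self, label_cons_self, ih, map_mul]
    · rw [List.map_cons, Prod.map_apply, id, label_cons_ne _ _ h, label_cons_ne _ _ h, ih]

theorem label_eq_one {l : List (unitInterval × G)} {τ : unitInterval} (h : ∀ p ∈ l, p.1 ≠ τ) :
    label l τ = 1 := by
  refine List.prod_eq_one fun g hg ↦ ?_
  obtain ⟨p, hp, rfl⟩ := List.mem_map.1 hg
  exact if_neg (h p hp)

/-- The word with times `T` and labels `f`. -/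
abbrev word (T : List unitInterval) (f : unitInterval → G) : List (unitInterval × G) :=
  T.map fun t ↦ (t, f t)

theorem sorted_append_word {l₁ : List (unitInterval × G)} {T : List unitInterval}
    (hl₁ : Sorted l₁) (hT : T.Pairwise (· < ·)) (h : ∀ p ∈ l₁, ∀ t ∈ T, p.1 ≤ t)
    (f : unitInterval → G) : Sorted (l₁ ++ word T f) := by
  refine List.pairwise_append.2 ⟨hl₁, ?_, ?_⟩
  · rw [List.pairwise_map]
    exact hT.imp le_of_lt
  · intro p hp q hq
    obtain ⟨t, ht, rfl⟩ := List.mem_map.1 hq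
    exact h p hp t ht

theorem word_congr {T : List unitInterval} {f f' : unitInterval → G} (h : ∀ t ∈ T, f t = f' t) :
    word T f = word T f' := List.map_congr_left fun t ht ↦ by rw [h t ht]

theorem mk_eq_mk_word (x : X) (T : List unitInterval) (hT : T.Pairwise (· < ·)) :
    ∀ (l l₁ : List (unitInterval × G)) (_ : ∀ p ∈ l, p.1 ∈ T)
      (_ : ∀ p ∈ l₁, ∀ t ∈ T, p.1 ≤ t) (h : Sorted (l₁ ++ l))
      (h' : Sorted (l₁ ++ word T (label l))),
      mk ⟨l₁ ++ l, h⟩ x = mk ⟨l₁ ++ word T (label l), h'⟩ x := by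
  induction T with
  | nil =>
    intro l l₁ hl _ h h'
    cases l with
    | nil => rfl
    | cons p l => exact absurd (hl p (by simp)) (by simp)
  | cons t T ihT =>
    obtain ⟨htT, hT'⟩ := List.pairwise_cons.1 hT
    have other : ∀ (l l₁ : List (unitInterval × G)) (_ : ∀ p ∈ l, p.1 ∈ T)
        (_ : ∀ p ∈ l₁, ∀ t' ∈ t :: T, p.1 ≤ t') (h : Sorted (l₁ ++ l))
        (h' : Sorted (l₁ ++ word (t :: T) (label l))),
        mk ⟨l₁ ++ l, h⟩ x = mk ⟨l₁ ++ word (t :: T) (label l), h'⟩ x := by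
      intro l l₁ hl h₁ h h'
      have hs := sorted_append_word (List.pairwise_append.1 h).1 hT'
        (fun p hp s hs ↦ h₁ p hp s (by simp [hs])) (label l)
      rw [ihT hT' l l₁ hl (fun p hp s hs ↦ h₁ p hp s (by simp [hs])) h hs]
      refine (sound ?_).symm
      have h1 : label l t = 1 := label_eq_one fun p hp hpt ↦
        (htT _ (hl p hp)).ne' hpt
      simp only [word, List.map_cons, h1]
      exact BarRel.degeneracy _ _ t x
    intro l
    induction l with
    | nil => exact fun l₁ _ h₁ h h' ↦ other [] l₁ (by simp) h₁ h h'
    | cons p l ih =>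
      intro l₁ hl h₁ h h'
      obtain ⟨s, g⟩ := p
      by_cases hs : s = t
      · subst hs
        have h2 : Sorted ((l₁ ++ [(s, g)]) ++ l) := by simpa using h
        have h₁' : ∀ p ∈ l₁ ++ [(s, g)], ∀ t ∈ s :: T, p.1 ≤ t := by
          intro p hp t ht
          rcases List.mem_append.1 hp with hp | hp
          · exact h₁ p hp t ht
          · rw [List.mem_singleton.1 hp]
            rcases List.mem_cons.1 ht with rfl | ht
            · exact le_rfl
            · exact (htT t ht).le
        have h3 : Sorted ((l₁ ++ [(s, g)]) ++ word (s :: T) (label l)) :=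
          sorted_append_word (List.pairwise_append.1 h2).1 hT h₁' _
        have e := ih (l₁ ++ [(s, g)]) (fun p hp ↦ hl p (by simp [hp])) h₁' h2 h3
        have e1 : (⟨l₁ ++ (s, g) :: l, h⟩ : BarWord G) = ⟨(l₁ ++ [(s, g)]) ++ l, h2⟩ :=
          Subtype.ext (by simp)
        rw [e1, e]
        refine sound ?_
        have hw : word (s :: T) (label ((s, g) :: l)) =
            (s, g * label l s) :: word T (label l) := by
          rw [word, List.map_cons, label_cons_self]
          congr 1
          exact word_congr fun t ht ↦ label_cons_ne _ _ (htT t ht).ne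
        simp only [hw, word, List.map_cons, List.append_assoc, List.cons_append, List.nil_append]
        exact BarRel.face _ _ s _ _ x
      · refine other _ l₁ ?_ h₁ h h'
        have hsT : s ∈ T := (List.mem_cons.1 (hl (s, g) (by simp))).resolve_left hs
        intro p hp
        rcases List.mem_cons.1 hp with rfl | hp'
        · exact hsT
        · refine (List.mem_cons.1 (hl p hp)).resolve_left fun hpt ↦ ?_
          have h4 := (List.pairwise_cons.1 (List.pairwise_append.1 h).2.1).1 p hp'
          rw [hpt] at h4
          exact absurd (htT s hsT) (not_lt.2 h4)

theorem mk_word_congr (T : List unitInterval) (hT : T.Pairwise (· < ·)) (f f' : unitInterval → G)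
    (hf : ∀ t, 0 < t → t < 1 → f t = f' t) (h : Sorted (word T f)) (h' : Sorted (word T f')) :
    mk ⟨word T f, h⟩ () = mk ⟨word T f', h'⟩ () := by
  have main : ∀ (T : List unitInterval) (_ : T.Pairwise (· < ·)) (_ : ∀ t ∈ T, 0 < t)
      (h : Sorted (word T f)) (h' : Sorted (word T f')),
      mk ⟨word T f, h⟩ () = mk ⟨word T f', h'⟩ () := by
    intro T hT hT0 h h'
    rcases List.eq_nil_or_concat T with rfl | ⟨T, t, hTt⟩
    · rfl
    · rw [List.concat_eq_append] at hTt
      subst hTt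
      have hlt : ∀ s ∈ T, s < t := fun s hs ↦ (List.pairwise_append.1 hT).2.2 s hs t (by simp)
      have hc : word T f = word T f' := word_congr fun s hs ↦
        hf s (hT0 s (by simp [hs])) ((hlt s hs).trans_le (unitInterval.le_one t))
      by_cases ht : t = 1
      · subst ht
        have hs : ∀ f : unitInterval → G, Sorted (word T f) := fun f ↦ by
          simpa using sorted_append_word (l₁ := []) List.Pairwise.nil
            (List.pairwise_append.1 hT).1 (by simp) f
        have e : ∀ (f : unitInterval → G) (h : Sorted (word (T ++ [1]) f)),
            mk ⟨word (T ++ [1]) f, h⟩ () = mk ⟨word T f, hs f⟩ () := fun f h ↦ by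
          refine sound ?_
          simp only [word, List.map_append, List.map_cons, List.map_nil]
          exact BarRel.last _ _ ()
        rw [e f h, e f' h']
        congr 2
      · congr 2
        refine word_congr fun s hs ↦ hf s (hT0 s hs) ?_
        rcases List.mem_append.1 hs with hs | hs
        · exact (hlt s hs).trans_le (unitInterval.le_one t)
        · rw [List.mem_singleton.1 hs]
          exact lt_of_le_of_ne (unitInterval.le_one t) ht
  cases T with
  | nil => rfl
  | cons t T =>
    obtain ⟨htT, hT'⟩ := List.pairwise_cons.1 hT
    by_cases ht : t = 0
    · subst ht
      have hs : ∀ f : unitInterval → G, Sorted (word T f) := fun f ↦ by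
        simpa using sorted_append_word (l₁ := []) List.Pairwise.nil hT' (by simp) f
      have e : ∀ (f : unitInterval → G) (h : Sorted (word (0 :: T) f)),
          mk ⟨word (0 :: T) f, h⟩ () = mk ⟨word T f, hs f⟩ () := fun f h ↦ sound (.first _ _ _)
      rw [e f h, e f' h']
      exact main T hT' htT _ _
    · refine main _ hT ?_ _ _
      intro s hs
      have h0 : 0 < t := lt_of_le_of_ne (unitInterval.nonneg t) (Ne.symm ht)
      rcases List.mem_cons.1 hs with rfl | hs
      · exact h0
      · exact h0.trans (htT s hs)

/-- A point of `BG` is determined by its labels in the open unit interval. -/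
theorem mk_eq_of_label {l l' : BarWord G}
    (h : ∀ t, 0 < t → t < 1 → label l.1 t = label l'.1 t) : mk l () = mk l' () := by
  classical
  let S : Finset unitInterval := (l.1.map Prod.fst).toFinset ∪ (l'.1.map Prod.fst).toFinset
  have hT : (S.sort (· ≤ ·)).Pairwise (· < ·) := S.sortedLT_sort.pairwise
  have hs : ∀ f : unitInterval → G, Sorted (word (S.sort (· ≤ ·)) f) := fun f ↦ by
    simpa using sorted_append_word (l₁ := []) List.Pairwise.nil hT (by simp) f
  have e1 := mk_eq_mk_word () (S.sort (· ≤ ·)) hT l.1 [] (fun p hp ↦ by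
    rw [Finset.mem_sort, Finset.mem_union, List.mem_toFinset]
    exact .inl (List.mem_map_of_mem hp)) (by simp) l.2 (hs _)
  have e2 := mk_eq_mk_word () (S.sort (· ≤ ·)) hT l'.1 [] (fun p hp ↦ by
    rw [Finset.mem_sort, Finset.mem_union, List.mem_toFinset, List.mem_toFinset]
    exact .inr (List.mem_map_of_mem hp)) (by simp) l'.2 (hs _)
  exact (e1.trans (mk_word_congr _ hT _ _ h _ _)).trans e2.symm

/-- The shuffle of two lists according to a pattern. -/
def shuf {A : Type} : List Bool → List A → List A → List A
  | true :: π, a :: u, v => a :: shuf π u v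
  | false :: π, u, b :: v => b :: shuf π u v
  | _, _, _ => []

/-- The pattern `π` matches the lengths of `u` and `v`. -/
abbrev Fits {A : Type} (π : List Bool) (u v : List A) : Prop :=
  π.count true = u.length ∧ π.count false = v.length

theorem continuous_shuf {A : Type} [TopologicalSpace A] (π : List Bool) :
    Continuous fun p : List A × List A ↦ shuf π p.1 p.2 := by
  induction π with
  | nil => simpa only [shuf] using continuous_const
  | cons b π ih =>
    rw [continuous_iff_continuousAt]
    rintro ⟨u, v⟩
    cases b with
    | true =>
      have h : Filter.Tendsto (fun p : List A × List A ↦ shuf (true :: π) p.1 p.2)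
          (𝓝 u ×ˢ 𝓝 v) (𝓝 (shuf (true :: π) u v)) := by
        cases u with
        | nil =>
          simp only [shuf, nhds_nil]
          rw [Filter.tendsto_pure]
          filter_upwards [Filter.prod_mem_prod (Filter.mem_pure.2 rfl) Filter.univ_mem]
          rintro ⟨u, v⟩ ⟨rfl, -⟩
          rfl
        | cons a u =>
          have : 𝓝 (a :: u) ×ˢ 𝓝 v = ((𝓝 a ×ˢ 𝓝 u) ×ˢ 𝓝 v).map
              (Prod.map (fun p : A × List A ↦ p.1 :: p.2) id) := by
            rw [← Filter.prod_map_map_eq', Filter.map_id]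
            congr 1
            simp only [nhds_cons, Filter.prod_eq, ← Filter.map_def, ← Filter.seq_eq_filter_seq]
            simp [-Filter.map_def, Function.comp_def, functor_norm]
          rw [this, Filter.tendsto_map'_iff]
          have hi := (ih.tendsto (u, v))
          rw [nhds_prod_eq] at hi
          exact (Filter.tendsto_fst.comp Filter.tendsto_fst).cons
            (hi.comp ((Filter.tendsto_snd.comp Filter.tendsto_fst).prodMk Filter.tendsto_snd))
      rwa [← nhds_prod_eq] at h
    | false =>
      have h : Filter.Tendsto (fun p : List A × List A ↦ shuf (false :: π) p.1 p.2)
          (𝓝 u ×ˢ 𝓝 v) (𝓝 (shuf (false :: π) u v)) := by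
        cases v with
        | nil =>
          simp only [shuf, nhds_nil]
          rw [Filter.tendsto_pure]
          filter_upwards [Filter.prod_mem_prod Filter.univ_mem (Filter.mem_pure.2 rfl)]
          rintro ⟨u, v⟩ ⟨-, rfl⟩
          simp [shuf]
        | cons a v =>
          have : 𝓝 u ×ˢ 𝓝 (a :: v) = (𝓝 u ×ˢ (𝓝 a ×ˢ 𝓝 v)).map
              (Prod.map id (fun p : A × List A ↦ p.1 :: p.2)) := by
            rw [← Filter.prod_map_map_eq', Filter.map_id]
            congr 1
            simp only [nhds_cons, Filter.prod_eq, ← Filter.map_def, ← Filter.seq_eq_filter_seq]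
            simp [-Filter.map_def, Function.comp_def, functor_norm]
          rw [this, Filter.tendsto_map'_iff]
          have hi := (ih.tendsto (u, v))
          rw [nhds_prod_eq] at hi
          have := (Filter.tendsto_fst.comp Filter.tendsto_snd).cons
            (hi.comp (Filter.tendsto_fst.prodMk (Filter.tendsto_snd.comp
              (Filter.tendsto_snd (f := 𝓝 u) (g := 𝓝 a ×ˢ 𝓝 v)))))
          refine this.congr ?_
          rintro ⟨u, a, v⟩
          simp [shuf]
      rwa [← nhds_prod_eq] at h

theorem label_shuf (π : List Bool) : ∀ (u v : List (unitInterval × M)) (_ : Fits π u v)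
    (_ : ∀ p ∈ u, ∀ q ∈ v, Commute p.2 q.2) (τ : unitInterval),
    label (shuf π u v) τ = label u τ * label v τ := by
  induction π with
  | nil =>
    rintro u v ⟨h1, h2⟩ - τ
    rw [List.length_eq_zero_iff.1 h1.symm, List.length_eq_zero_iff.1 h2.symm]
    simp [shuf, label]
  | cons b π ih =>
    rintro u v ⟨h1, h2⟩ hc τ
    cases b with
    | true =>
      cases u with
      | nil => simp at h1
      | cons p u =>
        obtain ⟨t, g⟩ := p
        have := ih u v ⟨by simpa using h1, by simpa using h2⟩
          (fun p hp q hq ↦ hc p (by simp [hp]) q hq) τ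
        by_cases ht : t = τ
        · subst ht
          simp only [shuf, label_cons_self, this, mul_assoc]
        · simp only [shuf, label_cons_ne _ _ ht, this]
    | false =>
      cases v with
      | nil => simp at h2
      | cons p v =>
        obtain ⟨t, g⟩ := p
        have := ih u v ⟨by simpa using h1, by simpa using h2⟩
          (fun p hp q hq ↦ hc p hp q (by simp [hq])) τ
        by_cases ht : t = τ
        · subst ht
          simp only [shuf, label_cons_self, this]
          have hcu : Commute (label u t) g := by
            refine Commute.list_prod_left _ _ fun x hx ↦ ?_
            obtain ⟨p, hp, rfl⟩ := List.mem_map.1 hx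
            split_ifs
            · exact hc p hp (t, g) (by simp)
            · exact Commute.one_left _
          rw [← mul_assoc, ← hcu.eq, mul_assoc]
        · simp only [shuf, label_cons_ne _ _ ht, this]

theorem exists_shuf : ∀ (u v : List (unitInterval × M)) (_ : Sorted u) (_ : Sorted v),
    ∃ π, Fits π u v ∧ Sorted (shuf π u v) ∧ ∀ p ∈ shuf π u v, p ∈ u ∨ p ∈ v
  | [], [], _, _ => ⟨[], ⟨rfl, rfl⟩, List.Pairwise.nil, by simp [shuf]⟩
  | p :: u, [], hu, hv => by
    obtain ⟨π, h1, h2, h3⟩ := exists_shuf u [] (List.pairwise_cons.1 hu).2 hv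
    refine ⟨true :: π, ⟨by simpa using h1.1, by simpa using h1.2⟩, ?_, ?_⟩
    · refine List.pairwise_cons.2 ⟨fun q hq ↦ ?_, h2⟩
      exact (List.pairwise_cons.1 hu).1 q ((h3 q hq).resolve_right (by simp))
    · intro q hq
      rcases List.mem_cons.1 hq with rfl | hq
      · simp
      · have := h3 q hq
        simp_all
  | [], q :: v, hu, hv => by
    obtain ⟨π, h1, h2, h3⟩ := exists_shuf [] v hu (List.pairwise_cons.1 hv).2
    refine ⟨false :: π, ⟨by simpa using h1.1, by simpa using h1.2⟩, ?_, ?_⟩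
    · rw [shuf]
      refine List.pairwise_cons.2 ⟨fun q hq ↦ ?_, h2⟩
      exact (List.pairwise_cons.1 hv).1 q ((h3 q hq).resolve_left (by simp))
    · intro p hp
      rw [shuf] at hp
      rcases List.mem_cons.1 hp with rfl | hp
      · simp
      · have := h3 p hp
        simp_all
  | p :: u, q :: v, hu, hv => by
    by_cases hpq : p.1 ≤ q.1
    · obtain ⟨π, h1, h2, h3⟩ := exists_shuf u (q :: v) (List.pairwise_cons.1 hu).2 hv
      refine ⟨true :: π, ⟨by simpa using h1.1, by simpa using h1.2⟩, ?_, ?_⟩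
      · refine List.pairwise_cons.2 ⟨fun r hr ↦ ?_, h2⟩
        rcases h3 r hr with h | h
        · exact (List.pairwise_cons.1 hu).1 r h
        · rcases List.mem_cons.1 h with rfl | h
          · exact hpq
          · exact hpq.trans ((List.pairwise_cons.1 hv).1 r h)
      · intro r hr
        rcases List.mem_cons.1 hr with rfl | hr
        · simp
        · rcases h3 r hr with h | h <;> simp [h]
    · obtain ⟨π, h1, h2, h3⟩ := exists_shuf (p :: u) v hu (List.pairwise_cons.1 hv).2
      refine ⟨false :: π, ⟨by simpa using h1.1, by simpa using h1.2⟩, ?_, ?_⟩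
      · rw [shuf]
        refine List.pairwise_cons.2 ⟨fun r hr ↦ ?_, h2⟩
        rcases h3 r hr with h | h
        · rcases List.mem_cons.1 h with rfl | h
          · exact (not_le.1 hpq).le
          · exact (not_le.1 hpq).le.trans ((List.pairwise_cons.1 hu).1 r h)
        · exact (List.pairwise_cons.1 hv).1 r h
      · intro r hr
        rw [shuf] at hr
        rcases List.mem_cons.1 hr with rfl | hr
        · simp
        · rcases h3 r hr with h | h <;> simp [h]
termination_by u v => u.length + v.length

theorem isClosed_sorted : IsClosed {l : List (unitInterval × M) | Sorted l} := by
  let minT : List (unitInterval × M) → unitInterval := List.foldr (fun p t ↦ min p.1 t) 1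
  have hmin : Continuous minT := by
    rw [continuous_iff_continuousAt]
    refine List.tendsto_nhds ?_ ?_
    · exact tendsto_pure_nhds _ _
    · intro l a ih
      exact ((continuous_fst.tendsto a).comp Filter.tendsto_fst).min (ih.comp Filter.tendsto_snd)
  have hle : ∀ (t : unitInterval) (l : List (unitInterval × M)),
      t ≤ minT l ↔ ∀ q ∈ l, t ≤ q.1 := by
    intro t l
    induction l with
    | nil => exact ⟨fun _ _ h ↦ absurd h (by simp), fun _ ↦ unitInterval.le_one'⟩
    | cons p l ih =>
      change t ≤ min p.1 (minT l) ↔ _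
      rw [le_min_iff, ih]
      simp
  rw [← isOpen_compl_iff, isOpen_iff_mem_nhds]
  intro l
  induction l with
  | nil => exact fun h ↦ absurd List.Pairwise.nil h
  | cons p l ih =>
    intro h
    have key : Filter.Tendsto id (𝓝 (p :: l)) (Filter.principal {l | Sorted l}ᶜ) := by
      rw [List.tendsto_cons_iff, Filter.tendsto_principal]
      by_cases hl : Sorted l
      · have hp : ¬ p.1 ≤ minT l := fun hp ↦ h (List.pairwise_cons.2 ⟨(hle _ _).1 hp, hl⟩)
        have hop : IsOpen {x : (unitInterval × M) × List (unitInterval × M) |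
            minT x.2 < x.1.1} := isOpen_lt (by fun_prop) (by fun_prop)
        have := hop.mem_nhds (x := (p, l)) (not_le.1 hp)
        rw [nhds_prod_eq] at this
        filter_upwards [this] with x hx hs
        exact absurd ((hle _ _).2 (List.pairwise_cons.1 hs).1) (not_le.2 hx)
      · filter_upwards [Filter.prod_mem_prod Filter.univ_mem (ih hl)] with x hx hs
        exact hx.2 (List.pairwise_cons.1 hs).2
    exact Filter.tendsto_principal.1 key

/-- The sorted union of two words in the same monoid. -/
def mergeWord (u v : BarWord M) : BarWord M :=
  ⟨shuf (exists_shuf u.1 v.1 u.2 v.2).choose u.1 v.1,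
    (exists_shuf u.1 v.1 u.2 v.2).choose_spec.2.1⟩

section
variable (i : G →* M) (j : H →* M)

theorem commute_map (hc : ∀ g h, Commute (i g) (j h)) (u : List (unitInterval × G))
    (v : List (unitInterval × H)) : ∀ p ∈ u.map (Prod.map id i), ∀ q ∈ v.map (Prod.map id j),
      Commute p.2 q.2 := by
  intro p hp q hq
  obtain ⟨a, -, rfl⟩ := List.mem_map.1 hp
  obtain ⟨b, -, rfl⟩ := List.mem_map.1 hq
  exact hc _ _

theorem label_mergeWord (hc : ∀ g h, Commute (i g) (j h)) (u : BarWord G) (v : BarWord H)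
    (τ : unitInterval) : label (mergeWord (mapWord i u) (mapWord j v)).1 τ =
      i (label u.1 τ) * j (label v.1 τ) := by
  have h := (exists_shuf _ _ (mapWord i u).2 (mapWord j v).2).choose_spec.1
  have := label_shuf _ _ _ h (commute_map i j hc u.1 v.1) τ
  rw [← label_map, ← label_map]
  exact this

theorem kcont_merge (hi : Continuous i) (hj : Continuous j)
    (hc : ∀ g h, Commute (i g) (j h)) :
    KCont fun p : BarWord G × BarWord H ↦
      mk (mergeWord (mapWord i p.1) (mapWord j p.2)) () := by
  intro K k
  let u : CH K → List (unitInterval × M) := fun x ↦ (mapWord i (k x).1).1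
  let v : CH K → List (unitInterval × M) := fun x ↦ (mapWord j (k x).2).1
  have hu : Continuous u := continuous_subtype_val.comp ((continuous_mapWord hi).comp
    (continuous_fst.comp k.continuous))
  have hv : Continuous v := continuous_subtype_val.comp ((continuous_mapWord hj).comp
    (continuous_snd.comp k.continuous))
  have hlen : Continuous (List.length : List (unitInterval × M) → ℕ) :=
    continuous_iff_continuousAt.2 List.continuousAt_length
  let C : List Bool → Set (CH K) := fun π ↦ {x | Fits π (u x) (v x) ∧ Sorted (shuf π (u x) (v x))}
  have hsh : ∀ π, Continuous fun x ↦ shuf π (u x) (v x) := fun π ↦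
    (continuous_shuf π).comp (hu.prodMk hv)
  have hC : ∀ π, IsClosed (C π) := fun π ↦
    ((isClosed_eq continuous_const (hlen.comp hu)).inter
      (isClosed_eq continuous_const (hlen.comp hv))).inter (isClosed_sorted.preimage (hsh π))
  have hfin : LocallyFinite C := by
    intro x
    refine ⟨{y | (u y).length = (u x).length} ∩ {y | (v y).length = (v x).length}, ?_, ?_⟩
    · exact Filter.inter_mem
        ((hlen.comp hu).continuousAt (IsOpen.mem_nhds (isOpen_discrete {(u x).length}) rfl))
        ((hlen.comp hv).continuousAt (IsOpen.mem_nhds (isOpen_discrete {(v x).length}) rfl))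
    · refine (List.finite_length_eq Bool ((u x).length + (v x).length)).subset ?_
      rintro π ⟨y, ⟨⟨h1, h2⟩, -⟩, h3, h4⟩
      have := List.count_true_add_count_false π
      simp only [Set.mem_ofPred_eq] at h3 h4 ⊢
      omega
  refine hfin.continuous ?_ hC ?_
  · refine Set.eq_univ_of_forall fun x ↦ Set.mem_iUnion.2 ?_
    obtain ⟨π, h1, h2, -⟩ := exists_shuf (u x) (v x) (mapWord i (k x).1).2 (mapWord j (k x).2).2
    exact ⟨π, h1, h2⟩
  · intro π
    rw [continuousOn_iff_continuous_domRestrict]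
    have : CompactSpace (C π) := isCompact_iff_compactSpace.1 (hC π).isCompact
    let w : C(C π, BarWord M × Unit) := ⟨fun x ↦ (⟨shuf π (u x) (v x), x.2.2⟩, ()),
      (((hsh π).comp continuous_subtype_val).subtype_mk _).prodMk continuous_const⟩
    have h := @kcont_mk M Unit _ _ _ _ (CompHaus.of (C π)) w
    convert h using 1
    funext x
    refine mk_eq_of_label fun t _ _ ↦ ?_
    rw [label_mergeWord i j hc, ← label_map, ← label_map]
    exact (label_shuf π _ _ x.2.1 (commute_map i j hc _ _) t).symm

theorem label_eq_of_rel {l l' : List (unitInterval × G)} (h : BarRel G Unit (l, ()) (l', ()))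
    (t : unitInterval) (h0 : 0 < t) (h1 : t < 1) : label l t = label l' t := by
  generalize hp : (l, ()) = p at h
  generalize hq : (l', ()) = q at h
  cases h with
  | degeneracy l₁ l₂ s x =>
    cases hp; cases hq
    by_cases hs : s = t
    · subst hs
      simp [label_append, label_cons_self]
    · simp [label_append, label_cons_ne _ _ hs]
  | face l₁ l₂ s g g' x =>
    cases hp; cases hq
    by_cases hs : s = t
    · subst hs
      simp [label_append, label_cons_self, mul_assoc]
    · simp [label_append, label_cons_ne _ _ hs]
  | first l g x =>
    cases hp; cases hq
    exact label_cons_ne _ _ h0.ne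
  | last l g x =>
    cases hp; cases hq
    simp [label_append, label_cons_ne _ _ h1.ne', label_nil]

/-- For homomorphisms `i : G → M` and `j : H → M` with commuting images, the composite map
`BG × BH ≅ B(G × H) → BM`. The inverse of the homeomorphism `B(G × H) ≅ BG × BH` is given by
subdivision: it unites the two sets of times. -/
def merge (i : G →* M) (j : H →* M) (hi : Continuous i) (hj : Continuous j)
    (hc : ∀ g h, Commute (i g) (j h)) (b : Bar G Unit) (c : Bar H Unit) : Bar M Unit :=
  KQuot.lift (fun p : BarWord G × Unit ↦ KQuot.lift (fun q : BarWord H × Unit ↦ mk (mergeWord (mapWord i p.1) (mapWord j q.1)) ())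
    ((KCont.comp (kcont_merge i j hi hj hc) (kcont (fun q : BarWord H × Unit ↦ (p.1, q.1))
      (by fun_prop)) :))
    (fun _ _ hr ↦ mk_eq_of_label fun t h0 h1 ↦ by
      rw [label_mergeWord i j hc, label_mergeWord i j hc, label_eq_of_rel hr t h0 h1]) c)
    (by
      induction c using ind with | h l x
      exact (KCont.comp (kcont_merge i j hi hj hc) (kcont (fun q : BarWord G × Unit ↦ (q.1, l))
        (by fun_prop)) :))
    (fun _ _ hr ↦ by
      induction c using ind with | h l x
      exact mk_eq_of_label fun t h0 h1 ↦ by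
        rw [label_mergeWord i j hc, label_mergeWord i j hc, label_eq_of_rel hr t h0 h1]) b

variable (hi : Continuous i) (hj : Continuous j) (hc : ∀ g h, Commute (i g) (j h))

theorem merge_mk (u : BarWord G) (v : BarWord H) : merge i j hi hj hc (mk u ()) (mk v ()) =
    mk (mergeWord (mapWord i u) (mapWord j v)) () := rfl

theorem kcont_merge' : KCont fun p : Bar G Unit × Bar H Unit ↦ merge i j hi hj hc p.1 p.2 := by
  refine KQuot.kcont_prod ?_
  refine KQuot.kcont_prod_right (B := BarWord G × Unit) (f := fun p ↦ merge i j hi hj hc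
    (KQuot.mk p.1) p.2) ?_
  exact (KCont.comp (kcont_merge i j hi hj hc)
    (kcont (fun q : (BarWord G × Unit) × (BarWord H × Unit) ↦ (q.1.1, q.2.1))
      (by fun_prop)) :)

end

end Bar

/-! ### `ℐ`-spaces -/

/-- An `ℐ`-space: a functor from the category `ℐ` of the finite sets `{1, …, n}`, `n ≥ 0`, and
injective maps to the category of compactly generated weak Hausdorff spaces. -/
structure ISpace where
  /-- the spaces -/
  obj : ℕ → Type
  [top : ∀ n, TopologicalSpace (obj n)]
  [cgwh : ∀ n, CGWH (obj n)]
  /-- the induced maps -/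
  map {m n : ℕ} (α : Fin m ↪ Fin n) : obj m → obj n
  continuous_map {m n : ℕ} (α : Fin m ↪ Fin n) : Continuous (map α)
  map_refl {n : ℕ} (x : obj n) : map (.refl _) x = x
  map_trans {l m n : ℕ} (α : Fin l ↪ Fin m) (β : Fin m ↪ Fin n) (x : obj l) :
    map (α.trans β) x = map β (map α x)

attribute [instance] ISpace.top ISpace.cgwh

namespace ISpace

/-- A natural transformation of `ℐ`-spaces. -/
@[ext]
structure Hom (X Y : ISpace) where
  /-- the components -/
  app {n : ℕ} : X.obj n → Y.obj n
  continuous_app {n : ℕ} : Continuous (app (n := n))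
  naturality {m n : ℕ} (α : Fin m ↪ Fin n) (x : X.obj m) : app (X.map α x) = Y.map α (app x)

instance : Category ISpace where
  Hom := Hom
  id X := ⟨fun x ↦ x, continuous_id, fun _ _ ↦ rfl⟩
  comp f g := ⟨fun x ↦ g.app (f.app x), g.continuous_app.comp f.continuous_app, fun α x ↦ by
    rw [f.naturality, g.naturality]⟩

variable {W X Y Z X' Y' Z' : ISpace}

theorem hom_ext {f g : X ⟶ Y} (h : ∀ {n : ℕ} (x : X.obj n), f.app x = g.app x) : f = g :=
  Hom.ext (funext fun _ ↦ funext fun x ↦ h x)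

@[simp]
theorem id_app {n : ℕ} (x : X.obj n) : Hom.app (𝟙 X) x = x := rfl

@[simp]
theorem comp_app (f : X ⟶ Y) (g : Y ⟶ Z) {n : ℕ} (x : X.obj n) :
    (f ≫ g).app x = g.app (f.app x) := rfl

/-- An object `(a, b, a ⊔ b → n)` of the comma category `(⊔ ↓ n)`. -/
structure BoxIndex (n : ℕ) where
  /-- the first number -/
  left : ℕ
  /-- the second number -/
  right : ℕ
  /-- the injective map -/
  emb : Fin left ⊕ Fin right ↪ Fin n

/-- The disjoint union of the spaces `X(a) × Y(b)` over the objects of `(⊔ ↓ n)`. -/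
abbrev BoxPre (X Y : ISpace) (n : ℕ) : Type :=
  Σ i : BoxIndex n, X.obj i.left × Y.obj i.right

/-- The identifications made along the morphisms of `(⊔ ↓ n)`. -/
inductive BoxRel (X Y : ISpace) (n : ℕ) : BoxPre X Y n → BoxPre X Y n → Prop
  | shift {a b a' b' : ℕ} (β : Fin a ↪ Fin a') (γ : Fin b ↪ Fin b')
      (α : Fin a' ⊕ Fin b' ↪ Fin n) (x : X.obj a) (y : Y.obj b) :
      BoxRel X Y n ⟨⟨a, b, (β.sumMap γ).trans α⟩, (x, y)⟩ ⟨⟨a', b', α⟩, (X.map β x, Y.map γ y)⟩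

theorem kcont_sigma_prod {ι : Type} {A : ι → Type} [∀ i, TopologicalSpace (A i)] {B C : Type}
    [TopologicalSpace B] [TopologicalSpace C] {f : (Σ i, A i) × B → C}
    (h : ∀ i, KCont fun p : A i × B ↦ f (⟨i, p.1⟩, p.2)) : KCont f := by
  have h1 : KCont fun p : Σ i, A i × B ↦ f (⟨p.1, p.2.1⟩, p.2.2) := KCont.sigma h
  exact (KCont.comp h1 (kcont _ Homeomorph.sigmaProdDistrib.continuous) :)

/-- The `n`-th space of the box product. -/
abbrev BoxObj (X Y : ISpace) (n : ℕ) : Type := KQuot (BoxRel X Y n)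

theorem boxRel_map {m n : ℕ} (δ : Fin m ↪ Fin n) (p q : BoxPre X Y m) (h : BoxRel X Y m p q) :
    (KQuot.mk ⟨⟨p.1.left, p.1.right, p.1.emb.trans δ⟩, p.2⟩ : BoxObj X Y n) =
      KQuot.mk ⟨⟨q.1.left, q.1.right, q.1.emb.trans δ⟩, q.2⟩ := by
  cases h with
  | shift β γ α x y => exact KQuot.sound (.shift β γ (α.trans δ) x y)

/-- The box product of `ℐ`-spaces, `(X ⊠ Y)(n) = colim X(a) × Y(b)`, where the colimit is over
the objects `a ⊔ b → n` of `(⊔ ↓ n)`. -/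
def box (X Y : ISpace) : ISpace where
  obj := BoxObj X Y
  map δ := KQuot.lift (fun p ↦ KQuot.mk ⟨⟨p.1.left, p.1.right, p.1.emb.trans δ⟩, p.2⟩)
    (KCont.sigma fun i ↦ (KCont.comp KQuot.kcont_mk (kcont (fun p : X.obj i.left × Y.obj i.right ↦
      (⟨⟨i.left, i.right, i.emb.trans δ⟩, p⟩ : BoxPre X Y _))
      (continuous_sigmaMk (σ := fun i : BoxIndex _ ↦ X.obj i.left × Y.obj i.right)
        (i := ⟨i.left, i.right, i.emb.trans δ⟩))) :))
    (boxRel_map δ)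
  continuous_map δ := KQuot.continuous_lift _ _ _
  map_refl w := by
    induction w using KQuot.ind with | h p
    rfl
  map_trans β γ w := by
    induction w using KQuot.ind with | h p
    rfl

/-- The point of `(X ⊠ Y)(n)` represented by points of `X(a)` and `Y(b)` and
`α : a ⊔ b → n`. -/
def t {a b n : ℕ} (α : Fin a ⊕ Fin b ↪ Fin n) (x : X.obj a) (y : Y.obj b) : (box X Y).obj n :=
  KQuot.mk (r := BoxRel X Y n) ⟨⟨a, b, α⟩, (x, y)⟩

section
variable {a b c a' b' c' m n : ℕ}

theorem box_map_t (δ : Fin m ↪ Fin n) (α : Fin a ⊕ Fin b ↪ Fin m) (x : X.obj a) (y : Y.obj b) :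
    (box X Y).map δ (t α x y) = t (α.trans δ) x y := rfl

theorem t_shift (β : Fin a ↪ Fin a') (γ : Fin b ↪ Fin b')
    (α : Fin a' ⊕ Fin b' ↪ Fin n) (x : X.obj a) (y : Y.obj b) :
    t ((β.sumMap γ).trans α) x y = t α (X.map β x) (Y.map γ y) :=
  KQuot.sound (r := BoxRel X Y n) (.shift β γ α x y)

theorem kcont_t (α : Fin a ⊕ Fin b ↪ Fin n) :
    KCont fun p : X.obj a × Y.obj b ↦ t α p.1 p.2 :=
  (KCont.comp (KQuot.kcont_mk (r := BoxRel X Y n)) (kcont (fun p : X.obj a × Y.obj b ↦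
    (⟨⟨a, b, α⟩, p⟩ : BoxPre X Y n))
    (continuous_sigmaMk (σ := fun i : BoxIndex n ↦ X.obj i.left × Y.obj i.right)
      (i := ⟨a, b, α⟩))) :)

theorem kcont_t_comp {S : Type} [TopologicalSpace S] (α : Fin a ⊕ Fin b ↪ Fin n) {f : S → X.obj a}
    {g : S → Y.obj b} (hf : KCont f) (hg : KCont g) : KCont fun p ↦ t α (f p) (g p) :=
  (KCont.comp (kcont_t α) (hf.prodMk hg) :)

theorem box_ind {p : (box X Y).obj n → Prop}
    (h : ∀ {a b : ℕ} (α : Fin a ⊕ Fin b ↪ Fin n) (x : X.obj a) (y : Y.obj b), p (t α x y))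
    (w : (box X Y).obj n) : p w :=
  KQuot.ind (r := BoxRel X Y n) (fun ⟨⟨_, _, α⟩, (x, y)⟩ ↦ h α x y) w

variable {T B : Type} [TopologicalSpace T] [TopologicalSpace B]

theorem kcont_box {f : (box X Y).obj n × B → T}
    (h : ∀ {a b : ℕ} (α : Fin a ⊕ Fin b ↪ Fin n),
      KCont fun p : (X.obj a × Y.obj b) × B ↦ f (t α p.1.1 p.1.2, p.2)) : KCont f :=
  KQuot.kcont_prod (r := BoxRel X Y n) (kcont_sigma_prod fun i ↦ h i.emb)

/-- Maps out of the box product. -/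
def boxLift [CGWH T] (φ : ∀ {a b : ℕ}, (Fin a ⊕ Fin b ↪ Fin n) → X.obj a → Y.obj b → T)
    (hφ : ∀ {a b : ℕ} (α : Fin a ⊕ Fin b ↪ Fin n),
      KCont fun p : X.obj a × Y.obj b ↦ φ α p.1 p.2)
    (h : ∀ {a b a' b' : ℕ} (β : Fin a ↪ Fin a') (γ : Fin b ↪ Fin b')
      (α : Fin a' ⊕ Fin b' ↪ Fin n) (x : X.obj a) (y : Y.obj b),
      φ ((β.sumMap γ).trans α) x y = φ α (X.map β x) (Y.map γ y)) : (box X Y).obj n → T :=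
  KQuot.lift (r := BoxRel X Y n) (fun p ↦ φ p.1.emb p.2.1 p.2.2)
    (KCont.sigma fun i ↦ hφ i.emb) fun _ _ hr ↦ by
    cases hr with
    | shift β γ α x y => exact h β γ α x y

theorem boxLift_t [CGWH T] (φ : ∀ {a b : ℕ}, (Fin a ⊕ Fin b ↪ Fin n) → X.obj a → Y.obj b → T)
    (hφ : ∀ {a b : ℕ} (α : Fin a ⊕ Fin b ↪ Fin n),
      KCont fun p : X.obj a × Y.obj b ↦ φ α p.1 p.2)
    (h : ∀ {a b a' b' : ℕ} (β : Fin a ↪ Fin a') (γ : Fin b ↪ Fin b')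
      (α : Fin a' ⊕ Fin b' ↪ Fin n) (x : X.obj a) (y : Y.obj b),
      φ ((β.sumMap γ).trans α) x y = φ α (X.map β x) (Y.map γ y))
    (α : Fin a ⊕ Fin b ↪ Fin n) (x : X.obj a) (y : Y.obj b) :
    boxLift φ hφ h (t α x y) = φ α x y := rfl

end

/-- A map out of the box product. -/
def boxDesc (φ : ∀ {a b n : ℕ}, (Fin a ⊕ Fin b ↪ Fin n) → X.obj a → Y.obj b → Z.obj n)
    (hφ : ∀ {a b n : ℕ} (α : Fin a ⊕ Fin b ↪ Fin n),
      KCont fun p : X.obj a × Y.obj b ↦ φ α p.1 p.2)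
    (h : ∀ {a b a' b' n : ℕ} (β : Fin a ↪ Fin a') (γ : Fin b ↪ Fin b')
      (α : Fin a' ⊕ Fin b' ↪ Fin n) (x : X.obj a) (y : Y.obj b),
      φ ((β.sumMap γ).trans α) x y = φ α (X.map β x) (Y.map γ y))
    (h' : ∀ {a b m n : ℕ} (α : Fin a ⊕ Fin b ↪ Fin m) (δ : Fin m ↪ Fin n) (x : X.obj a)
      (y : Y.obj b), φ (α.trans δ) x y = Z.map δ (φ α x y)) : box X Y ⟶ Z where
  app := boxLift φ hφ h
  continuous_app {n} := KQuot.continuous_lift (r := BoxRel X Y n) _ _ _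
  naturality δ w := by
    induction w using box_ind with | h α x y
    exact h' α δ x y

theorem box_hom_ext {f g : box X Y ⟶ Z}
    (h : ∀ {a b n : ℕ} (α : Fin a ⊕ Fin b ↪ Fin n) (x : X.obj a) (y : Y.obj b),
      f.app (t α x y) = g.app (t α x y)) : f = g :=
  hom_ext fun w ↦ by
    induction w using box_ind with | h α x y
    exact h α x y

section Trilinear
variable {a b c a' b' c' m n : ℕ}

/-- A point of `X ⊠ (Y ⊠ Z)`. -/
def tR (γ : Fin a ⊕ (Fin b ⊕ Fin c) ↪ Fin n) (x : X.obj a) (y : Y.obj b) (z : Z.obj c) :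
    (box X (box Y Z)).obj n :=
  t (((Function.Embedding.refl _).sumMap finSumFinEquiv.symm.toEmbedding).trans γ) x
    (t finSumFinEquiv.toEmbedding y z : (box Y Z).obj (b + c))

/-- A point of `(X ⊠ Y) ⊠ Z`. -/
def tL (γ : (Fin a ⊕ Fin b) ⊕ Fin c ↪ Fin n) (x : X.obj a) (y : Y.obj b) (z : Z.obj c) :
    (box (box X Y) Z).obj n :=
  t ((finSumFinEquiv.symm.toEmbedding.sumMap (Function.Embedding.refl _)).trans γ)
    (t finSumFinEquiv.toEmbedding x y : (box X Y).obj (a + b)) z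

theorem t_t_right (α : Fin a ⊕ Fin m ↪ Fin n) (β : Fin b ⊕ Fin c ↪ Fin m) (x : X.obj a)
    (y : Y.obj b) (z : Z.obj c) :
    (t α x (t β y z : (box Y Z).obj m) : (box X (box Y Z)).obj n) =
      tR (((Function.Embedding.refl _).sumMap β).trans α) x y z := by
  have h := t_shift (X := X) (Y := box Y Z) (.refl _) (finSumFinEquiv.symm.toEmbedding.trans β) α
    x (t finSumFinEquiv.toEmbedding y z : (box Y Z).obj (b + c))
  rw [X.map_refl] at h
  have e : (finSumFinEquiv.toEmbedding.trans (finSumFinEquiv.symm.toEmbedding.trans β) :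
      Fin b ⊕ Fin c ↪ Fin m) = β := by ext i; simp
  change _ = t α x (t (finSumFinEquiv.toEmbedding.trans
    (finSumFinEquiv.symm.toEmbedding.trans β)) y z : (box Y Z).obj m) at h
  rw [e] at h
  rw [← h]
  unfold tR
  congr 1
  ext (i | i) <;> simp

theorem t_t_left (α : Fin m ⊕ Fin c ↪ Fin n) (β : Fin a ⊕ Fin b ↪ Fin m) (x : X.obj a)
    (y : Y.obj b) (z : Z.obj c) :
    (t α (t β x y : (box X Y).obj m) z : (box (box X Y) Z).obj n) =
      tL ((β.sumMap (Function.Embedding.refl _)).trans α) x y z := by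
  have h := t_shift (X := box X Y) (Y := Z) (finSumFinEquiv.symm.toEmbedding.trans β) (.refl _) α
    (t finSumFinEquiv.toEmbedding x y : (box X Y).obj (a + b)) z
  rw [Z.map_refl] at h
  have e : (finSumFinEquiv.toEmbedding.trans (finSumFinEquiv.symm.toEmbedding.trans β) :
      Fin a ⊕ Fin b ↪ Fin m) = β := by ext i; simp
  change _ = t α (t (finSumFinEquiv.toEmbedding.trans
    (finSumFinEquiv.symm.toEmbedding.trans β)) x y : (box X Y).obj m) z at h
  rw [e] at h
  rw [← h]
  unfold tL
  congr 1
  ext (i | i) <;> simp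

theorem tR_shift (β : Fin a ↪ Fin a') (γ : Fin b ↪ Fin b') (δ : Fin c ↪ Fin c')
    (α : Fin a' ⊕ (Fin b' ⊕ Fin c') ↪ Fin n) (x : X.obj a) (y : Y.obj b) (z : Z.obj c) :
    tR ((β.sumMap (γ.sumMap δ)).trans α) x y z =
      tR α (X.map β x) (Y.map γ y) (Z.map δ z) := by
  rw [tR, tR, ← t_shift, t_t_right]
  have h := t_shift (X := X) (Y := box Y Z) β (.refl _)
    (((Function.Embedding.refl _).sumMap finSumFinEquiv.symm.toEmbedding).trans α) x
    (t ((γ.sumMap δ).trans finSumFinEquiv.toEmbedding) y z : (box Y Z).obj (b' + c'))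
  rw [(box Y Z).map_refl] at h
  refine Eq.trans ?_ h
  rw [t_t_right]
  congr 1
  ext (i | i | i) <;> simp

theorem tL_shift (β : Fin a ↪ Fin a') (γ : Fin b ↪ Fin b') (δ : Fin c ↪ Fin c')
    (α : (Fin a' ⊕ Fin b') ⊕ Fin c' ↪ Fin n) (x : X.obj a) (y : Y.obj b) (z : Z.obj c) :
    tL (((β.sumMap γ).sumMap δ).trans α) x y z =
      tL α (X.map β x) (Y.map γ y) (Z.map δ z) := by
  rw [tL, tL, ← t_shift, t_t_left]
  have h := t_shift (X := box X Y) (Y := Z) (.refl _) δ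
    ((finSumFinEquiv.symm.toEmbedding.sumMap (Function.Embedding.refl _)).trans α)
    (t ((β.sumMap γ).trans finSumFinEquiv.toEmbedding) x y : (box X Y).obj (a' + b')) z
  rw [(box X Y).map_refl] at h
  refine Eq.trans ?_ h
  rw [t_t_left]
  congr 1
  ext ((i | i) | i) <;> simp

theorem kcont_tR (α : Fin a ⊕ (Fin b ⊕ Fin c) ↪ Fin n) :
    KCont fun p : (X.obj a × Y.obj b) × Z.obj c ↦ tR α p.1.1 p.1.2 p.2 :=
  kcont_t_comp _ (kcont _ (by fun_prop)) (kcont_t_comp _ (kcont _ (by fun_prop))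
    (kcont _ (by fun_prop)))

theorem kcont_tL (α : (Fin a ⊕ Fin b) ⊕ Fin c ↪ Fin n) :
    KCont fun p : (Y.obj b × Z.obj c) × X.obj a ↦ tL α p.2 p.1.1 p.1.2 :=
  kcont_t_comp _ (kcont_t_comp _ (kcont _ (by fun_prop)) (kcont _ (by fun_prop)))
    (kcont _ (by fun_prop))

end Trilinear

/-- The associativity isomorphism on representatives. -/
def assocHomAux {b m n : ℕ} (α : Fin m ⊕ Fin b ↪ Fin n) (w : (box X Y).obj m) (z : Z.obj b) :
    (box X (box Y Z)).obj n :=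
  boxLift (fun β x y ↦ tR ((Equiv.sumAssoc _ _ _).symm.toEmbedding.trans
      ((β.sumMap (Function.Embedding.refl _)).trans α)) x y z)
    (fun {c d} β ↦ (KCont.comp (kcont_tR _) (kcont (fun p : X.obj c × Y.obj d ↦ (p, z))
      (by fun_prop)) :))
    (fun β γ δ x y ↦ by
      nth_rw 2 [← Z.map_refl z]
      rw [← tR_shift]
      congr 1
      ext (i | i | i) <;> simp) w

theorem assocHomAux_t {a b c m n : ℕ} (α : Fin m ⊕ Fin c ↪ Fin n) (β : Fin a ⊕ Fin b ↪ Fin m)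
    (x : X.obj a) (y : Y.obj b) (z : Z.obj c) :
    assocHomAux α (t β x y) z = tR ((Equiv.sumAssoc _ _ _).symm.toEmbedding.trans
        ((β.sumMap (Function.Embedding.refl _)).trans α)) x y z := rfl

/-- The associativity isomorphism. -/
def assocHom (X Y Z : ISpace) : box (box X Y) Z ⟶ box X (box Y Z) :=
  boxDesc assocHomAux
    (fun α ↦ kcont_box fun β ↦ by
      simp only [assocHomAux_t]
      exact kcont_tR _)
    (fun β γ α w z ↦ by
      induction w using box_ind with | h δ x y
      rw [box_map_t, assocHomAux_t, assocHomAux_t]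
      nth_rw 2 [← X.map_refl x, ← Y.map_refl y]
      rw [← tR_shift]
      congr 1
      ext (i | i | i) <;> simp)
    (fun α δ w z ↦ by
      induction w using box_ind with | h β x y
      rfl)

/-- The inverse of the associativity isomorphism on representatives. -/
def assocInvAux {a m n : ℕ} (α : Fin a ⊕ Fin m ↪ Fin n) (x : X.obj a) (w : (box Y Z).obj m) :
    (box (box X Y) Z).obj n :=
  boxLift (fun β y z ↦ tL ((Equiv.sumAssoc _ _ _).toEmbedding.trans
      (((Function.Embedding.refl _).sumMap β).trans α)) x y z)
    (fun {c d} β ↦ (KCont.comp (kcont_tL _) (kcont (fun p : Y.obj c × Z.obj d ↦ (p, x))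
      (by fun_prop)) :))
    (fun β γ δ y z ↦ by
      nth_rw 2 [← X.map_refl x]
      rw [← tL_shift]
      congr 1
      ext ((i | i) | i) <;> simp) w

theorem assocInvAux_t {a b c m n : ℕ} (α : Fin a ⊕ Fin m ↪ Fin n) (β : Fin b ⊕ Fin c ↪ Fin m)
    (x : X.obj a) (y : Y.obj b) (z : Z.obj c) :
    assocInvAux α x (t β y z) = tL ((Equiv.sumAssoc _ _ _).toEmbedding.trans
        (((Function.Embedding.refl _).sumMap β).trans α)) x y z := rfl

/-- The inverse of the associativity isomorphism. -/
def assocInv (X Y Z : ISpace) : box X (box Y Z) ⟶ box (box X Y) Z :=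
  boxDesc assocInvAux
    (fun {a b n} α ↦ by
      have h := kcont_box (X := Y) (Y := Z) (n := b) (B := X.obj a)
        (f := fun p ↦ assocInvAux α p.2 p.1) (fun β ↦ by
          simp only [assocInvAux_t]
          exact kcont_tL _)
      exact (KCont.comp h (kcont (fun p : X.obj a × (box Y Z).obj b ↦ (p.2, p.1))
        (by fun_prop)) :))
    (fun β γ α x w ↦ by
      induction w using box_ind with | h δ y z
      rw [box_map_t, assocInvAux_t, assocInvAux_t]
      nth_rw 2 [← Y.map_refl y, ← Z.map_refl z]
      rw [← tL_shift]
      congr 1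
      ext ((i | i) | i) <;> simp)
    (fun α δ x w ↦ by
      induction w using box_ind with | h β y z
      rfl)

section
variable {a b c m n : ℕ}

theorem assocHom_t (α : Fin m ⊕ Fin c ↪ Fin n) (β : Fin a ⊕ Fin b ↪ Fin m) (x : X.obj a)
    (y : Y.obj b) (z : Z.obj c) :
    (assocHom X Y Z).app (t α (t β x y) z) =
      tR ((Equiv.sumAssoc _ _ _).symm.toEmbedding.trans
        ((β.sumMap (Function.Embedding.refl _)).trans α)) x y z := rfl

theorem assocInv_t (α : Fin a ⊕ Fin m ↪ Fin n) (β : Fin b ⊕ Fin c ↪ Fin m) (x : X.obj a)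
    (y : Y.obj b) (z : Z.obj c) :
    (assocInv X Y Z).app (t α x (t β y z)) =
      tL ((Equiv.sumAssoc _ _ _).toEmbedding.trans
        (((Function.Embedding.refl _).sumMap β).trans α)) x y z := rfl

end

/-- The associativity isomorphism. -/
def assoc (X Y Z : ISpace) : box (box X Y) Z ≅ box X (box Y Z) where
  hom := assocHom X Y Z
  inv := assocInv X Y Z
  hom_inv_id := box_hom_ext fun α w z ↦ by
    induction w using box_ind with | h β x y
    rw [comp_app, assocHom_t, tR, assocInv_t, id_app, t_t_left]
    congr 1
    ext ((i | i) | i) <;> simp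
  inv_hom_id := box_hom_ext fun α x w ↦ by
    induction w using box_ind with | h β y z
    rw [comp_app, assocInv_t, tL, assocHom_t, id_app, t_t_right]
    congr 1
    ext (i | i | i) <;> simp

/-- The box product of two morphisms. -/
def boxMap (f : X ⟶ X') (g : Y ⟶ Y') : box X Y ⟶ box X' Y' :=
  boxDesc (fun α x y ↦ t α (f.app x) (g.app y))
    (fun α ↦ kcont_t_comp α (kcont _ (f.continuous_app.comp continuous_fst))
      (kcont _ (g.continuous_app.comp continuous_snd)))
    (fun β γ α x y ↦ by rw [t_shift, f.naturality, g.naturality])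
    (fun α δ x y ↦ rfl)

@[simp]
theorem boxMap_t (f : X ⟶ X') (g : Y ⟶ Y') {a b n : ℕ} (α : Fin a ⊕ Fin b ↪ Fin n)
    (x : X.obj a) (y : Y.obj b) :
    (boxMap f g).app (t α x y) = t α (f.app x) (g.app y) := rfl

/-- The symmetry isomorphism. -/
def swap (X Y : ISpace) : box X Y ⟶ box Y X :=
  boxDesc (fun α x y ↦ t ((Equiv.sumComm _ _).toEmbedding.trans α) y x)
    (fun α ↦ kcont_t_comp _ (kcont _ continuous_snd) (kcont _ continuous_fst))
    (fun β γ α x y ↦ by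
      rw [← t_shift]
      congr 1
      ext (i | i) <;> simp)
    (fun α δ x y ↦ rfl)

@[simp]
theorem swap_t {a b n : ℕ} (α : Fin a ⊕ Fin b ↪ Fin n) (x : X.obj a) (y : Y.obj b) :
    (swap X Y).app (t α x y) = t ((Equiv.sumComm _ _).toEmbedding.trans α) y x := rfl

theorem swap_swap (X Y : ISpace) : swap X Y ≫ swap Y X = 𝟙 _ := box_hom_ext fun α x y ↦ by
  rw [comp_app, swap_t, swap_t, id_app]
  congr 1
  ext (i | i) <;> rfl

/-- The unit: the constant one-point space, `ℐ(0, -)`. -/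
def unit : ISpace where
  obj _ := Unit
  map _ x := x
  continuous_map _ := continuous_id
  map_refl _ := rfl
  map_trans _ _ _ := rfl

/-- The left unit isomorphism. -/
def leftUnit (X : ISpace) : box unit X ≅ X where
  hom := boxDesc (fun α _ x ↦ X.map (Function.Embedding.inr.trans α) x)
    (fun {a b n} α ↦ (KCont.comp (kcont _ (X.continuous_map _))
      (kcont (fun p : unit.obj a × X.obj b ↦ p.2) (by fun_prop)) :))
    (fun β γ α _ x ↦ by
      rw [← X.map_trans]
      rfl)
    (fun α δ _ x ↦ X.map_trans (Function.Embedding.inr.trans α) δ x)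
  inv :=
    { app := fun {n} x ↦ t (X := unit) (Y := X) (a := 0) (Equiv.emptySum _ _).toEmbedding () x
      continuous_app := (kcont_t_comp _ (kcont _ continuous_const)
        (kcont _ continuous_id)).continuous
      naturality := fun α x ↦ by
        rw [← X.map_refl (X.map α x), ← X.map_trans]
        have h := t_shift (X := unit) (Y := X) (.refl (Fin 0)) α (Equiv.emptySum _ _).toEmbedding
          () x
        refine Eq.trans h.symm ?_
        change _ = t ((Equiv.emptySum _ _).toEmbedding.trans α) _ x
        congr 1
        ext (i | i)
        · exact i.elim0
        · rfl }
  hom_inv_id := box_hom_ext fun {a b n} α x y ↦ by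
    rw [comp_app, id_app]
    change t (X := unit) (Y := X) (a := 0) (Equiv.emptySum _ _).toEmbedding () (X.map _ y) = _
    have h := t_shift (X := unit) (Y := X) (.refl (Fin 0)) (Function.Embedding.inr.trans α)
      (Equiv.emptySum _ _).toEmbedding () y
    have h' := t_shift (X := unit) (Y := X) (⟨Fin.elim0, fun i ↦ i.elim0⟩ : Fin 0 ↪ Fin a)
      (.refl _) α () y
    rw [X.map_refl] at h'
    refine h.symm.trans (Eq.trans ?_ h')
    congr 1
    ext (i | i)
    · exact i.elim0
    · rfl
  inv_hom_id := hom_ext fun x ↦ X.map_refl x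

theorem leftUnit_t {a b n : ℕ} (α : Fin a ⊕ Fin b ↪ Fin n) (u : unit.obj a) (x : X.obj b) :
    (leftUnit X).hom.app (t α u x) = X.map (Function.Embedding.inr.trans α) x := rfl

instance : MonoidalCategoryStruct ISpace where
  tensorObj := box
  tensorHom := boxMap
  whiskerLeft X _ _ f := boxMap (𝟙 X) f
  whiskerRight f Y := boxMap f (𝟙 Y)
  tensorUnit := unit
  associator := assoc
  leftUnitor := leftUnit
  rightUnitor X := ⟨swap X unit, swap unit X, swap_swap _ _, swap_swap _ _⟩ ≪≫ leftUnit X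

section
variable {a b c m n : ℕ}

theorem tensor_t (f : X ⟶ X') (g : Y ⟶ Y') (α : Fin a ⊕ Fin b ↪ Fin n) (x : X.obj a)
    (y : Y.obj b) : (f ⊗ₘ g).app (t α x y) = t α (f.app x) (g.app y) := rfl

theorem leftUnitor_t (α : Fin a ⊕ Fin b ↪ Fin n) (u : (𝟙_ ISpace).obj a) (x : X.obj b) :
    (λ_ X).hom.app (t α u x) = X.map (Function.Embedding.inr.trans α) x := rfl

theorem rightUnitor_t (α : Fin a ⊕ Fin b ↪ Fin n) (x : X.obj a) (u : (𝟙_ ISpace).obj b) :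
    (ρ_ X).hom.app (t α x u) = X.map (Function.Embedding.inl.trans α) x := rfl

theorem associator_t (α : Fin m ⊕ Fin c ↪ Fin n) (β : Fin a ⊕ Fin b ↪ Fin m) (x : X.obj a)
    (y : Y.obj b) (z : Z.obj c) :
    (α_ X Y Z).hom.app (t α (t β x y) z) =
      tR ((Equiv.sumAssoc _ _ _).symm.toEmbedding.trans
        ((β.sumMap (Function.Embedding.refl _)).trans α)) x y z := rfl

theorem associator_inv_t (α : Fin a ⊕ Fin m ↪ Fin n) (β : Fin b ⊕ Fin c ↪ Fin m) (x : X.obj a)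
    (y : Y.obj b) (z : Z.obj c) :
    (α_ X Y Z).inv.app (t α x (t β y z)) =
      tL ((Equiv.sumAssoc _ _ _).toEmbedding.trans
        (((Function.Embedding.refl _).sumMap β).trans α)) x y z := rfl

end

theorem pentagon_aux (W X Y Z : ISpace) :
    ((α_ W X Y).hom ⊗ₘ 𝟙 Z) ≫ (α_ W (X ⊗ Y) Z).hom ≫ (𝟙 W ⊗ₘ (α_ X Y Z).hom) =
      (α_ (W ⊗ X) Y Z).hom ≫ (α_ W X (Y ⊗ Z)).hom := box_hom_ext fun α v z ↦ by
  induction v using box_ind with | h β v y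
  induction v using box_ind with | h γ w x
  simp only [comp_app]
  rw [tensor_t, associator_t, associator_t, tR, tR, associator_t, tR, associator_t, tR, tensor_t,
    associator_t, tR]
  refine (t_t_right _ _ _ _ _).trans (Eq.trans ?_ (t_t_right _ _ _ _ _).symm)
  simp only [id_app]
  congr 1
  ext (i | i | i)
  · simp
  · simp
  · obtain ⟨(i | i), rfl⟩ := finSumFinEquiv.surjective i <;> simp

theorem triangle_aux (X Y : ISpace) :
    (α_ X (𝟙_ ISpace) Y).hom ≫ (𝟙 X ⊗ₘ (λ_ Y).hom) = (ρ_ X).hom ⊗ₘ 𝟙 Y :=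
  box_hom_ext fun α w y ↦ by
    induction w using box_ind with | h β x u
    rw [comp_app, associator_t, tR, tensor_t, tensor_t, leftUnitor_t, rightUnitor_t, id_app,
      id_app]
    nth_rw 1 [← X.map_refl x]
    nth_rw 2 [← Y.map_refl y]
    rw [← t_shift, ← t_shift]
    congr 1
    ext (i | i) <;> simp

instance : MonoidalCategory ISpace := MonoidalCategory.ofTensorHom
  (id_tensorHom_id := fun _ _ ↦ box_hom_ext fun _ _ _ ↦ rfl)
  (id_tensorHom := fun _ _ _ _ ↦ rfl)
  (tensorHom_id := fun _ _ ↦ rfl)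
  (tensorHom_comp_tensorHom := fun _ _ _ _ ↦ box_hom_ext fun _ _ _ ↦ rfl)
  (associator_naturality := fun _ _ _ ↦ box_hom_ext fun α w z ↦ by
    induction w using box_ind with | h β x y
    rfl)
  (leftUnitor_naturality := fun f ↦ box_hom_ext fun α u x ↦
    (f.naturality (Function.Embedding.inr.trans α) x).symm)
  (rightUnitor_naturality := fun f ↦ box_hom_ext fun α x u ↦
    (f.naturality (Function.Embedding.inl.trans α) x).symm)
  (pentagon := pentagon_aux)
  (triangle := triangle_aux)

/-- The symmetry isomorphism. -/
def braid (X Y : ISpace) : X ⊗ Y ≅ Y ⊗ X := ⟨swap X Y, swap Y X, swap_swap _ _, swap_swap _ _⟩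

theorem braid_t {a b n : ℕ} (α : Fin a ⊕ Fin b ↪ Fin n) (x : X.obj a) (y : Y.obj b) :
    (braid X Y).hom.app (t α x y) = t ((Equiv.sumComm _ _).toEmbedding.trans α) y x := rfl

theorem whiskerLeft_t (X : ISpace) (g : Y ⟶ Y') {a b n : ℕ} (α : Fin a ⊕ Fin b ↪ Fin n)
    (x : X.obj a) (y : Y.obj b) : (X ◁ g).app (t α x y) = t α x (g.app y) := rfl

theorem whiskerRight_t (f : X ⟶ X') (Y : ISpace) {a b n : ℕ} (α : Fin a ⊕ Fin b ↪ Fin n)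
    (x : X.obj a) (y : Y.obj b) : (f ▷ Y).app (t α x y) = t α (f.app x) y := rfl

theorem hexagon_aux (X Y Z : ISpace) :
    (α_ X Y Z).hom ≫ (braid X (Y ⊗ Z)).hom ≫ (α_ Y Z X).hom =
      ((braid X Y).hom ▷ Z) ≫ (α_ Y X Z).hom ≫ (Y ◁ (braid X Z).hom) :=
  box_hom_ext fun α w z ↦ by
    induction w using box_ind with | h β x y
    simp only [comp_app]
    rw [associator_t, tR, braid_t, associator_t, whiskerRight_t, braid_t, associator_t,
      tR, tR, whiskerLeft_t, braid_t]
    refine (t_t_right _ _ _ _ _).trans (Eq.trans ?_ (t_t_right _ _ _ _ _).symm)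
    congr 1
    ext (i | i | i) <;> simp

theorem hexagon_aux' (X Y Z : ISpace) :
    (α_ X Y Z).inv ≫ (braid (X ⊗ Y) Z).hom ≫ (α_ Z X Y).inv =
      (X ◁ (braid Y Z).hom) ≫ (α_ X Z Y).inv ≫ ((braid X Z).hom ▷ Y) :=
  box_hom_ext fun α x w ↦ by
    induction w using box_ind with | h β y z
    simp only [comp_app]
    rw [associator_inv_t, tL, braid_t, associator_inv_t, whiskerLeft_t, braid_t,
      associator_inv_t, tL, tL, whiskerRight_t, braid_t]
    refine (t_t_left _ _ _ _ _).trans (Eq.trans ?_ (t_t_left _ _ _ _ _).symm)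
    congr 1
    ext ((i | i) | i) <;> simp

instance : SymmetricCategory ISpace where
  braiding := braid
  braiding_naturality_right _ _ _ _ := box_hom_ext fun _ _ _ ↦ rfl
  braiding_naturality_left _ _ := box_hom_ext fun _ _ _ ↦ rfl
  hexagon_forward := hexagon_aux
  hexagon_reverse := hexagon_aux'
  symmetry X Y := swap_swap X Y

theorem braiding_t {a b n : ℕ} (α : Fin a ⊕ Fin b ↪ Fin n) (x : X.obj a) (y : Y.obj b) :
    (β_ X Y).hom.app (t α x y) = t ((Equiv.sumComm _ _).toEmbedding.trans α) y x := rfl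

end ISpace

/-! ### The commutative `ℐ`-space monoid `BF` -/

theorem Bar.label_mapWord {G H : Type} [Monoid G] [Monoid H] [TopologicalSpace G]
    [TopologicalSpace H] (φ : G →* H) (l : BarWord G) (τ : unitInterval) :
    Bar.label (Bar.mapWord φ l).1 τ = φ (Bar.label l.1 τ) := Bar.label_map φ l.1 τ

/-- The space `BF(n) = B(*, F(n), *)`. -/
abbrev BFObj (n : ℕ) : Type := Bar (F n) Unit

/-- The `ℐ`-space `BF`. -/
def BF : ISpace where
  obj := BFObj
  map α := Bar.map (F.map α) (F.continuous_map α) id continuous_id fun _ _ ↦ rfl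
  continuous_map α := Bar.continuous_map _ _ _ _ _
  map_refl b := by
    induction b using Bar.ind with | h l x
    refine Bar.mk_eq_of_label fun t _ _ ↦ ?_
    rw [Bar.label_mapWord, F.map_refl]
  map_trans α β b := by
    induction b using Bar.ind with | h l x
    refine Bar.mk_eq_of_label fun t _ _ ↦ ?_
    rw [Bar.label_mapWord, Bar.label_mapWord, Bar.label_mapWord, F.map_trans]

namespace BF

/-- A point of `BF(n)`. -/
def mk {n : ℕ} (l : BarWord (F n)) : BF.obj n := Bar.mk l ()

theorem ind {n : ℕ} {p : BF.obj n → Prop} (h : ∀ l, p (mk l)) (b : BF.obj n) : p b :=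
  Bar.ind (fun l _ ↦ h l) b

theorem mk_eq {n : ℕ} {l l' : BarWord (F n)}
    (h : ∀ t, 0 < t → t < 1 → Bar.label l.1 t = Bar.label l'.1 t) : mk l = mk l' :=
  Bar.mk_eq_of_label h

theorem map_mk {m n : ℕ} (α : Fin m ↪ Fin n) (l : BarWord (F m)) :
    BF.map α (mk l) = mk (Bar.mapWord (F.map α) l) := rfl

section
variable {a b a' b' m n : ℕ}

theorem commute (α : Fin a ⊕ Fin b ↪ Fin n) (f : F a) (g : F b) :
    Commute (F.map (Function.Embedding.inl.trans α) f)
      (F.map (Function.Embedding.inr.trans α) g) := by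
  refine F.map_comm _ _ ?_ f g
  rw [Set.disjoint_left]
  rintro _ ⟨i, rfl⟩ ⟨j, hj⟩
  exact absurd (α.injective hj) (by simp)

/-- For `α : a ⊔ b → n`, the map `BF(a) × BF(b) ≅ B(F(a) × F(b)) → BF(n)` induced by the
homomorphism `F(a) × F(b) → F(n)` that takes `(f, g)` to
`S^{n-α} ∧ f ∧ g = (S^{n-α} ∧ f ∧ Sᵇ) (S^{n-α} ∧ Sᵃ ∧ g)`. -/
def mulAux (α : Fin a ⊕ Fin b ↪ Fin n) (x : BF.obj a) (y : BF.obj b) : BF.obj n :=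
  Bar.merge (F.map (Function.Embedding.inl.trans α)) (F.map (Function.Embedding.inr.trans α))
    (F.continuous_map _) (F.continuous_map _) (commute α) x y

/-- A representative of the product. -/
def mulWord (α : Fin a ⊕ Fin b ↪ Fin n) (l : BarWord (F a)) (l' : BarWord (F b)) :
    BarWord (F n) :=
  Bar.mergeWord (Bar.mapWord (F.map (Function.Embedding.inl.trans α)) l)
    (Bar.mapWord (F.map (Function.Embedding.inr.trans α)) l')

theorem mulAux_mk (α : Fin a ⊕ Fin b ↪ Fin n) (l : BarWord (F a)) (l' : BarWord (F b)) :
    mulAux α (mk l) (mk l') = mk (mulWord α l l') := rfl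

theorem label_mulWord (α : Fin a ⊕ Fin b ↪ Fin n) (l : BarWord (F a)) (l' : BarWord (F b))
    (t : unitInterval) : Bar.label (mulWord α l l').1 t =
      F.map (Function.Embedding.inl.trans α) (Bar.label l.1 t) *
        F.map (Function.Embedding.inr.trans α) (Bar.label l'.1 t) :=
  Bar.label_mergeWord _ _ (commute α) l l' t

end

/-- The multiplication of `BF`. -/
def mul : BF ⊗ BF ⟶ BF :=
  ISpace.boxDesc mulAux (fun α ↦ Bar.kcont_merge' _ _ _ _ (commute α))
    (fun β γ α x y ↦ by
      induction x using ind with | h l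
      induction y using ind with | h l'
      rw [map_mk, map_mk, mulAux_mk, mulAux_mk]
      refine mk_eq fun t _ _ ↦ ?_
      rw [label_mulWord, label_mulWord, Bar.label_mapWord, Bar.label_mapWord, ← F.map_trans,
        ← F.map_trans]
      rfl)
    (fun α δ x y ↦ by
      induction x using ind with | h l
      induction y using ind with | h l'
      rw [mulAux_mk, mulAux_mk, map_mk]
      refine mk_eq fun t _ _ ↦ ?_
      rw [label_mulWord, Bar.label_mapWord, label_mulWord, map_mul, ← F.map_trans, ← F.map_trans]
      rfl)

theorem mul_t {a b n : ℕ} (α : Fin a ⊕ Fin b ↪ Fin n) (x : BF.obj a) (y : BF.obj b) :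
    mul.app (ISpace.t α x y) = mulAux α x y := rfl

/-- The empty word. -/
def nil (n : ℕ) : BarWord (F n) := ⟨[], List.Pairwise.nil⟩

/-- The unit of `BF`. -/
def one : 𝟙_ ISpace ⟶ BF where
  app {n} _ := mk (nil n)
  continuous_app := continuous_const
  naturality _ _ := rfl

theorem one_app {n : ℕ} (u : (𝟙_ ISpace).obj n) : one.app u = mk (nil n) := rfl

theorem label_nil {n : ℕ} (t : unitInterval) : Bar.label (nil n).1 t = 1 := rfl

theorem one_mul : one ▷ BF ≫ mul = (λ_ BF).hom := ISpace.box_hom_ext fun α u y ↦ by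
  induction y using ind with | h l'
  rw [ISpace.comp_app, ISpace.whiskerRight_t, mul_t, one_app, mulAux_mk, ISpace.leftUnitor_t,
    map_mk]
  refine mk_eq fun t _ _ ↦ ?_
  rw [label_mulWord, Bar.label_mapWord, label_nil, map_one, _root_.one_mul]

theorem mul_one : BF ◁ one ≫ mul = (ρ_ BF).hom := ISpace.box_hom_ext fun α x u ↦ by
  induction x using ind with | h l'
  rw [ISpace.comp_app, ISpace.whiskerLeft_t, mul_t, one_app, mulAux_mk, ISpace.rightUnitor_t,
    map_mk]
  refine mk_eq fun t _ _ ↦ ?_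
  rw [label_mulWord, Bar.label_mapWord, label_nil, map_one, _root_.mul_one]

theorem map_congr {m n : ℕ} {α β : Fin m ↪ Fin n} (h : ∀ i, α i = β i) (f : F m) :
    F.map α f = F.map β f := by rw [show α = β from Function.Embedding.ext h]

theorem mul_assoc : mul ▷ BF ≫ mul = (α_ BF BF BF).hom ≫ BF ◁ mul ≫ mul :=
  ISpace.box_hom_ext fun α w z ↦ by
    induction w using ISpace.box_ind with | h β x y
    induction x using ind with | h l₁
    induction y using ind with | h l₂
    induction z using ind with | h l₃
    simp only [ISpace.comp_app]
    rw [ISpace.whiskerRight_t, ISpace.associator_t, ISpace.tR, ISpace.whiskerLeft_t, mul_t, mul_t,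
      mul_t, mul_t, mulAux_mk, mulAux_mk, mulAux_mk, mulAux_mk]
    refine mk_eq fun t _ _ ↦ ?_
    simp only [label_mulWord, map_mul, ← F.map_trans, _root_.mul_assoc]
    refine congrArg₂ _ (map_congr (fun i ↦ ?_) _) (congrArg₂ _ (map_congr (fun i ↦ ?_) _)
      (map_congr (fun i ↦ ?_) _)) <;> simp

theorem mul_comm : (β_ BF BF).hom ≫ mul = mul := ISpace.box_hom_ext fun α x y ↦ by
  induction x using ind with | h l
  induction y using ind with | h l'
  rw [ISpace.comp_app, ISpace.braiding_t, mul_t, mul_t, mulAux_mk, mulAux_mk]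
  refine mk_eq fun t _ _ ↦ ?_
  rw [label_mulWord, label_mulWord, (commute α _ _).eq]
  rfl

/-- `BF` is a monoid with respect to the box product. -/
instance : MonObj BF where
  one := one
  mul := mul
  one_mul := one_mul
  mul_one := mul_one
  mul_assoc := mul_assoc

/-- The monoid `BF` is commutative. -/
instance : IsCommMonObj BF where
  mul_comm := mul_comm

end BF

/-! ### The symmetric monoidal category of objects over a commutative monoid -/

namespace OverMon

universe v u

variable {C : Type u} [Category.{v} C] [MonoidalCategory C] [SymmetricCategory C]
  (P : C) [MonObj P] [IsCommMonObj P]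

open scoped MonObj

theorem assoc_hom {X Y Z : C} (f : X ⟶ P) (g : Y ⟶ P) (h : Z ⟶ P) :
    (α_ X Y Z).hom ≫ (f ⊗ₘ ((g ⊗ₘ h) ≫ μ)) ≫ μ = (((f ⊗ₘ g) ≫ μ) ⊗ₘ h) ≫ μ := by
  have h1 : (f ⊗ₘ ((g ⊗ₘ h) ≫ μ)) = (f ⊗ₘ (g ⊗ₘ h)) ≫ (P ◁ μ) := by
    rw [← id_tensorHom, tensorHom_comp_tensorHom, Category.comp_id]
  have h2 : (((f ⊗ₘ g) ≫ μ) ⊗ₘ h) = ((f ⊗ₘ g) ⊗ₘ h) ≫ (μ ▷ P) := by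
    rw [← tensorHom_id, tensorHom_comp_tensorHom, Category.comp_id]
  rw [h1, h2, Category.assoc, Category.assoc, MonObj.mul_assoc, associator_naturality_assoc]

theorem one_hom {X : C} (f : X ⟶ P) : (λ_ X).hom ≫ f = (η ⊗ₘ f) ≫ μ := by
  rw [MonoidalCategory.tensorHom_def', Category.assoc, MonObj.one_mul, leftUnitor_naturality]

theorem hom_one {X : C} (f : X ⟶ P) : (ρ_ X).hom ≫ f = (f ⊗ₘ η) ≫ μ := by
  rw [MonoidalCategory.tensorHom_def, Category.assoc, MonObj.mul_one, rightUnitor_naturality]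

theorem braiding_hom {X Y : C} (f : X ⟶ P) (g : Y ⟶ P) :
    (β_ X Y).hom ≫ (g ⊗ₘ f) ≫ μ = (f ⊗ₘ g) ≫ μ := by
  rw [← BraidedCategory.braiding_naturality_assoc, IsCommMonObj.mul_comm]

/-- The product of `f : X → P` and `g : Y → P` is `X ⊗ Y → P ⊗ P → P`, and the unit is the unit
of `P`. -/
@[reducible]
def monoidalStruct : MonoidalCategoryStruct (Over P) where
  tensorObj X Y := Over.mk ((X.hom ⊗ₘ Y.hom) ≫ μ[P])
  tensorHom f g := Over.homMk (f.left ⊗ₘ g.left) (by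
    simp [tensorHom_comp_tensorHom_assoc])
  whiskerLeft X _ _ f := Over.homMk (X.left ◁ f.left) (by
    simp [← id_tensorHom, tensorHom_comp_tensorHom_assoc])
  whiskerRight f Y := Over.homMk (f.left ▷ Y.left) (by
    simp [← tensorHom_id, tensorHom_comp_tensorHom_assoc])
  tensorUnit := Over.mk η[P]
  associator X Y Z := Over.isoMk (α_ X.left Y.left Z.left) (assoc_hom P _ _ _)
  leftUnitor X := Over.isoMk (λ_ X.left) (one_hom P _)
  rightUnitor X := Over.isoMk (ρ_ X.left) (hom_one P _)

/-- The monoidal structure on the category of objects over `P`. -/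
@[reducible]
def monoidal : MonoidalCategory (Over P) :=
  letI := monoidalStruct P
  { tensorHom_def := fun _ _ ↦ Over.OverMorphism.ext (tensorHom_def _ _)
    id_tensorHom_id := fun _ _ ↦ Over.OverMorphism.ext (id_tensorHom_id _ _)
    tensorHom_comp_tensorHom := fun _ _ _ _ ↦
      Over.OverMorphism.ext (tensorHom_comp_tensorHom _ _ _ _)
    whiskerLeft_id := fun _ _ ↦ Over.OverMorphism.ext (MonoidalCategory.whiskerLeft_id _ _)
    id_whiskerRight := fun _ _ ↦ Over.OverMorphism.ext (MonoidalCategory.id_whiskerRight _ _)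
    associator_naturality := fun _ _ _ ↦ Over.OverMorphism.ext (associator_naturality _ _ _)
    leftUnitor_naturality := fun _ ↦ Over.OverMorphism.ext (leftUnitor_naturality _)
    rightUnitor_naturality := fun _ ↦ Over.OverMorphism.ext (rightUnitor_naturality _)
    pentagon := fun _ _ _ _ ↦ Over.OverMorphism.ext (MonoidalCategory.pentagon _ _ _ _)
    triangle := fun _ _ ↦ Over.OverMorphism.ext (MonoidalCategory.triangle _ _) }

/-- The symmetry on the category of objects over the commutative monoid `P`. -/
@[reducible]
def symmetric : letI := monoidal P; SymmetricCategory (Over P) :=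
  letI := monoidal P
  { braiding := fun X Y ↦ Over.isoMk (β_ X.left Y.left) (braiding_hom P _ _)
    braiding_naturality_right := fun _ _ _ _ ↦
      Over.OverMorphism.ext (BraidedCategory.braiding_naturality_right _ _)
    braiding_naturality_left := fun _ _ ↦
      Over.OverMorphism.ext (BraidedCategory.braiding_naturality_left _ _)
    hexagon_forward := fun _ _ _ ↦
      Over.OverMorphism.ext (BraidedCategory.hexagon_forward _ _ _)
    hexagon_reverse := fun _ _ _ ↦
      Over.OverMorphism.ext (BraidedCategory.hexagon_reverse _ _ _)
    symmetry := fun _ _ ↦ Over.OverMorphism.ext (SymmetricCategory.symmetry _ _) }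

end OverMon

/-- The monoidal structure of the category of `ℐ`-spaces over `BF`: the product of `f` and `g` is
`X ⊠ Y → BF ⊠ BF → BF`. -/
instance : MonoidalCategory (Over BF) := OverMon.monoidal BF

instance : SymmetricCategory (Over BF) := OverMon.symmetric BF

/-- A map of monoids `f : X → BF` is a monoid in the category of `ℐ`-spaces over `BF`. -/
instance {X : ISpace} [MonObj X] (f : X ⟶ BF) [IsMonHom f] : MonObj (Over.mk f) where
  one := Over.homMk (MonObj.one (X := X)) (IsMonHom.one_hom f)
  mul := Over.homMk (MonObj.mul (X := X)) (IsMonHom.mul_hom f)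
  one_mul := Over.OverMorphism.ext (MonObj.one_mul X)
  mul_one := Over.OverMorphism.ext (MonObj.mul_one X)
  mul_assoc := Over.OverMorphism.ext (MonObj.mul_assoc X)

/-! ### Symmetric spectra -/

namespace CoSphere

variable {ι ι' κ : Type} {l m n a b a' b' : ℕ}

theorem suppOn_add_push {α : ι ↪ Fin n} {β : ι' ↪ Fin m} (γ : κ ↪ Fin n) (δ : Fin m ↪ Fin n)
    (s : CoSphere α) (t : CoSphere β) (h : ∀ k, γ k ∈ Set.range α)
    (h' : ∀ k j, γ k = δ j → j ∈ Set.range β) :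
    Sphere.SuppOn (Set.range γ)ᶜ (s.1 + Sphere.push δ t.1) := by
  refine (s.2.mono ?_).add ((t.2.push δ).mono ?_)
  · rw [Set.compl_subset_compl]
    rintro _ ⟨i, rfl⟩
    exact h i
  · rintro _ ⟨j, hj, rfl⟩ ⟨k, hk⟩
    exact hj (h' k j hk)

/-- The point `s ∧ δ_* t`. -/
def mix {α : ι ↪ Fin n} {β : ι' ↪ Fin m} (γ : κ ↪ Fin n) (δ : Fin m ↪ Fin n)
    (s : CoSphere α) (t : CoSphere β)
    (h : ∀ k, γ k ∈ Set.range α) (h' : ∀ k j, γ k = δ j → j ∈ Set.range β) : CoSphere γ :=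
  ⟨s.1 + Sphere.push δ t.1, suppOn_add_push γ δ s t h h'⟩

theorem continuous_mix {α : ι ↪ Fin n} {β : ι' ↪ Fin m} (γ : κ ↪ Fin n) (δ : Fin m ↪ Fin n)
    (h : ∀ k, γ k ∈ Set.range α) (h' : ∀ k j, γ k = δ j → j ∈ Set.range β)
    (h'' : ∀ j, δ j ∈ Set.range α) :
    Continuous fun p : CoSphere α × CoSphere β ↦ mix γ δ p.1 p.2 h h' := by
  have h1 := (CoSphere.continuous_add (α := α) (A := Set.range δ) (by rintro _ ⟨j, rfl⟩; exact h'' j)).comp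
    (continuous_fst.prodMk (((Sphere.continuous_push δ).comp
      (continuous_subtype_val.comp continuous_snd)).subtype_mk
      fun p : CoSphere α × CoSphere β ↦ Sphere.suppOn_push p.2.1 δ))
  exact h1.subtype_mk _

theorem continuous_comp (α : Fin m ↪ Fin n) (β : ι ↪ Fin m) :
    Continuous fun p : CoSphere α × CoSphere β ↦ comp α p.1 p.2 :=
  continuous_mix (β.trans α) α (fun k ↦ ⟨β k, rfl⟩) (fun k _ h ↦ ⟨k, α.injective h⟩)
    fun j ↦ ⟨j, rfl⟩

theorem comp_val (α : Fin m ↪ Fin n) (β : ι ↪ Fin m) (s : CoSphere α) (t : CoSphere β) :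
    (comp α s t).1 = s.1 + Sphere.push α t.1 := rfl

/-- A point of `S^{n-α}` as a point of the larger sphere `S^{n-αe}`. -/
def precomp (e : κ ↪ ι) {α : ι ↪ Fin n} (s : CoSphere α) : CoSphere (e.trans α) :=
  ⟨s.1, s.2.mono (Set.compl_subset_compl.2 (by rintro _ ⟨i, rfl⟩; exact ⟨_, rfl⟩))⟩

theorem precomp_val (e : κ ↪ ι) {α : ι ↪ Fin n} (s : CoSphere α) : (precomp e s).1 = s.1 := rfl

theorem continuous_precomp (e : κ ↪ ι) (α : ι ↪ Fin n) :
    Continuous fun s : CoSphere α ↦ precomp e s := continuous_subtype_val.subtype_mk _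

/-- The canonical homeomorphism `S^{n-α} ∧ S^{a'-β} ∧ S^{b'-γ} ≅ S^{n-α(β ⊔ γ)}`. -/
def comp₂ (α : Fin a' ⊕ Fin b' ↪ Fin n) (β : Fin a ↪ Fin a') (γ : Fin b ↪ Fin b')
    (s : CoSphere α) (s₁ : CoSphere β) (s₂ : CoSphere γ) :
    CoSphere ((β.sumMap γ).trans α) :=
  ⟨s.1 + Sphere.push (Function.Embedding.inl.trans α) s₁.1 +
      Sphere.push (Function.Embedding.inr.trans α) s₂.1, by
    refine ((s.2.mono ?_).add ((s₁.2.push _).mono ?_)).add ((s₂.2.push _).mono ?_)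
    · rw [Set.compl_subset_compl]
      rintro _ ⟨i, rfl⟩
      exact ⟨_, rfl⟩
    · rintro _ ⟨j, hj, rfl⟩ ⟨k | k, hk⟩
      · exact hj ⟨k, Sum.inl_injective (α.injective hk)⟩
      · exact absurd (α.injective hk) (by simp)
    · rintro _ ⟨j, hj, rfl⟩ ⟨k | k, hk⟩
      · exact absurd (α.injective hk) (by simp)
      · exact hj ⟨k, Sum.inr_injective (α.injective hk)⟩⟩

end CoSphere

/-- A symmetric spectrum (of compactly generated weak Hausdorff spaces): a based continuous
functor from the category with objects `n ≥ 0` and based spaces of morphisms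
`⋁_α S^{n-α}`, where `α` runs through the injective maps `m → n`, to the category of based
spaces. The composition in the category is given by `S^{n-α} ∧ S^{m-β} ≅ S^{n-αβ}`. -/
structure SymSpectrum where
  /-- the spaces -/
  obj : ℕ → Type
  [top : ∀ n, TopologicalSpace (obj n)]
  [cgwh : ∀ n, CGWH (obj n)]
  /-- the base points -/
  pt {n : ℕ} : obj n
  /-- the structure maps `S^{n-α} ∧ X(m) → X(n)` -/
  act {m n : ℕ} (α : Fin m ↪ Fin n) : CoSphere α × obj m → obj n
  kcont_act {m n : ℕ} (α : Fin m ↪ Fin n) : KCont (act α)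
  act_infty {m n : ℕ} (α : Fin m ↪ Fin n) (x : obj m) : act α (.infty α, x) = pt
  act_pt {m n : ℕ} (α : Fin m ↪ Fin n) (s : CoSphere α) : act α (s, pt) = pt
  act_zero {n : ℕ} (x : obj n) : act (.refl _) (.zero _, x) = x
  act_comp {l m n : ℕ} (β : Fin l ↪ Fin m) (α : Fin m ↪ Fin n) (s : CoSphere α)
    (t : CoSphere β) (x : obj l) :
    act (β.trans α) (CoSphere.comp α s t, x) = act α (s, act β (t, x))

attribute [instance] SymSpectrum.top SymSpectrum.cgwh

namespace SymSpectrum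

/-- A morphism of symmetric spectra. -/
@[ext]
structure Hom (X Y : SymSpectrum) where
  /-- the components -/
  app {n : ℕ} : X.obj n → Y.obj n
  continuous_app {n : ℕ} : Continuous (app (n := n))
  app_pt {n : ℕ} : app (X.pt (n := n)) = Y.pt
  app_act {m n : ℕ} (α : Fin m ↪ Fin n) (s : CoSphere α) (x : X.obj m) :
    app (X.act α (s, x)) = Y.act α (s, app x)

instance : Category SymSpectrum where
  Hom := Hom
  id X := ⟨fun x ↦ x, continuous_id, rfl, fun _ _ _ ↦ rfl⟩
  comp f g := ⟨fun x ↦ g.app (f.app x), g.continuous_app.comp f.continuous_app, by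
    intro n
    rw [f.app_pt, g.app_pt], fun α s x ↦ by rw [f.app_act, g.app_act]⟩

variable {W X Y Z X' Y' Z' : SymSpectrum}

theorem hom_ext {f g : X ⟶ Y} (h : ∀ {n : ℕ} (x : X.obj n), f.app x = g.app x) : f = g :=
  Hom.ext (funext fun _ ↦ funext fun x ↦ h x)

@[simp]
theorem id_app {n : ℕ} (x : X.obj n) : Hom.app (𝟙 X) x = x := rfl

@[simp]
theorem comp_app (f : X ⟶ Y) (g : Y ⟶ Z) {n : ℕ} (x : X.obj n) :
    (f ≫ g).app x = g.app (f.app x) := rfl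

theorem act_congr {m n : ℕ} {α α' : Fin m ↪ Fin n} {s : CoSphere α} {s' : CoSphere α'} {x x' : X.obj m}
    (h : ∀ i, α i = α' i) (hs : s.1 = s'.1) (hx : x = x') : X.act α (s, x) = X.act α' (s', x') := by
  obtain rfl : α = α' := Function.Embedding.ext h
  obtain rfl : s = s' := Subtype.ext hs
  rw [hx]

theorem act_refl {n : ℕ} (α : Fin n ↪ Fin n) (h : ∀ i, α i = i) (s : CoSphere α) (hs : s.1 = 0)
    (x : X.obj n) : X.act α (s, x) = x :=
  (act_congr h hs rfl).trans (X.act_zero x)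

/-- The disjoint union of the spaces `S^{n-α} × X(a) × Y(b)` over the injective maps
`α : a ⊔ b → n`. -/
abbrev SmashPre (X Y : SymSpectrum) (n : ℕ) : Type :=
  Σ i : ISpace.BoxIndex n, CoSphere i.emb × (X.obj i.left × Y.obj i.right)

/-- The points that represent the base point of the smash product. -/
def IsBase (X Y : SymSpectrum) (n : ℕ) (p : SmashPre X Y n) : Prop :=
  p.2.1.1 = Sphere.infty ∨ p.2.2.1 = X.pt ∨ p.2.2.2 = Y.pt

/-- The identifications in the colimit of the spaces `S^{n-α} ∧ X(a) ∧ Y(b)` over the category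
of the injective maps `α : a ⊔ b → n`. -/
inductive SmashRel (X Y : SymSpectrum) (n : ℕ) : SmashPre X Y n → SmashPre X Y n → Prop
  | base (p q : SmashPre X Y n) (hp : IsBase X Y n p) (hq : IsBase X Y n q) : SmashRel X Y n p q
  | shift {a b a' b' : ℕ} (β : Fin a ↪ Fin a') (γ : Fin b ↪ Fin b')
      (α : Fin a' ⊕ Fin b' ↪ Fin n) (s : CoSphere α) (s₁ : CoSphere β) (s₂ : CoSphere γ)
      (x : X.obj a) (y : Y.obj b) :
      SmashRel X Y n ⟨⟨a, b, (β.sumMap γ).trans α⟩, (CoSphere.comp₂ α β γ s s₁ s₂, (x, y))⟩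
        ⟨⟨a', b', α⟩, (s, (X.act β (s₁, x), Y.act γ (s₂, y)))⟩

/-- The `n`-th space of the smash product. -/
abbrev SmashObj (X Y : SymSpectrum) (n : ℕ) : Type := KQuot (SmashRel X Y n)

/-- The structure map of the smash product on representatives. -/
def actPre {m n : ℕ} (δ : Fin m ↪ Fin n) (p : CoSphere δ × SmashPre X Y m) : SmashPre X Y n :=
  ⟨⟨p.2.1.left, p.2.1.right, p.2.1.emb.trans δ⟩,
    (.comp δ p.1 p.2.2.1, p.2.2.2)⟩

theorem actPre_rel {m n : ℕ} (δ : Fin m ↪ Fin n) (s : CoSphere δ) (p q : SmashPre X Y m)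
    (h : SmashRel X Y m p q) :
    (KQuot.mk (actPre δ (s, p)) : SmashObj X Y n) = KQuot.mk (actPre δ (s, q)) := by
  have hb : ∀ p, IsBase X Y m p → IsBase X Y n (actPre δ (s, p)) := by
    rintro p (h | h | h)
    · refine .inl ?_
      have : s.1 + Sphere.push δ p.2.1.1 = Sphere.infty := by
        rw [h, Sphere.push_infty, Sphere.add_infty]
      exact this
    · exact .inr (.inl h)
    · exact .inr (.inr h)
  cases h with
  | base p q hp hq => exact KQuot.sound (.base _ _ (hb _ hp) (hb _ hq))
  | shift β γ α s' s₁ s₂ x y =>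
    refine Eq.trans ?_ (KQuot.sound (.shift β γ (α.trans δ)
      (.comp δ s s') s₁ s₂ x y))
    refine congrArg (fun s ↦ KQuot.mk (⟨_, (s, _)⟩ : SmashPre X Y n)) (Subtype.ext ?_)
    change s.1 + Sphere.push δ (s'.1 + Sphere.push _ s₁.1 + Sphere.push _ s₂.1) =
      s.1 + Sphere.push δ s'.1 + Sphere.push _ s₁.1 + Sphere.push _ s₂.1
    simp only [map_add, ← Sphere.push_trans, ← add_assoc]
    rfl

theorem kcont_smash_mk {n a b : ℕ} (α : Fin a ⊕ Fin b ↪ Fin n) :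
    KCont fun p : CoSphere α × (X.obj a × Y.obj b) ↦
      (KQuot.mk ⟨⟨a, b, α⟩, p⟩ : SmashObj X Y n) :=
  (KCont.comp KQuot.kcont_mk (kcont (fun p : CoSphere α × (X.obj a × Y.obj b) ↦
    (⟨⟨a, b, α⟩, p⟩ : SmashPre X Y n)) (continuous_sigmaMk
      (σ := fun i : ISpace.BoxIndex n ↦ CoSphere i.emb × (X.obj i.left × Y.obj i.right))
      (i := ⟨a, b, α⟩))) :)

theorem kcont_actPre {m n : ℕ} (δ : Fin m ↪ Fin n) :
    KCont fun p : SmashPre X Y m × CoSphere δ ↦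
      (KQuot.mk (actPre δ (p.2, p.1)) : SmashObj X Y n) :=
  ISpace.kcont_sigma_prod fun i ↦ (KCont.comp (kcont_smash_mk (i.emb.trans δ))
    (kcont (fun p : (CoSphere i.emb × (X.obj i.left × Y.obj i.right)) × CoSphere δ ↦
      (CoSphere.comp δ p.2 p.1.1, p.1.2))
      (((CoSphere.continuous_comp δ i.emb).comp
        (by fun_prop : Continuous fun p : (CoSphere i.emb × (X.obj i.left × Y.obj i.right)) ×
          CoSphere δ ↦ (p.2, p.1.1))).prodMk (by fun_prop))) :)

/-- The structure map of the smash product. -/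
def smashAct {m n : ℕ} (δ : Fin m ↪ Fin n) (p : CoSphere δ × SmashObj X Y m) : SmashObj X Y n :=
  KQuot.lift (fun q ↦ KQuot.mk (actPre δ (p.1, q)))
    ((KCont.comp (kcont_actPre δ) (kcont (fun q : SmashPre X Y m ↦ (q, p.1))
      (by fun_prop)) :)) (actPre_rel δ p.1) p.2

/-- The smash product of symmetric spectra, `(X ∧ Y)(n) = colim S^{n-α} ∧ X(a) ∧ Y(b)`, where the
colimit is over the category `(⊔ ↓ n)` of the injective maps `α : a ⊔ b → n`. -/
def smash (X Y : SymSpectrum) : SymSpectrum where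
  obj := SmashObj X Y
  pt := KQuot.mk ⟨⟨0, 0, Function.Embedding.ofIsEmpty⟩, (.infty _, (X.pt, Y.pt))⟩
  act δ := smashAct δ
  kcont_act δ := (KCont.comp (KQuot.kcont_prod (f := fun p ↦ smashAct δ (p.2, p.1))
    (kcont_actPre δ)) (kcont (fun p : CoSphere δ × SmashObj X Y _ ↦ (p.2, p.1))
      (by fun_prop)) :)
  act_infty δ w := by
    induction w using KQuot.ind with | h p
    exact KQuot.sound (.base _ _ (.inl rfl) (.inl rfl))
  act_pt δ s := KQuot.sound (.base _ _ (.inr (.inl rfl)) (.inl rfl))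
  act_zero w := by
    induction w using KQuot.ind with | h p
    refine congrArg (fun s ↦ KQuot.mk (⟨_, (s, _)⟩ : SmashPre X Y _)) (Subtype.ext ?_)
    change 0 + Sphere.push (.refl _) p.2.1.1 = _
    rw [zero_add, Sphere.push_refl]
  act_comp β α s t w := by
    induction w using KQuot.ind with | h p
    refine congrArg (fun s ↦ KQuot.mk (⟨_, (s, _)⟩ : SmashPre X Y _)) (Subtype.ext ?_)
    change s.1 + Sphere.push α t.1 + Sphere.push (β.trans α) p.2.1.1 =
      s.1 + Sphere.push α (t.1 + Sphere.push β p.2.1.1)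
    rw [map_add, Sphere.push_trans, add_assoc]

/-- The point of `(X ∧ Y)(n)` represented by points of `S^{n-α}`, `X(a)` and `Y(b)`. -/
def t {a b n : ℕ} (α : Fin a ⊕ Fin b ↪ Fin n) (s : CoSphere α) (x : X.obj a) (y : Y.obj b) :
    (smash X Y).obj n :=
  KQuot.mk (r := SmashRel X Y n) ⟨⟨a, b, α⟩, (s, (x, y))⟩

section
variable {a b c a' b' c' m n : ℕ}

theorem t_congr {α α' : Fin a ⊕ Fin b ↪ Fin n} {s : CoSphere α} {s' : CoSphere α'}
    {x x' : X.obj a} {y y' : Y.obj b}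
    (h : ∀ i, α i = α' i) (hs : s.1 = s'.1) (hx : x = x') (hy : y = y') :
    t α s x y = t α' s' x' y' := by
  obtain rfl : α = α' := Function.Embedding.ext h
  obtain rfl : s = s' := Subtype.ext hs
  rw [hx, hy]

theorem act_t (δ : Fin m ↪ Fin n) (r : CoSphere δ) (α : Fin a ⊕ Fin b ↪ Fin m) (s : CoSphere α)
    (x : X.obj a) (y : Y.obj b) :
    (smash X Y).act δ (r, t α s x y) = t (α.trans δ)
      (.comp δ r s) x y := rfl

theorem t_shift (β : Fin a ↪ Fin a') (γ : Fin b ↪ Fin b')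
    (α : Fin a' ⊕ Fin b' ↪ Fin n) (s : CoSphere α) (s₁ : CoSphere β) (s₂ : CoSphere γ)
    (x : X.obj a) (y : Y.obj b) :
    t ((β.sumMap γ).trans α) (CoSphere.comp₂ α β γ s s₁ s₂) x y =
      t α s (X.act β (s₁, x)) (Y.act γ (s₂, y)) :=
  KQuot.sound (r := SmashRel X Y n) (.shift β γ α s s₁ s₂ x y)

theorem t_infty (α : Fin a ⊕ Fin b ↪ Fin n) (s : CoSphere α) (hs : s.1 = Sphere.infty)
    (x : X.obj a) (y : Y.obj b) : t α s x y = (smash X Y).pt :=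
  KQuot.sound (r := SmashRel X Y n) (.base _ _ (.inl hs) (.inl rfl))

theorem t_pt_left (α : Fin a ⊕ Fin b ↪ Fin n) (s : CoSphere α) (y : Y.obj b) :
    t α s X.pt y = (smash X Y).pt :=
  KQuot.sound (r := SmashRel X Y n) (.base _ _ (.inr (.inl rfl)) (.inl rfl))

theorem t_pt_right (α : Fin a ⊕ Fin b ↪ Fin n) (s : CoSphere α) (x : X.obj a) :
    t α s x Y.pt = (smash X Y).pt :=
  KQuot.sound (r := SmashRel X Y n) (.base _ _ (.inr (.inr rfl)) (.inl rfl))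

theorem pt_eq : (smash X Y).pt (n := n) =
    t (a := 0) (b := 0) .ofIsEmpty (.infty _) X.pt Y.pt := rfl

theorem kcont_t_comp {S : Type} [TopologicalSpace S] (α : Fin a ⊕ Fin b ↪ Fin n)
    {r : S → CoSphere α} {f : S → X.obj a} {g : S → Y.obj b} (hr : KCont r) (hf : KCont f)
    (hg : KCont g) : KCont fun p ↦ t α (r p) (f p) (g p) :=
  (KCont.comp (kcont_smash_mk α) (hr.prodMk (hf.prodMk hg)) :)

theorem smash_ind {p : (smash X Y).obj n → Prop}
    (h : ∀ {a b : ℕ} (α : Fin a ⊕ Fin b ↪ Fin n) (s : CoSphere α) (x : X.obj a) (y : Y.obj b),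
      p (t α s x y)) (w : (smash X Y).obj n) : p w :=
  KQuot.ind (r := SmashRel X Y n) (fun ⟨⟨_, _, α⟩, (s, (x, y))⟩ ↦ h α s x y) w

variable {T B : Type} [TopologicalSpace T] [TopologicalSpace B]

theorem kcont_smash {f : (smash X Y).obj n × B → T}
    (h : ∀ {a b : ℕ} (α : Fin a ⊕ Fin b ↪ Fin n),
      KCont fun p : (CoSphere α × (X.obj a × Y.obj b)) × B ↦
        f (t α p.1.1 p.1.2.1 p.1.2.2, p.2)) : KCont f :=
  KQuot.kcont_prod (r := SmashRel X Y n) (ISpace.kcont_sigma_prod fun i ↦ h i.emb)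

/-- Based maps out of the smash product. -/
def smashLift [CGWH T] (z : T)
    (φ : ∀ {a b : ℕ} (α : Fin a ⊕ Fin b ↪ Fin n), CoSphere α → X.obj a → Y.obj b → T)
    (hφ : ∀ {a b : ℕ} (α : Fin a ⊕ Fin b ↪ Fin n),
      KCont fun p : CoSphere α × (X.obj a × Y.obj b) ↦ φ α p.1 p.2.1 p.2.2)
    (h₁ : ∀ {a b : ℕ} (α : Fin a ⊕ Fin b ↪ Fin n) (x : X.obj a) (y : Y.obj b),
      φ α (.infty α) x y = z)
    (h₂ : ∀ {a b : ℕ} (α : Fin a ⊕ Fin b ↪ Fin n) (s : CoSphere α) (y : Y.obj b),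
      φ α s X.pt y = z)
    (h₃ : ∀ {a b : ℕ} (α : Fin a ⊕ Fin b ↪ Fin n) (s : CoSphere α) (x : X.obj a),
      φ α s x Y.pt = z)
    (h : ∀ {a b a' b' : ℕ} (β : Fin a ↪ Fin a') (γ : Fin b ↪ Fin b')
      (α : Fin a' ⊕ Fin b' ↪ Fin n) (s : CoSphere α) (s₁ : CoSphere β) (s₂ : CoSphere γ)
      (x : X.obj a) (y : Y.obj b), φ ((β.sumMap γ).trans α) (CoSphere.comp₂ α β γ s s₁ s₂) x y =
        φ α s (X.act β (s₁, x)) (Y.act γ (s₂, y))) : (smash X Y).obj n → T :=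
  KQuot.lift (r := SmashRel X Y n) (fun p ↦ φ p.1.emb p.2.1 p.2.2.1 p.2.2.2)
    (KCont.sigma fun i ↦ hφ i.emb) fun _ _ hr ↦ by
    cases hr with
    | base _ _ hp hq =>
      have key : ∀ p, IsBase X Y n p → φ p.1.emb p.2.1 p.2.2.1 p.2.2.2 = z := by
        rintro ⟨i, s, x, y⟩ (hp | hp | hp)
        · obtain rfl : s = .infty _ := Subtype.ext hp
          exact h₁ _ _ _
        · obtain rfl : x = X.pt := hp
          exact h₂ _ _ _
        · obtain rfl : y = Y.pt := hp
          exact h₃ _ _ _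
      rw [key _ hp, key _ hq]
    | shift β γ α s s₁ s₂ x y => exact h β γ α s s₁ s₂ x y

end

/-- A map out of the smash product. -/
def smashDesc
    (φ : ∀ {a b n : ℕ} (α : Fin a ⊕ Fin b ↪ Fin n), CoSphere α → X.obj a → Y.obj b → Z.obj n)
    (hφ : ∀ {a b n : ℕ} (α : Fin a ⊕ Fin b ↪ Fin n),
      KCont fun p : CoSphere α × (X.obj a × Y.obj b) ↦ φ α p.1 p.2.1 p.2.2)
    (h₁ : ∀ {a b n : ℕ} (α : Fin a ⊕ Fin b ↪ Fin n) (x : X.obj a) (y : Y.obj b),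
      φ α (.infty α) x y = Z.pt)
    (h₂ : ∀ {a b n : ℕ} (α : Fin a ⊕ Fin b ↪ Fin n) (s : CoSphere α) (y : Y.obj b),
      φ α s X.pt y = Z.pt)
    (h₃ : ∀ {a b n : ℕ} (α : Fin a ⊕ Fin b ↪ Fin n) (s : CoSphere α) (x : X.obj a),
      φ α s x Y.pt = Z.pt)
    (h : ∀ {a b a' b' n : ℕ} (β : Fin a ↪ Fin a') (γ : Fin b ↪ Fin b')
      (α : Fin a' ⊕ Fin b' ↪ Fin n) (s : CoSphere α) (s₁ : CoSphere β) (s₂ : CoSphere γ)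
      (x : X.obj a) (y : Y.obj b), φ ((β.sumMap γ).trans α) (CoSphere.comp₂ α β γ s s₁ s₂) x y =
        φ α s (X.act β (s₁, x)) (Y.act γ (s₂, y)))
    (h' : ∀ {a b m n : ℕ} (α : Fin a ⊕ Fin b ↪ Fin m) (δ : Fin m ↪ Fin n) (r : CoSphere δ)
      (s : CoSphere α) (x : X.obj a) (y : Y.obj b),
      φ (α.trans δ) (.comp δ r s) x y =
        Z.act δ (r, φ α s x y)) : smash X Y ⟶ Z where
  app := smashLift Z.pt φ hφ h₁ h₂ h₃ h
  continuous_app {n} := KQuot.continuous_lift (r := SmashRel X Y n) _ _ _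
  app_pt := h₁ _ _ _
  app_act δ r w := by
    induction w using smash_ind with | h α s x y
    exact h' α δ r s x y

theorem smash_hom_ext {f g : smash X Y ⟶ Z}
    (h : ∀ {a b n : ℕ} (α : Fin a ⊕ Fin b ↪ Fin n) (s : CoSphere α) (x : X.obj a) (y : Y.obj b),
      f.app (t α s x y) = g.app (t α s x y)) : f = g :=
  hom_ext fun w ↦ by
    induction w using smash_ind with | h α s x y
    exact h α s x y

section Trilinear
variable {a b c a' b' c' m n : ℕ}

/-- A point of `X ∧ (Y ∧ Z)`. -/
def tR (γ : Fin a ⊕ (Fin b ⊕ Fin c) ↪ Fin n) (s : CoSphere γ) (x : X.obj a) (y : Y.obj b)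
    (z : Z.obj c) : (smash X (smash Y Z)).obj n :=
  t (((Function.Embedding.refl _).sumMap finSumFinEquiv.symm.toEmbedding).trans γ)
    (.precomp _ s) x (t finSumFinEquiv.toEmbedding (.zero _) y z)

/-- A point of `(X ∧ Y) ∧ Z`. -/
def tL (γ : (Fin a ⊕ Fin b) ⊕ Fin c ↪ Fin n) (s : CoSphere γ) (x : X.obj a) (y : Y.obj b)
    (z : Z.obj c) : (smash (smash X Y) Z).obj n :=
  t ((finSumFinEquiv.symm.toEmbedding.sumMap (Function.Embedding.refl _)).trans γ)
    (.precomp _ s) (t finSumFinEquiv.toEmbedding (.zero _) x y) z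

theorem tR_congr {γ γ' : Fin a ⊕ (Fin b ⊕ Fin c) ↪ Fin n} {s : CoSphere γ} {s' : CoSphere γ'}
    {x x' : X.obj a} {y y' : Y.obj b} {z z' : Z.obj c}
    (h : ∀ i, γ i = γ' i) (hs : s.1 = s'.1) (hx : x = x') (hy : y = y') (hz : z = z') :
    tR γ s x y z = tR γ' s' x' y' z' := by
  obtain rfl : γ = γ' := Function.Embedding.ext h
  obtain rfl : s = s' := Subtype.ext hs
  rw [hx, hy, hz]

theorem tL_congr {γ γ' : (Fin a ⊕ Fin b) ⊕ Fin c ↪ Fin n} {s : CoSphere γ} {s' : CoSphere γ'}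
    {x x' : X.obj a} {y y' : Y.obj b} {z z' : Z.obj c}
    (h : ∀ i, γ i = γ' i) (hs : s.1 = s'.1) (hx : x = x') (hy : y = y') (hz : z = z') :
    tL γ s x y z = tL γ' s' x' y' z' := by
  obtain rfl : γ = γ' := Function.Embedding.ext h
  obtain rfl : s = s' := Subtype.ext hs
  rw [hx, hy, hz]

/-- The sphere coordinate in `t_t_right`. -/
def mixR (α : Fin a ⊕ Fin m ↪ Fin n) (β : Fin b ⊕ Fin c ↪ Fin m) (s : CoSphere α)
    (s' : CoSphere β) : CoSphere (((Function.Embedding.refl (Fin a)).sumMap β).trans α) :=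
  .mix _ (Function.Embedding.inr.trans α) s s' (fun _ ↦ ⟨_, rfl⟩) (by
    rintro (k | k) j h
    · exact absurd (α.injective h) (by simp)
    · exact ⟨k, Sum.inr_injective (α.injective h)⟩)

/-- The sphere coordinate in `t_t_left`. -/
def mixL (α : Fin m ⊕ Fin c ↪ Fin n) (β : Fin a ⊕ Fin b ↪ Fin m) (s : CoSphere α)
    (s' : CoSphere β) : CoSphere ((β.sumMap (Function.Embedding.refl (Fin c))).trans α) :=
  .mix _ (Function.Embedding.inl.trans α) s s' (fun _ ↦ ⟨_, rfl⟩) (by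
    rintro (k | k) j h
    · exact ⟨k, Sum.inl_injective (α.injective h)⟩
    · exact absurd (α.injective h) (by simp))

theorem mixR_val (α : Fin a ⊕ Fin m ↪ Fin n) (β : Fin b ⊕ Fin c ↪ Fin m) (s : CoSphere α)
    (s' : CoSphere β) : (mixR α β s s').1 =
      s.1 + Sphere.push (Function.Embedding.inr.trans α) s'.1 := rfl

theorem mixL_val (α : Fin m ⊕ Fin c ↪ Fin n) (β : Fin a ⊕ Fin b ↪ Fin m) (s : CoSphere α)
    (s' : CoSphere β) : (mixL α β s s').1 =
      s.1 + Sphere.push (Function.Embedding.inl.trans α) s'.1 := rfl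

theorem comp₂_val (α : Fin a' ⊕ Fin b' ↪ Fin n) (β : Fin a ↪ Fin a') (γ : Fin b ↪ Fin b')
    (s : CoSphere α) (s₁ : CoSphere β) (s₂ : CoSphere γ) :
    (CoSphere.comp₂ α β γ s s₁ s₂).1 = s.1 + Sphere.push (Function.Embedding.inl.trans α) s₁.1 +
      Sphere.push (Function.Embedding.inr.trans α) s₂.1 := rfl

theorem continuous_mixR (α : Fin a ⊕ Fin m ↪ Fin n) (β : Fin b ⊕ Fin c ↪ Fin m) :
    Continuous fun p : CoSphere α × CoSphere β ↦ mixR α β p.1 p.2 :=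
  CoSphere.continuous_mix _ _ _ _ fun _ ↦ ⟨_, rfl⟩

theorem continuous_mixL (α : Fin m ⊕ Fin c ↪ Fin n) (β : Fin a ⊕ Fin b ↪ Fin m) :
    Continuous fun p : CoSphere α × CoSphere β ↦ mixL α β p.1 p.2 :=
  CoSphere.continuous_mix _ _ _ _ fun _ ↦ ⟨_, rfl⟩

theorem zero_val {ι : Type} (α : ι ↪ Fin n) : (CoSphere.zero α).1 = 0 := rfl

theorem infty_val {ι : Type} (α : ι ↪ Fin n) : (CoSphere.infty α).1 = Sphere.infty := rfl

theorem mix_val {ι ι' κ : Type} {α : ι ↪ Fin n} {β : ι' ↪ Fin m} (γ : κ ↪ Fin n)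
    (δ : Fin m ↪ Fin n) (h : ∀ k, γ k ∈ Set.range α) (h' : ∀ k j, γ k = δ j → j ∈ Set.range β)
    (s : CoSphere α) (t : CoSphere β) : (CoSphere.mix γ δ s t h h').1 =
      s.1 + Sphere.push δ t.1 := rfl

theorem t_t_right (α : Fin a ⊕ Fin m ↪ Fin n) (β : Fin b ⊕ Fin c ↪ Fin m) (s : CoSphere α)
    (s' : CoSphere β) (x : X.obj a) (y : Y.obj b) (z : Z.obj c) :
    t α s x (t β s' y z) =
      tR (((Function.Embedding.refl _).sumMap β).trans α) (mixR α β s s') x y z := by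
  have h := t_shift (X := X) (Y := smash Y Z) (.refl _) (finSumFinEquiv.symm.toEmbedding.trans β)
    α s (.zero _) (.precomp _ s') x (t finSumFinEquiv.toEmbedding (.zero _) y z)
  rw [X.act_zero, act_t] at h
  refine Eq.trans (t_congr (fun _ ↦ rfl) rfl rfl (t_congr ?_ ?_ rfl rfl)) (h.symm.trans ?_)
  · intro i
    simp
  · rw [CoSphere.comp_val, zero_val, map_zero, add_zero, CoSphere.precomp_val]
  · refine t_congr ?_ ?_ rfl rfl
    · rintro (i | i) <;> simp
    · rw [comp₂_val, CoSphere.precomp_val, CoSphere.precomp_val, mixR_val, zero_val, map_zero,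
        add_zero]

theorem t_t_left (α : Fin m ⊕ Fin c ↪ Fin n) (β : Fin a ⊕ Fin b ↪ Fin m) (s : CoSphere α)
    (s' : CoSphere β) (x : X.obj a) (y : Y.obj b) (z : Z.obj c) :
    t α s (t β s' x y) z =
      tL ((β.sumMap (Function.Embedding.refl _)).trans α) (mixL α β s s') x y z := by
  have h := t_shift (X := smash X Y) (Y := Z) (finSumFinEquiv.symm.toEmbedding.trans β) (.refl _)
    α s (.precomp _ s') (.zero _) (t finSumFinEquiv.toEmbedding (.zero _) x y) z
  rw [Z.act_zero, act_t] at h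
  refine Eq.trans (t_congr (fun _ ↦ rfl) rfl (t_congr ?_ ?_ rfl rfl) rfl) (h.symm.trans ?_)
  · intro i
    simp
  · rw [CoSphere.comp_val, zero_val, map_zero, add_zero, CoSphere.precomp_val]
  · refine t_congr ?_ ?_ rfl rfl
    · rintro (i | i) <;> simp
    · rw [comp₂_val, CoSphere.precomp_val, CoSphere.precomp_val, mixL_val, zero_val, map_zero,
        add_zero]

end Trilinear

end SymSpectrum

set_option linter.unusedSimpArgs false

/-! Bookkeeping lemmas for embeddings of finite sets. -/

section Embeddings

open Function.Embedding

variable {A B C A' B' D E : Type}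

theorem emb_assoc (e : A ↪ B) (f : B ↪ C) (g : C ↪ D) :
    (e.trans f).trans g = e.trans (f.trans g) := rfl

theorem refl_emb (e : A ↪ B) : (Function.Embedding.refl A).trans e = e := rfl

theorem inl_sumMap (e : A ↪ A') (f : B ↪ B') (g : A' ⊕ B' ↪ C) :
    inl.trans ((e.sumMap f).trans g) = e.trans (inl.trans g) := rfl

theorem inr_sumMap (e : A ↪ A') (f : B ↪ B') (g : A' ⊕ B' ↪ C) :
    inr.trans ((e.sumMap f).trans g) = f.trans (inr.trans g) := rfl

theorem inl_sumAssoc_symm (g : (A ⊕ B) ⊕ C ↪ D) :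
    inl.trans ((Equiv.sumAssoc A B C).symm.toEmbedding.trans g) = inl.trans (inl.trans g) := rfl

theorem inl_inr_sumAssoc_symm (g : (A ⊕ B) ⊕ C ↪ D) :
    inl.trans (inr.trans ((Equiv.sumAssoc A B C).symm.toEmbedding.trans g)) =
      inr.trans (inl.trans g) := rfl

theorem inr_inr_sumAssoc_symm (g : (A ⊕ B) ⊕ C ↪ D) :
    inr.trans (inr.trans ((Equiv.sumAssoc A B C).symm.toEmbedding.trans g)) = inr.trans g := rfl

theorem inl_inl_sumAssoc (g : A ⊕ (B ⊕ C) ↪ D) :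
    inl.trans (inl.trans ((Equiv.sumAssoc A B C).toEmbedding.trans g)) = inl.trans g := rfl

theorem inr_inl_sumAssoc (g : A ⊕ (B ⊕ C) ↪ D) :
    inr.trans (inl.trans ((Equiv.sumAssoc A B C).toEmbedding.trans g)) =
      inl.trans (inr.trans g) := rfl

theorem inr_sumAssoc (g : A ⊕ (B ⊕ C) ↪ D) :
    inr.trans ((Equiv.sumAssoc A B C).toEmbedding.trans g) = inr.trans (inr.trans g) := rfl

theorem inl_sumComm (g : B ⊕ A ↪ D) :
    inl.trans ((Equiv.sumComm A B).toEmbedding.trans g) = inr.trans g := rfl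

theorem inr_sumComm (g : B ⊕ A ↪ D) :
    inr.trans ((Equiv.sumComm A B).toEmbedding.trans g) = inl.trans g := rfl

theorem equiv_symm_emb (e : A ≃ B) (g : A ↪ D) :
    e.toEmbedding.trans (e.symm.toEmbedding.trans g) = g := by
  ext i
  simp

theorem inl_equiv_symm_emb (e : A ⊕ B ≃ C) (g : A ⊕ B ↪ D) :
    inl.trans (e.toEmbedding.trans (e.symm.toEmbedding.trans g)) = inl.trans g := by
  rw [equiv_symm_emb]

end Embeddings

namespace SymSpectrum

variable {W X Y Z X' Y' Z' : SymSpectrum}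

section Trilinear
variable {a b c a' b' c' m n : ℕ}

theorem tR_shift (β : Fin a ↪ Fin a') (γ : Fin b ↪ Fin b') (δ : Fin c ↪ Fin c')
    (α : Fin a' ⊕ (Fin b' ⊕ Fin c') ↪ Fin n) (s : CoSphere α) (s₁ : CoSphere β) (s₂ : CoSphere γ)
    (s₃ : CoSphere δ) (x : X.obj a) (y : Y.obj b) (z : Z.obj c)
    (ε : Fin a ⊕ (Fin b ⊕ Fin c) ↪ Fin n) (r : CoSphere ε)
    (hε : ∀ i, ε i = α (Sum.map β (Sum.map γ δ) i))
    (hr : r.1 = s.1 + Sphere.push (Function.Embedding.inl.trans α) s₁.1 +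
      Sphere.push (Function.Embedding.inl.trans (Function.Embedding.inr.trans α)) s₂.1 +
      Sphere.push (Function.Embedding.inr.trans (Function.Embedding.inr.trans α)) s₃.1) :
    tR ε r x y z = tR α s (X.act β (s₁, x)) (Y.act γ (s₂, y)) (Z.act δ (s₃, z)) := by
  unfold tR
  rw [← t_shift γ δ]
  have h := t_shift (X := X) (Y := smash Y Z) β (.refl _)
    (((Function.Embedding.refl _).sumMap finSumFinEquiv.symm.toEmbedding).trans α)
    (.precomp _ s) s₁
    (.zero _) x (t ((γ.sumMap δ).trans finSumFinEquiv.toEmbedding)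
      (CoSphere.comp₂ _ γ δ (.zero _) s₂ s₃) y z)
  rw [(smash Y Z).act_zero] at h
  refine Eq.trans ?_ h
  rw [t_t_right, t_t_right]
  refine tR_congr ?_ ?_ rfl rfl rfl
  · rintro (i | i | i) <;> simp [hε]
  · simp only [hr, CoSphere.precomp_val, mixR_val, mixL_val, comp₂_val, CoSphere.comp_val, zero_val, infty_val,
      map_add, map_zero, add_zero, zero_add, ← Sphere.push_trans, emb_assoc, refl_emb, inl_sumMap, inr_sumMap, inl_sumAssoc_symm, inl_inr_sumAssoc_symm, inr_inr_sumAssoc_symm, inl_inl_sumAssoc, inr_inl_sumAssoc, inr_sumAssoc, inl_sumComm, inr_sumComm, equiv_symm_emb]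
    try abel

theorem tL_shift (β : Fin a ↪ Fin a') (γ : Fin b ↪ Fin b') (δ : Fin c ↪ Fin c')
    (α : (Fin a' ⊕ Fin b') ⊕ Fin c' ↪ Fin n) (s : CoSphere α) (s₁ : CoSphere β) (s₂ : CoSphere γ)
    (s₃ : CoSphere δ) (x : X.obj a) (y : Y.obj b) (z : Z.obj c)
    (ε : (Fin a ⊕ Fin b) ⊕ Fin c ↪ Fin n) (r : CoSphere ε)
    (hε : ∀ i, ε i = α (Sum.map (Sum.map β γ) δ i))
    (hr : r.1 = s.1 +
      Sphere.push (Function.Embedding.inl.trans (Function.Embedding.inl.trans α)) s₁.1 +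
      Sphere.push (Function.Embedding.inr.trans (Function.Embedding.inl.trans α)) s₂.1 +
      Sphere.push (Function.Embedding.inr.trans α) s₃.1) :
    tL ε r x y z = tL α s (X.act β (s₁, x)) (Y.act γ (s₂, y)) (Z.act δ (s₃, z)) := by
  unfold tL
  rw [← t_shift β γ]
  have h := t_shift (X := smash X Y) (Y := Z) (.refl _) δ
    ((finSumFinEquiv.symm.toEmbedding.sumMap (Function.Embedding.refl _)).trans α)
    (.precomp _ s)
    (.zero _) s₃ (t ((β.sumMap γ).trans finSumFinEquiv.toEmbedding)
      (CoSphere.comp₂ _ β γ (.zero _) s₁ s₂) x y) z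
  rw [(smash X Y).act_zero] at h
  refine Eq.trans ?_ h
  rw [t_t_left, t_t_left]
  refine tL_congr ?_ ?_ rfl rfl rfl
  · rintro ((i | i) | i) <;> simp [hε]
  · simp only [hr, CoSphere.precomp_val, mixR_val, mixL_val, comp₂_val, CoSphere.comp_val, zero_val, infty_val,
      map_add, map_zero, add_zero, zero_add, ← Sphere.push_trans, emb_assoc, refl_emb, inl_sumMap, inr_sumMap, inl_sumAssoc_symm, inl_inr_sumAssoc_symm, inr_inr_sumAssoc_symm, inl_inl_sumAssoc, inr_inl_sumAssoc, inr_sumAssoc, inl_sumComm, inr_sumComm, equiv_symm_emb]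
    try abel

theorem kcont_tR {S : Type} [TopologicalSpace S] (γ : Fin a ⊕ (Fin b ⊕ Fin c) ↪ Fin n)
    {r : S → CoSphere γ} {f : S → X.obj a} {g : S → Y.obj b} {h : S → Z.obj c} (hr : KCont r)
    (hf : KCont f) (hg : KCont g) (hh : KCont h) :
    KCont fun p ↦ tR γ (r p) (f p) (g p) (h p) :=
  kcont_t_comp _ (KCont.comp (kcont _ (CoSphere.continuous_precomp _ γ)) hr :) hf
    (kcont_t_comp _ (kcont _ continuous_const) hg hh)

theorem kcont_tL {S : Type} [TopologicalSpace S] (γ : (Fin a ⊕ Fin b) ⊕ Fin c ↪ Fin n)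
    {r : S → CoSphere γ} {f : S → X.obj a} {g : S → Y.obj b} {h : S → Z.obj c} (hr : KCont r)
    (hf : KCont f) (hg : KCont g) (hh : KCont h) :
    KCont fun p ↦ tL γ (r p) (f p) (g p) (h p) :=
  kcont_t_comp _ (KCont.comp (kcont _ (CoSphere.continuous_precomp _ γ)) hr :)
    (kcont_t_comp _ (kcont _ continuous_const) hf hg) hh

section
variable (γ : Fin a ⊕ (Fin b ⊕ Fin c) ↪ Fin n) (s : CoSphere γ) (x : X.obj a) (y : Y.obj b)
  (z : Z.obj c)

theorem tR_infty (hs : s.1 = Sphere.infty) : tR γ s x y z = (smash X (smash Y Z)).pt :=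
  t_infty _ _ hs _ _
theorem tR_pt₁ : tR γ s X.pt y z = (smash X (smash Y Z)).pt := t_pt_left _ _ _
theorem tR_pt₂ : tR γ s x Y.pt z = (smash X (smash Y Z)).pt := by
  rw [tR, t_pt_left, t_pt_right]
theorem tR_pt₃ : tR γ s x y Z.pt = (smash X (smash Y Z)).pt := by
  rw [tR, t_pt_right, t_pt_right]

end

section
variable (γ : (Fin a ⊕ Fin b) ⊕ Fin c ↪ Fin n) (s : CoSphere γ) (x : X.obj a) (y : Y.obj b)
  (z : Z.obj c)

theorem tL_infty (hs : s.1 = Sphere.infty) : tL γ s x y z = (smash (smash X Y) Z).pt :=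
  t_infty _ _ hs _ _
theorem tL_pt₁ : tL γ s X.pt y z = (smash (smash X Y) Z).pt := by
  rw [tL, t_pt_left, t_pt_left]
theorem tL_pt₂ : tL γ s x Y.pt z = (smash (smash X Y) Z).pt := by
  rw [tL, t_pt_right, t_pt_left]
theorem tL_pt₃ : tL γ s x y Z.pt = (smash (smash X Y) Z).pt := t_pt_right _ _ _

end

theorem act_tR {k : ℕ} (δ : Fin n ↪ Fin k) (r : CoSphere δ)
    (γ : Fin a ⊕ (Fin b ⊕ Fin c) ↪ Fin n) (s : CoSphere γ) (x : X.obj a) (y : Y.obj b)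
    (z : Z.obj c) : (smash X (smash Y Z)).act δ (r, tR γ s x y z) =
      tR (γ.trans δ) (.comp δ r s) x y z := rfl

theorem act_tL {k : ℕ} (δ : Fin n ↪ Fin k) (r : CoSphere δ)
    (γ : (Fin a ⊕ Fin b) ⊕ Fin c ↪ Fin n) (s : CoSphere γ) (x : X.obj a) (y : Y.obj b)
    (z : Z.obj c) : (smash (smash X Y) Z).act δ (r, tL γ s x y z) =
      tL (γ.trans δ) (.comp δ r s) x y z := rfl

end Trilinear

/-- The associativity isomorphism on representatives. -/
def assocHomAux {b m n : ℕ} (α : Fin m ⊕ Fin b ↪ Fin n) (s : CoSphere α) (w : (smash X Y).obj m)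
    (z : Z.obj b) : (smash X (smash Y Z)).obj n :=
  smashLift (smash X (smash Y Z)).pt
    (fun β s' x y ↦ tR ((Equiv.sumAssoc _ _ _).symm.toEmbedding.trans
      ((β.sumMap (Function.Embedding.refl _)).trans α)) (.precomp _ (mixL α β s s')) x y z)
    (fun β ↦ kcont_tR _ (kcont _ ((CoSphere.continuous_precomp _ _).comp
      ((continuous_mixL α β).comp (continuous_const.prodMk continuous_fst))))
      (kcont _ (by fun_prop)) (kcont _ (by fun_prop)) (kcont _ (by fun_prop)))
    (fun β x y ↦ tR_infty _ _ _ _ _ (by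
      simp only [CoSphere.precomp_val, mixR_val, mixL_val, comp₂_val, CoSphere.comp_val, zero_val, infty_val, Sphere.push_infty, Sphere.add_infty]))
    (fun β s' y ↦ tR_pt₁ _ _ _ _) (fun β s' x ↦ tR_pt₂ _ _ _ _)
    (fun β γ δ s' s₁ s₂ x y ↦ by
      refine (tR_shift β γ (.refl _) _ (.precomp (Equiv.sumAssoc _ _ _).symm.toEmbedding (mixL α δ s s')) s₁ s₂ (.zero _) x y z _ _ ?_
        ?_).trans ?_
      · rintro (i | i | i) <;> simp
      · simp only [CoSphere.precomp_val, mixR_val, mixL_val, comp₂_val, CoSphere.comp_val, zero_val, infty_val,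
          map_add, map_zero, add_zero, zero_add, ← Sphere.push_trans, emb_assoc, refl_emb, inl_sumMap, inr_sumMap, inl_sumAssoc_symm, inl_inr_sumAssoc_symm, inr_inr_sumAssoc_symm, inl_inl_sumAssoc, inr_inl_sumAssoc, inr_sumAssoc, inl_sumComm, inr_sumComm, equiv_symm_emb]
        try abel
      · rw [Z.act_zero]) w

theorem assocHomAux_t {a b c m n : ℕ} (α : Fin m ⊕ Fin c ↪ Fin n) (s : CoSphere α)
    (β : Fin a ⊕ Fin b ↪ Fin m) (s' : CoSphere β) (x : X.obj a) (y : Y.obj b) (z : Z.obj c) :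
    assocHomAux α s (t β s' x y) z = tR ((Equiv.sumAssoc _ _ _).symm.toEmbedding.trans
      ((β.sumMap (Function.Embedding.refl _)).trans α)) (.precomp _ (mixL α β s s')) x y z := rfl

theorem kcont_assocHomAux {b m n : ℕ} (α : Fin m ⊕ Fin b ↪ Fin n) :
    KCont fun p : (smash X Y).obj m × (CoSphere α × Z.obj b) ↦ assocHomAux α p.2.1 p.1 p.2.2 :=
  kcont_smash fun β ↦ by
    simp only [assocHomAux_t]
    exact kcont_tR _ (kcont _ ((CoSphere.continuous_precomp _ _).comp
      ((continuous_mixL α β).comp ((continuous_fst.comp continuous_snd).prodMk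
        (continuous_fst.comp continuous_fst)))))
      (kcont _ (by fun_prop)) (kcont _ (by fun_prop)) (kcont _ (by fun_prop))

/-- The associativity isomorphism. -/
def assocHom (X Y Z : SymSpectrum) : smash (smash X Y) Z ⟶ smash X (smash Y Z) :=
  smashDesc assocHomAux
    (fun {a b n} α ↦ (KCont.comp (kcont_assocHomAux α)
      (kcont (fun p : CoSphere α × ((smash X Y).obj a × Z.obj b) ↦ (p.2.1, (p.1, p.2.2)))
        (by fun_prop)) :))
    (fun α w z ↦ by
      induction w using smash_ind with | h β s' x y
      exact tR_infty _ _ _ _ _ rfl)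
    (fun α s z ↦ tR_pt₁ _ _ _ _)
    (fun α s w ↦ by
      induction w using smash_ind with | h β s' x y
      exact tR_pt₃ _ _ _ _)
    (fun β γ α s s₁ s₂ w z ↦ by
      induction w using smash_ind with | h δ s' x y
      rw [act_t, assocHomAux_t, assocHomAux_t]
      refine (tR_shift (.refl _) (.refl _) γ _ (.precomp (Equiv.sumAssoc _ _ _).symm.toEmbedding (mixL α (δ.trans β) s (.comp β s₁ s')))
        (.zero _) (.zero _) s₂ x y z _ _ ?_ ?_).trans ?_
      · rintro (i | i | i) <;> simp
      · simp only [CoSphere.precomp_val, mixR_val, mixL_val, comp₂_val, CoSphere.comp_val, zero_val, infty_val,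
          map_add, map_zero, add_zero, zero_add, ← Sphere.push_trans, emb_assoc, refl_emb, inl_sumMap, inr_sumMap, inl_sumAssoc_symm, inl_inr_sumAssoc_symm, inr_inr_sumAssoc_symm, inl_inl_sumAssoc, inr_inl_sumAssoc, inr_sumAssoc, inl_sumComm, inr_sumComm, equiv_symm_emb]
        try abel
      · rw [X.act_zero, Y.act_zero])
    (fun α δ r s w z ↦ by
      induction w using smash_ind with | h β s' x y
      rw [assocHomAux_t, assocHomAux_t, act_tR]
      refine tR_congr (fun _ ↦ rfl) ?_ rfl rfl rfl
      simp only [CoSphere.precomp_val, mixR_val, mixL_val, comp₂_val, CoSphere.comp_val, zero_val, infty_val,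
          map_add, map_zero, add_zero, zero_add, ← Sphere.push_trans, emb_assoc, refl_emb, inl_sumMap, inr_sumMap, inl_sumAssoc_symm, inl_inr_sumAssoc_symm, inr_inr_sumAssoc_symm, inl_inl_sumAssoc, inr_inl_sumAssoc, inr_sumAssoc, inl_sumComm, inr_sumComm, equiv_symm_emb]
      try abel)

/-- The inverse of the associativity isomorphism on representatives. -/
def assocInvAux {a m n : ℕ} (α : Fin a ⊕ Fin m ↪ Fin n) (s : CoSphere α) (x : X.obj a)
    (w : (smash Y Z).obj m) : (smash (smash X Y) Z).obj n :=
  smashLift (smash (smash X Y) Z).pt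
    (fun β s' y z ↦ tL ((Equiv.sumAssoc _ _ _).toEmbedding.trans
      (((Function.Embedding.refl _).sumMap β).trans α)) (.precomp _ (mixR α β s s')) x y z)
    (fun β ↦ kcont_tL _ (kcont _ ((CoSphere.continuous_precomp _ _).comp
      ((continuous_mixR α β).comp (continuous_const.prodMk continuous_fst))))
      (kcont _ (by fun_prop)) (kcont _ (by fun_prop)) (kcont _ (by fun_prop)))
    (fun β x y ↦ tL_infty _ _ _ _ _ (by
      simp only [CoSphere.precomp_val, mixR_val, mixL_val, comp₂_val, CoSphere.comp_val, zero_val, infty_val, Sphere.push_infty, Sphere.add_infty]))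
    (fun β s' y ↦ tL_pt₂ _ _ _ _) (fun β s' x ↦ tL_pt₃ _ _ _ _)
    (fun β γ δ s' s₁ s₂ y z ↦ by
      refine (tL_shift (.refl _) β γ _ (.precomp (Equiv.sumAssoc _ _ _).toEmbedding (mixR α δ s s')) (.zero _) s₁ s₂ x y z _ _ ?_
        ?_).trans ?_
      · rintro ((i | i) | i) <;> simp
      · simp only [CoSphere.precomp_val, mixR_val, mixL_val, comp₂_val, CoSphere.comp_val, zero_val, infty_val,
          map_add, map_zero, add_zero, zero_add, ← Sphere.push_trans, emb_assoc, refl_emb, inl_sumMap, inr_sumMap, inl_sumAssoc_symm, inl_inr_sumAssoc_symm, inr_inr_sumAssoc_symm, inl_inl_sumAssoc, inr_inl_sumAssoc, inr_sumAssoc, inl_sumComm, inr_sumComm, equiv_symm_emb]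
        try abel
      · rw [X.act_zero]) w

theorem assocInvAux_t {a b c m n : ℕ} (α : Fin a ⊕ Fin m ↪ Fin n) (s : CoSphere α)
    (β : Fin b ⊕ Fin c ↪ Fin m) (s' : CoSphere β) (x : X.obj a) (y : Y.obj b) (z : Z.obj c) :
    assocInvAux α s x (t β s' y z) = tL ((Equiv.sumAssoc _ _ _).toEmbedding.trans
      (((Function.Embedding.refl _).sumMap β).trans α)) (.precomp _ (mixR α β s s')) x y z := rfl

theorem kcont_assocInvAux {a m n : ℕ} (α : Fin a ⊕ Fin m ↪ Fin n) :
    KCont fun p : (smash Y Z).obj m × (CoSphere α × X.obj a) ↦ assocInvAux α p.2.1 p.2.2 p.1 :=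
  kcont_smash fun β ↦ by
    simp only [assocInvAux_t]
    exact kcont_tL _ (kcont _ ((CoSphere.continuous_precomp _ _).comp
      ((continuous_mixR α β).comp ((continuous_fst.comp continuous_snd).prodMk
        (continuous_fst.comp continuous_fst)))))
      (kcont _ (by fun_prop)) (kcont _ (by fun_prop)) (kcont _ (by fun_prop))

/-- The inverse of the associativity isomorphism. -/
def assocInv (X Y Z : SymSpectrum) : smash X (smash Y Z) ⟶ smash (smash X Y) Z :=
  smashDesc assocInvAux
    (fun {a b n} α ↦ (KCont.comp (kcont_assocInvAux α)
      (kcont (fun p : CoSphere α × (X.obj a × (smash Y Z).obj b) ↦ (p.2.2, (p.1, p.2.1)))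
        (by fun_prop)) :))
    (fun α x w ↦ by
      induction w using smash_ind with | h β s' y z
      exact tL_infty _ _ _ _ _ rfl)
    (fun α s w ↦ by
      induction w using smash_ind with | h β s' y z
      exact tL_pt₁ _ _ _ _)
    (fun α s x ↦ tL_pt₂ _ _ _ _)
    (fun β γ α s s₁ s₂ x w ↦ by
      induction w using smash_ind with | h δ s' y z
      rw [act_t, assocInvAux_t, assocInvAux_t]
      refine (tL_shift β (.refl _) (.refl _) _ (.precomp (Equiv.sumAssoc _ _ _).toEmbedding (mixR α (δ.trans γ) s (.comp γ s₂ s')))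
        s₁ (.zero _) (.zero _) x y z _ _ ?_ ?_).trans ?_
      · rintro ((i | i) | i) <;> simp
      · simp only [CoSphere.precomp_val, mixR_val, mixL_val, comp₂_val, CoSphere.comp_val, zero_val, infty_val,
          map_add, map_zero, add_zero, zero_add, ← Sphere.push_trans, emb_assoc, refl_emb, inl_sumMap, inr_sumMap, inl_sumAssoc_symm, inl_inr_sumAssoc_symm, inr_inr_sumAssoc_symm, inl_inl_sumAssoc, inr_inl_sumAssoc, inr_sumAssoc, inl_sumComm, inr_sumComm, equiv_symm_emb]
        try abel
      · rw [Y.act_zero, Z.act_zero])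
    (fun α δ r s x w ↦ by
      induction w using smash_ind with | h β s' y z
      rw [assocInvAux_t, assocInvAux_t, act_tL]
      refine tL_congr (fun _ ↦ rfl) ?_ rfl rfl rfl
      simp only [CoSphere.precomp_val, mixR_val, mixL_val, comp₂_val, CoSphere.comp_val, zero_val, infty_val,
          map_add, map_zero, add_zero, zero_add, ← Sphere.push_trans, emb_assoc, refl_emb, inl_sumMap, inr_sumMap, inl_sumAssoc_symm, inl_inr_sumAssoc_symm, inr_inr_sumAssoc_symm, inl_inl_sumAssoc, inr_inl_sumAssoc, inr_sumAssoc, inl_sumComm, inr_sumComm, equiv_symm_emb]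
      try abel)

section
variable {a b c m n : ℕ}

theorem assocHom_t (α : Fin m ⊕ Fin c ↪ Fin n) (s : CoSphere α)
    (β : Fin a ⊕ Fin b ↪ Fin m) (s' : CoSphere β) (x : X.obj a) (y : Y.obj b) (z : Z.obj c) :
    (assocHom X Y Z).app (t α s (t β s' x y) z) = tR ((Equiv.sumAssoc _ _ _).symm.toEmbedding.trans
      ((β.sumMap (Function.Embedding.refl _)).trans α)) (.precomp _ (mixL α β s s')) x y z := rfl

theorem assocInv_t (α : Fin a ⊕ Fin m ↪ Fin n) (s : CoSphere α)
    (β : Fin b ⊕ Fin c ↪ Fin m) (s' : CoSphere β) (x : X.obj a) (y : Y.obj b) (z : Z.obj c) :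
    (assocInv X Y Z).app (t α s x (t β s' y z)) = tL ((Equiv.sumAssoc _ _ _).toEmbedding.trans
      (((Function.Embedding.refl _).sumMap β).trans α)) (.precomp _ (mixR α β s s')) x y z := rfl

end

/-- The associativity isomorphism. -/
def assoc (X Y Z : SymSpectrum) : smash (smash X Y) Z ≅ smash X (smash Y Z) where
  hom := assocHom X Y Z
  inv := assocInv X Y Z
  hom_inv_id := smash_hom_ext fun α s w z ↦ by
    induction w using smash_ind with | h β s' x y
    rw [comp_app, assocHom_t, tR, assocInv_t, id_app, t_t_left]
    refine tL_congr ?_ ?_ rfl rfl rfl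
    · rintro ((i | i) | i) <;> simp
    · simp only [CoSphere.precomp_val, mixR_val, mixL_val, comp₂_val, CoSphere.comp_val, zero_val, infty_val,
        map_add, map_zero, add_zero, zero_add, ← Sphere.push_trans, emb_assoc, refl_emb, inl_sumMap, inr_sumMap, inl_sumAssoc_symm, inl_inr_sumAssoc_symm, inr_inr_sumAssoc_symm, inl_inl_sumAssoc, inr_inl_sumAssoc, inr_sumAssoc, inl_sumComm, inr_sumComm, equiv_symm_emb]
      try abel
  inv_hom_id := smash_hom_ext fun α s x w ↦ by
    induction w using smash_ind with | h β s' y z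
    rw [comp_app, assocInv_t, tL, assocHom_t, id_app, t_t_right]
    refine tR_congr ?_ ?_ rfl rfl rfl
    · rintro (i | i | i) <;> simp
    · simp only [CoSphere.precomp_val, mixR_val, mixL_val, comp₂_val, CoSphere.comp_val, zero_val, infty_val,
        map_add, map_zero, add_zero, zero_add, ← Sphere.push_trans, emb_assoc, refl_emb, inl_sumMap, inr_sumMap, inl_sumAssoc_symm, inl_inr_sumAssoc_symm, inr_inr_sumAssoc_symm, inl_inl_sumAssoc, inr_inl_sumAssoc, inr_sumAssoc, inl_sumComm, inr_sumComm, equiv_symm_emb]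
      try abel

/-- The smash product of two morphisms. -/
def smashMap (f : X ⟶ X') (g : Y ⟶ Y') : smash X Y ⟶ smash X' Y' :=
  smashDesc (fun α s x y ↦ t α s (f.app x) (g.app y))
    (fun α ↦ kcont_t_comp α (kcont _ (by fun_prop))
      (kcont _ (f.continuous_app.comp (by fun_prop)))
      (kcont _ (g.continuous_app.comp (by fun_prop))))
    (fun α x y ↦ t_infty _ _ rfl _ _)
    (fun α s y ↦ by rw [f.app_pt, t_pt_left])
    (fun α s x ↦ by rw [g.app_pt, t_pt_right])
    (fun β γ α s s₁ s₂ x y ↦ by rw [t_shift, f.app_act, g.app_act])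
    (fun α δ r s x y ↦ rfl)

/-- The symmetry isomorphism. -/
def swap (X Y : SymSpectrum) : smash X Y ⟶ smash Y X :=
  smashDesc (fun α s x y ↦ t ((Equiv.sumComm _ _).toEmbedding.trans α) (.precomp _ s) y x)
    (fun α ↦ kcont_t_comp _ (kcont _ ((CoSphere.continuous_precomp _ _).comp continuous_fst))
      (kcont _ (by fun_prop)) (kcont _ (by fun_prop)))
    (fun α x y ↦ t_infty _ _ rfl _ _)
    (fun α s y ↦ t_pt_right _ _ _)
    (fun α s x ↦ t_pt_left _ _ _)
    (fun β γ α s s₁ s₂ x y ↦ by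
      rw [← t_shift]
      refine t_congr ?_ ?_ rfl rfl
      · rintro (i | i) <;> simp
      · simp only [CoSphere.precomp_val, mixR_val, mixL_val, comp₂_val, CoSphere.comp_val, zero_val, infty_val,
          map_add, map_zero, add_zero, zero_add, ← Sphere.push_trans, emb_assoc, refl_emb, inl_sumMap, inr_sumMap, inl_sumAssoc_symm, inl_inr_sumAssoc_symm, inr_inr_sumAssoc_symm, inl_inl_sumAssoc, inr_inl_sumAssoc, inr_sumAssoc, inl_sumComm, inr_sumComm, equiv_symm_emb]
        try abel)
    (fun α δ r s x y ↦ rfl)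

theorem swap_t {a b n : ℕ} (α : Fin a ⊕ Fin b ↪ Fin n) (s : CoSphere α) (x : X.obj a)
    (y : Y.obj b) : (swap X Y).app (t α s x y) =
      t ((Equiv.sumComm _ _).toEmbedding.trans α) (.precomp _ s) y x := rfl

theorem swap_swap (X Y : SymSpectrum) : swap X Y ≫ swap Y X = 𝟙 _ :=
  smash_hom_ext fun α s x y ↦ by
    rw [comp_app, swap_t, swap_t, id_app]
    refine t_congr ?_ rfl rfl rfl
    rintro (i | i) <;> rfl

theorem smash_comp {l m n : ℕ} (β : Fin l ↪ Fin m) (α : Fin m ↪ Fin n) (s : CoSphere α)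
    (t : CoSphere β) (x : Sphere l) : Sphere.smash (β.trans α) (CoSphere.comp α s t, x) =
      Sphere.smash α (s, Sphere.smash β (t, x)) := by
  simp only [Sphere.smash, CoSphere.comp_val, map_add, Sphere.push_trans, add_assoc]

/-- The sphere spectrum. -/
abbrev sphere : SymSpectrum where
  obj := Sphere
  pt := Sphere.infty
  act α := Sphere.smash α
  kcont_act α := kcont _ (Sphere.continuous_smash α)
  act_infty _ _ := rfl
  act_pt _ _ := Sphere.add_infty _
  act_zero x := by
    change 0 + Sphere.push (.refl _) x = x
    rw [zero_add, Sphere.push_refl]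
  act_comp β α s t x := smash_comp β α s t x

/-- The sphere coordinate in the left unit isomorphism. -/
def unitCoord {a b n : ℕ} (α : Fin a ⊕ Fin b ↪ Fin n) (s : CoSphere α) (u : Sphere a) :
    CoSphere (Function.Embedding.inr.trans α) :=
  ⟨s.1 + Sphere.push (Function.Embedding.inl.trans α) u, by
    refine (s.2.mono ?_).add ((Sphere.suppOn_push u _).mono ?_)
    · rw [Set.compl_subset_compl]
      rintro _ ⟨i, rfl⟩
      exact ⟨_, rfl⟩
    · rintro _ ⟨i, rfl⟩ ⟨j, hj⟩
      exact absurd (α.injective hj) (by simp)⟩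

theorem unitCoord_val {a b n : ℕ} (α : Fin a ⊕ Fin b ↪ Fin n) (s : CoSphere α) (u : Sphere a) :
    (unitCoord α s u).1 = s.1 + Sphere.push (Function.Embedding.inl.trans α) u := rfl

theorem continuous_unitCoord {a b n : ℕ} (α : Fin a ⊕ Fin b ↪ Fin n) :
    Continuous fun p : CoSphere α × Sphere a ↦ unitCoord α p.1 p.2 := by
  have h1 := (CoSphere.continuous_add (α := α)
    (A := Set.range (Function.Embedding.inl.trans α)) (by rintro _ ⟨j, rfl⟩; exact ⟨_, rfl⟩)).comp
    (continuous_fst.prodMk (((Sphere.continuous_push (Function.Embedding.inl.trans α)).comp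
      continuous_snd).subtype_mk
      fun p : CoSphere α × Sphere a ↦ Sphere.suppOn_push p.2 (Function.Embedding.inl.trans α)))
  exact h1.subtype_mk _

/-- The left unit isomorphism on representatives. -/
def leftUnitAux {a b n : ℕ} (α : Fin a ⊕ Fin b ↪ Fin n) (s : CoSphere α) (u : sphere.obj a)
    (x : X.obj b) : X.obj n := X.act (Function.Embedding.inr.trans α) (unitCoord α s u, x)

/-- The left unit isomorphism. -/
def leftUnitHom (X : SymSpectrum) : smash sphere X ⟶ X :=
  smashDesc leftUnitAux
    (fun {a b n} α ↦ (KCont.comp (X.kcont_act (Function.Embedding.inr.trans α))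
      (kcont (fun p : CoSphere α × (Sphere a × X.obj b) ↦ (unitCoord α p.1 p.2.1, p.2.2))
        (((continuous_unitCoord α).comp (by fun_prop : Continuous fun p : CoSphere α ×
          (Sphere a × X.obj b) ↦ (p.1, p.2.1))).prodMk (by fun_prop))) :))
    (fun α u x ↦ (act_congr (s' := .infty _) (fun _ ↦ rfl) rfl rfl).trans (X.act_infty _ x))
    (fun α s x ↦ (act_congr (s' := .infty _) (fun _ ↦ rfl)
      ((congrArg _ (Sphere.push_infty _)).trans (Sphere.add_infty _)) rfl).trans (X.act_infty _ x))
    (fun α s u ↦ X.act_pt _ _)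
    (fun β γ α s s₁ s₂ u x ↦ by
      refine Eq.trans (act_congr (fun _ ↦ rfl) ?_ rfl)
        (X.act_comp γ (Function.Embedding.inr.trans α) (unitCoord α s (sphere.act β (s₁, u))) s₂ x)
      change _ + Sphere.push _ u = s.1 + Sphere.push _ (s₁.1 + Sphere.push β u) + Sphere.push _ s₂.1
      simp only [CoSphere.precomp_val, mixR_val, mixL_val, comp₂_val, CoSphere.comp_val, zero_val, infty_val,
          map_add, map_zero, add_zero, zero_add, ← Sphere.push_trans, emb_assoc, refl_emb, inl_sumMap, inr_sumMap, inl_sumAssoc_symm, inl_inr_sumAssoc_symm, inr_inr_sumAssoc_symm, inl_inl_sumAssoc, inr_inl_sumAssoc, inr_sumAssoc, inl_sumComm, inr_sumComm, equiv_symm_emb]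
      try abel)
    (fun α δ r s u x ↦ by
      refine Eq.trans (act_congr (fun _ ↦ rfl) ?_ rfl)
        (X.act_comp (Function.Embedding.inr.trans α) δ r (unitCoord α s u) x)
      change (r.1 + Sphere.push δ s.1) + Sphere.push _ u =
        r.1 + Sphere.push δ (s.1 + Sphere.push _ u)
      simp only [CoSphere.precomp_val, mixR_val, mixL_val, comp₂_val, CoSphere.comp_val, zero_val, infty_val,
          map_add, map_zero, add_zero, zero_add, ← Sphere.push_trans, emb_assoc, refl_emb, inl_sumMap, inr_sumMap, inl_sumAssoc_symm, inl_inr_sumAssoc_symm, inr_inr_sumAssoc_symm, inl_inl_sumAssoc, inr_inl_sumAssoc, inr_sumAssoc, inl_sumComm, inr_sumComm, equiv_symm_emb]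
      try abel)

theorem leftUnitHom_t {a b n : ℕ} (α : Fin a ⊕ Fin b ↪ Fin n) (s : CoSphere α)
    (u : sphere.obj a) (x : X.obj b) : (leftUnitHom X).app (t α s u x) =
      X.act (Function.Embedding.inr.trans α) (unitCoord α s u, x) := rfl

/-- The inverse of the left unit isomorphism on representatives. -/
def leftUnitInvAux {n : ℕ} (x : X.obj n) : (smash sphere X).obj n :=
  t (a := 0) (Equiv.emptySum _ _).toEmbedding (.zero _) (0 : Sphere 0) x

theorem leftUnitInvAux_act {m n : ℕ} (α : Fin m ↪ Fin n) (s : CoSphere α) (x : X.obj m) :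
    leftUnitInvAux (X.act α (s, x)) =
      t (a := 0) ((Equiv.emptySum _ _).toEmbedding.trans α) (.precomp _ s) (0 : Sphere 0) x := by
  have h := t_shift (X := sphere) (Y := X) (.refl (Fin 0)) α (Equiv.emptySum _ _).toEmbedding
    (.zero _) (.zero _) s (0 : Sphere 0) x
  rw [sphere.act_zero] at h
  refine h.symm.trans (t_congr ?_ ?_ rfl rfl)
  · rintro (i | i)
    · exact i.elim0
    · rfl
  · rw [comp₂_val, zero_val, zero_val, map_zero, add_zero, zero_add, CoSphere.precomp_val]
    exact Sphere.push_refl s.1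

/-- The left unit isomorphism. -/
def leftUnit (X : SymSpectrum) : smash sphere X ≅ X where
  hom := leftUnitHom X
  inv :=
    { app := leftUnitInvAux
      continuous_app := (kcont_t_comp _ (kcont _ continuous_const) (kcont _ continuous_const)
        (kcont _ continuous_id)).continuous
      app_pt := t_pt_right _ _ _
      app_act := fun α s x ↦ by
        rw [leftUnitInvAux_act, leftUnitInvAux, act_t]
        refine t_congr (fun _ ↦ rfl) ?_ rfl rfl
        simp only [CoSphere.precomp_val, mixR_val, mixL_val, comp₂_val, CoSphere.comp_val, zero_val, infty_val,
            map_add, map_zero, add_zero, zero_add, ← Sphere.push_trans, emb_assoc, refl_emb, inl_sumMap, inr_sumMap, inl_sumAssoc_symm, inl_inr_sumAssoc_symm, inr_inr_sumAssoc_symm, inl_inl_sumAssoc, inr_inl_sumAssoc, inr_sumAssoc, inl_sumComm, inr_sumComm, equiv_symm_emb]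
        try abel }
  hom_inv_id := smash_hom_ext fun {a b n} α s u x ↦ by
    rw [comp_app, id_app, leftUnitHom_t]
    refine (leftUnitInvAux_act _ _ _).trans ?_
    have h := t_shift (X := sphere) (Y := X) (⟨Fin.elim0, fun i ↦ i.elim0⟩ : Fin 0 ↪ Fin a)
      (.refl _) α s ⟨u, fun _ _ i hi ↦ absurd (by simp) hi⟩ (.zero _) (0 : Sphere 0) x
    rw [X.act_zero] at h
    have hu : sphere.act (⟨Fin.elim0, fun i ↦ i.elim0⟩ : Fin 0 ↪ Fin a)
        (⟨u, fun _ _ i hi ↦ absurd (by simp) hi⟩, (0 : Sphere 0)) = u := by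
      change u + Sphere.push _ 0 = u
      rw [map_zero, add_zero]
    rw [hu] at h
    refine Eq.trans (t_congr ?_ ?_ rfl rfl) h
    · rintro (i | i)
      · exact i.elim0
      · rfl
    · simp only [unitCoord_val, CoSphere.precomp_val, mixR_val, mixL_val, comp₂_val, CoSphere.comp_val, zero_val, infty_val,
        map_add, map_zero, add_zero, zero_add, ← Sphere.push_trans, emb_assoc, refl_emb, inl_sumMap, inr_sumMap, inl_sumAssoc_symm, inl_inr_sumAssoc_symm, inr_inr_sumAssoc_symm, inl_inl_sumAssoc, inr_inl_sumAssoc, inr_sumAssoc, inl_sumComm, inr_sumComm, equiv_symm_emb]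
      try abel
  inv_hom_id := hom_ext fun x ↦ by
    refine act_refl _ (fun _ ↦ rfl) _ ?_ x
    change 0 + Sphere.push _ 0 = 0
    rw [map_zero, add_zero]

instance : MonoidalCategoryStruct SymSpectrum where
  tensorObj := smash
  tensorHom := smashMap
  whiskerLeft X _ _ f := smashMap (𝟙 X) f
  whiskerRight f Y := smashMap f (𝟙 Y)
  tensorUnit := sphere
  associator := assoc
  leftUnitor := leftUnit
  rightUnitor X := ⟨swap X sphere, swap sphere X, swap_swap _ _, swap_swap _ _⟩ ≪≫ leftUnit X

section
variable {a b c m n : ℕ}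

theorem tensor_t (f : X ⟶ X') (g : Y ⟶ Y') (α : Fin a ⊕ Fin b ↪ Fin n) (s : CoSphere α)
    (x : X.obj a) (y : Y.obj b) : (f ⊗ₘ g).app (t α s x y) = t α s (f.app x) (g.app y) := rfl

theorem leftUnitor_t (α : Fin a ⊕ Fin b ↪ Fin n) (s : CoSphere α) (u : (𝟙_ SymSpectrum).obj a)
    (x : X.obj b) : (λ_ X).hom.app (t α s u x) =
      X.act (Function.Embedding.inr.trans α) (unitCoord α s u, x) := rfl

theorem rightUnitor_t (α : Fin a ⊕ Fin b ↪ Fin n) (s : CoSphere α) (x : X.obj a)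
    (u : (𝟙_ SymSpectrum).obj b) : (ρ_ X).hom.app (t α s x u) =
      X.act (Function.Embedding.inl.trans α)
        (unitCoord ((Equiv.sumComm _ _).toEmbedding.trans α) (.precomp _ s) u, x) := rfl

theorem associator_t (α : Fin m ⊕ Fin c ↪ Fin n) (s : CoSphere α) (β : Fin a ⊕ Fin b ↪ Fin m)
    (s' : CoSphere β) (x : X.obj a) (y : Y.obj b) (z : Z.obj c) :
    (α_ X Y Z).hom.app (t α s (t β s' x y) z) =
      tR ((Equiv.sumAssoc _ _ _).symm.toEmbedding.trans
        ((β.sumMap (Function.Embedding.refl _)).trans α)) (.precomp _ (mixL α β s s')) x y z := rfl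

theorem associator_inv_t (α : Fin a ⊕ Fin m ↪ Fin n) (s : CoSphere α) (β : Fin b ⊕ Fin c ↪ Fin m)
    (s' : CoSphere β) (x : X.obj a) (y : Y.obj b) (z : Z.obj c) :
    (α_ X Y Z).inv.app (t α s x (t β s' y z)) =
      tL ((Equiv.sumAssoc _ _ _).toEmbedding.trans
        (((Function.Embedding.refl _).sumMap β).trans α)) (.precomp _ (mixR α β s s')) x y z := rfl

end

theorem pentagon_aux (W X Y Z : SymSpectrum) :
    ((α_ W X Y).hom ⊗ₘ 𝟙 Z) ≫ (α_ W (X ⊗ Y) Z).hom ≫ (𝟙 W ⊗ₘ (α_ X Y Z).hom) =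
      (α_ (W ⊗ X) Y Z).hom ≫ (α_ W X (Y ⊗ Z)).hom := smash_hom_ext fun α s v z ↦ by
  induction v using smash_ind with | h β s' v y
  induction v using smash_ind with | h γ s'' w x
  simp only [comp_app]
  rw [tensor_t, associator_t, associator_t, tR, tR, associator_t, tR, associator_t, tR, tensor_t,
    associator_t, tR]
  refine (t_t_right _ _ _ _ _ _ _).trans (Eq.trans ?_ (t_t_right _ _ _ _ _ _ _).symm)
  simp only [id_app]
  refine tR_congr ?_ ?_ rfl rfl rfl
  · rintro (i | i | i)
    · simp
    · simp
    · obtain ⟨(i | i), rfl⟩ := finSumFinEquiv.surjective i <;> simp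
  · simp only [CoSphere.precomp_val, mixR_val, mixL_val, comp₂_val, CoSphere.comp_val, zero_val, infty_val,
      map_add, map_zero, add_zero, zero_add, ← Sphere.push_trans, emb_assoc, refl_emb, inl_sumMap, inr_sumMap, inl_sumAssoc_symm, inl_inr_sumAssoc_symm, inr_inr_sumAssoc_symm, inl_inl_sumAssoc, inr_inl_sumAssoc, inr_sumAssoc, inl_sumComm, inr_sumComm, equiv_symm_emb]
    try abel

theorem triangle_aux (X Y : SymSpectrum) :
    (α_ X (𝟙_ SymSpectrum) Y).hom ≫ (𝟙 X ⊗ₘ (λ_ Y).hom) = (ρ_ X).hom ⊗ₘ 𝟙 Y :=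
  smash_hom_ext fun {m c n} α s w y ↦ by
    induction w using smash_ind with | @h a b β s' x u
    have hL := t_shift (X := X) (Y := Y) (.refl (Fin a))
      (Function.Embedding.inr.trans (finSumFinEquiv (m := b) (n := c)).toEmbedding)
      (((Function.Embedding.refl (Fin a)).sumMap finSumFinEquiv.symm.toEmbedding).trans
        ((Equiv.sumAssoc _ _ _).symm.toEmbedding.trans
          ((β.sumMap (Function.Embedding.refl _)).trans α)))
      (.precomp _ (.precomp _ (mixL α β s s'))) (.zero _)
      (unitCoord finSumFinEquiv.toEmbedding (.zero _) u) x y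
    have hR := t_shift (X := X) (Y := Y) (Function.Embedding.inl.trans β) (.refl _) α s
      (unitCoord ((Equiv.sumComm _ _).toEmbedding.trans β)
        (.precomp (Equiv.sumComm _ _).toEmbedding s') u) (.zero _) x y
    rw [X.act_zero] at hL
    rw [Y.act_zero] at hR
    refine hL.symm.trans (Eq.trans (t_congr ?_ ?_ rfl rfl) hR)
    · rintro (i | i) <;> simp
    · change _ = s.1 + Sphere.push (Function.Embedding.inl.trans α)
        (s'.1 + Sphere.push (Function.Embedding.inr.trans β) u) +
        Sphere.push (Function.Embedding.inr.trans α) 0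
      simp only [unitCoord_val, CoSphere.precomp_val, mixR_val, mixL_val, comp₂_val, CoSphere.comp_val, zero_val, infty_val,
          map_add, map_zero, add_zero, zero_add, ← Sphere.push_trans, emb_assoc, refl_emb, inl_sumMap, inr_sumMap, inl_sumAssoc_symm, inl_inr_sumAssoc_symm, inr_inr_sumAssoc_symm, inl_inl_sumAssoc, inr_inl_sumAssoc, inr_sumAssoc, inl_sumComm, inr_sumComm, equiv_symm_emb]
      try abel

instance : MonoidalCategory SymSpectrum := MonoidalCategory.ofTensorHom
  (id_tensorHom_id := fun _ _ ↦ smash_hom_ext fun _ _ _ _ ↦ rfl)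
  (id_tensorHom := fun _ _ _ _ ↦ rfl)
  (tensorHom_id := fun _ _ ↦ rfl)
  (tensorHom_comp_tensorHom := fun _ _ _ _ ↦ smash_hom_ext fun _ _ _ _ ↦ rfl)
  (associator_naturality := fun _ _ _ ↦ smash_hom_ext fun α s w z ↦ by
    induction w using smash_ind with | h β s' x y
    rfl)
  (leftUnitor_naturality := fun f ↦ smash_hom_ext fun α s u x ↦
    (f.app_act (Function.Embedding.inr.trans α) _ x).symm)
  (rightUnitor_naturality := fun f ↦ smash_hom_ext fun α s x u ↦
    (f.app_act (Function.Embedding.inl.trans α) _ x).symm)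
  (pentagon := pentagon_aux)
  (triangle := triangle_aux)

/-- The symmetry isomorphism. -/
def braid (X Y : SymSpectrum) : X ⊗ Y ≅ Y ⊗ X :=
  ⟨swap X Y, swap Y X, swap_swap _ _, swap_swap _ _⟩

section
variable {a b n : ℕ} (α : Fin a ⊕ Fin b ↪ Fin n) (s : CoSphere α) (x : X.obj a) (y : Y.obj b)

theorem braid_t : (braid X Y).hom.app (t α s x y) =
    t ((Equiv.sumComm _ _).toEmbedding.trans α) (.precomp _ s) y x := rfl

theorem whiskerLeft_t (g : Y ⟶ Y') : (X ◁ g).app (t α s x y) = t α s x (g.app y) := rfl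

theorem whiskerRight_t (f : X ⟶ X') : (f ▷ Y).app (t α s x y) = t α s (f.app x) y := rfl

end

theorem hexagon_aux (X Y Z : SymSpectrum) :
    (α_ X Y Z).hom ≫ (braid X (Y ⊗ Z)).hom ≫ (α_ Y Z X).hom =
      ((braid X Y).hom ▷ Z) ≫ (α_ Y X Z).hom ≫ (Y ◁ (braid X Z).hom) :=
  smash_hom_ext fun α s w z ↦ by
    induction w using smash_ind with | h β s' x y
    simp only [comp_app]
    rw [associator_t, tR, braid_t, associator_t, whiskerRight_t, braid_t, associator_t,
      tR, tR, whiskerLeft_t, braid_t]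
    refine (t_t_right _ _ _ _ _ _ _).trans (Eq.trans ?_ (t_t_right _ _ _ _ _ _ _).symm)
    refine tR_congr ?_ ?_ rfl rfl rfl
    · rintro (i | i | i) <;> simp
    · simp only [CoSphere.precomp_val, mixR_val, mixL_val, comp₂_val, CoSphere.comp_val, zero_val, infty_val,
        map_add, map_zero, add_zero, zero_add, ← Sphere.push_trans, emb_assoc, refl_emb, inl_sumMap, inr_sumMap, inl_sumAssoc_symm, inl_inr_sumAssoc_symm, inr_inr_sumAssoc_symm, inl_inl_sumAssoc, inr_inl_sumAssoc, inr_sumAssoc, inl_sumComm, inr_sumComm, equiv_symm_emb]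
      try abel

theorem hexagon_aux' (X Y Z : SymSpectrum) :
    (α_ X Y Z).inv ≫ (braid (X ⊗ Y) Z).hom ≫ (α_ Z X Y).inv =
      (X ◁ (braid Y Z).hom) ≫ (α_ X Z Y).inv ≫ ((braid X Z).hom ▷ Y) :=
  smash_hom_ext fun α s x w ↦ by
    induction w using smash_ind with | h β s' y z
    simp only [comp_app]
    rw [associator_inv_t, tL, braid_t, associator_inv_t, whiskerLeft_t, braid_t,
      associator_inv_t, tL, tL, whiskerRight_t, braid_t]
    refine (t_t_left _ _ _ _ _ _ _).trans (Eq.trans ?_ (t_t_left _ _ _ _ _ _ _).symm)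
    refine tL_congr ?_ ?_ rfl rfl rfl
    · rintro ((i | i) | i) <;> simp
    · simp only [CoSphere.precomp_val, mixR_val, mixL_val, comp₂_val, CoSphere.comp_val, zero_val, infty_val,
        map_add, map_zero, add_zero, zero_add, ← Sphere.push_trans, emb_assoc, refl_emb, inl_sumMap, inr_sumMap, inl_sumAssoc_symm, inl_inr_sumAssoc_symm, inr_inr_sumAssoc_symm, inl_inl_sumAssoc, inr_inl_sumAssoc, inr_sumAssoc, inl_sumComm, inr_sumComm, equiv_symm_emb]
      try abel

instance : SymmetricCategory SymSpectrum where
  braiding := braid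
  braiding_naturality_right _ _ _ _ := smash_hom_ext fun _ _ _ _ ↦ rfl
  braiding_naturality_left _ _ := smash_hom_ext fun _ _ _ _ ↦ rfl
  hexagon_forward := hexagon_aux
  hexagon_reverse := hexagon_aux'
  symmetry X Y := swap_swap X Y

end SymSpectrum

/-! ### The symmetric Thom spectrum functor -/

/-- The space `V(n) = B(*, F(n), Sⁿ)`. -/
abbrev VObj (n : ℕ) : Type := Bar (F n) (Sphere n)

namespace V

variable {l m n : ℕ}

/-- The projection `V(n) → BF(n)` induced by `Sⁿ → *`. -/
def proj : VObj n → BF.obj n :=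
  Bar.map (MonoidHom.id _) continuous_id (fun _ ↦ ()) continuous_const fun _ _ ↦ rfl

/-- The section `BF(n) → V(n)` induced by the inclusion of the base point `* → Sⁿ`. -/
def sec : BF.obj n → VObj n :=
  Bar.map (MonoidHom.id _) continuous_id (fun _ ↦ Sphere.infty) continuous_const
    fun g _ ↦ (F.smul_infty g).symm

theorem continuous_proj : Continuous (proj (n := n)) := Bar.continuous_map _ _ _ _ _

theorem continuous_sec : Continuous (sec (n := n)) := Bar.continuous_map _ _ _ _ _

/-- The structure maps `S^{n-α} × V(m) → V(n)`, induced by the homomorphism `F(m) → F(n)` and by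
`S^{n-α} × Sᵐ → Sⁿ`. -/
def act (α : Fin m ↪ Fin n) (p : CoSphere α × VObj m) : VObj n :=
  Bar.map (F.map α) (F.continuous_map α) (fun x ↦ Sphere.smash α (p.1, x))
    ((Sphere.continuous_smash α).comp (by fun_prop))
    (fun g x ↦ (F.map_smul_smash α g (p.1, x)).symm) p.2

theorem act_mk (α : Fin m ↪ Fin n) (s : CoSphere α) (w : BarWord (F m)) (x : Sphere m) :
    act α (s, Bar.mk w x) = Bar.mk (Bar.mapWord (F.map α) w) (Sphere.smash α (s, x)) := rfl

theorem proj_mk (w : BarWord (F m)) (x : Sphere m) : proj (Bar.mk w x) = BF.mk w :=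
  congrArg BF.mk (Bar.mapWord_id w)

theorem sec_mk (w : BarWord (F m)) : sec (BF.mk w) = Bar.mk w Sphere.infty :=
  congrArg (fun u ↦ Bar.mk u Sphere.infty) (Bar.mapWord_id w)

theorem kcont_act (α : Fin m ↪ Fin n) : KCont (act α) := by
  refine KQuot.kcont_prod_right (B := CoSphere α) (A := BarWord (F m) × Sphere m) ?_
  exact (KCont.comp Bar.kcont_mk (kcont (fun p : CoSphere α × (BarWord (F m) × Sphere m) ↦
    (Bar.mapWord (F.map α) p.2.1, Sphere.smash α (p.1, p.2.2)))
    (((Bar.continuous_mapWord (F.continuous_map α)).comp (by fun_prop)).prodMk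
      ((Sphere.continuous_smash α).comp (by fun_prop)))) :)

theorem proj_sec (b : BF.obj n) : proj (sec b) = b := by
  induction b using BF.ind with | h w
  rw [sec_mk, proj_mk]

theorem proj_act (α : Fin m ↪ Fin n) (s : CoSphere α) (v : VObj m) :
    proj (act α (s, v)) = BF.map α (proj v) := by
  induction v using Bar.ind with | h w x
  rw [act_mk, proj_mk, proj_mk, BF.map_mk]

theorem act_infty (α : Fin m ↪ Fin n) (v : VObj m) :
    act α (.infty α, v) = sec (BF.map α (proj v)) := by
  induction v using Bar.ind with | h w x
  rw [act_mk, proj_mk, BF.map_mk, sec_mk]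
  rfl

theorem act_sec (α : Fin m ↪ Fin n) (s : CoSphere α) (b : BF.obj m) :
    act α (s, sec b) = sec (BF.map α b) := by
  induction b using BF.ind with | h w
  rw [sec_mk, act_mk, BF.map_mk, sec_mk]
  exact congrArg _ (Sphere.add_infty _)

theorem act_zero (v : VObj n) : act (.refl _) (.zero _, v) = v := by
  induction v using Bar.ind with | h w x
  rw [act_mk]
  refine congrArg₂ Bar.mk ?_ ?_
  · rw [show (F.map (.refl (Fin n)) : F n → F n) = id from funext F.map_refl, Bar.mapWord_id]
  · exact (zero_add _).trans (Sphere.push_refl x)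

theorem act_comp (β : Fin l ↪ Fin m) (α : Fin m ↪ Fin n) (s : CoSphere α) (t : CoSphere β)
    (v : VObj l) : act (β.trans α) (CoSphere.comp α s t, v) = act α (s, act β (t, v)) := by
  induction v using Bar.ind with | h w x
  rw [act_mk, act_mk, act_mk, Bar.mapWord_comp]
  refine congrArg₂ Bar.mk ?_ ?_
  · rw [show (F.map (β.trans α) : F l → F n) = F.map α ∘ F.map β from funext (F.map_trans β α)]
  · simp only [Sphere.smash, CoSphere.comp, map_add, Sphere.push_trans, add_assoc]

end V

/-- The pullback of `V(n) → BF(n)` along a map `f : X → BF(n)`. -/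
abbrev ThomPullback {X : Type} {n : ℕ} (f : X → BF.obj n) : Type :=
  {p : X × VObj n // f p.1 = V.proj p.2}

/-- The Thom space of `f : X → BF(n)`: the quotient of the pullback of `V(n)` by the image of the
section, with that image as base point. (If `X` is empty, this is the one-point space.) -/
def ThomSpace {X : Type} [TopologicalSpace X] {n : ℕ} (f : X → BF.obj n) : Type :=
  KQuot fun a b : ThomPullback f ⊕ Unit ↦
    ∃ p : ThomPullback f, p.1.2 = V.sec (f p.1.1) ∧ a = .inl p ∧ b = .inr ()

namespace ThomSpace

section
variable {X Y Z A : Type} [TopologicalSpace X] [TopologicalSpace Y] [TopologicalSpace Z]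
  [TopologicalSpace A] {m n : ℕ} {f : X → BF.obj n} {g : Y → BF.obj m}

instance : TopologicalSpace (ThomSpace f) := inferInstanceAs (TopologicalSpace (KQuot _))
instance : CGWH (ThomSpace f) := inferInstanceAs (CGWH (KQuot _))

/-- The base point. -/
def pt : ThomSpace f := KQuot.mk (.inr ())

/-- The class of a point of the pullback. -/
def mk (p : ThomPullback f) : ThomSpace f := KQuot.mk (.inl p)

theorem mk_sec (p : ThomPullback f) (h : p.1.2 = V.sec (f p.1.1)) : mk p = pt :=
  KQuot.sound ⟨p, h, rfl, rfl⟩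

theorem ind {P : ThomSpace f → Prop} (h0 : P pt) (h : ∀ p, P (mk p)) (t : ThomSpace f) : P t :=
  KQuot.ind (fun a ↦ match a with
    | .inl p => h p
    | .inr () => h0) t

theorem kcont_mk : KCont (mk : ThomPullback f → ThomSpace f) :=
  (KCont.comp KQuot.kcont_mk (kcont (Sum.inl : ThomPullback f → ThomPullback f ⊕ Unit)
    continuous_inl) :)

/-- The extension of a map to the Thom space. -/
def lift [CGWH Z] (z : Z) (u : ThomPullback f → Z) (hu : KCont u)
    (h : ∀ p, p.1.2 = V.sec (f p.1.1) → u p = z) : ThomSpace f → Z :=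
  KQuot.lift (Sum.elim u fun _ ↦ z) (KCont.sum hu (kcont _ continuous_const)) (by
    rintro _ _ ⟨p, hp, rfl, rfl⟩
    exact h p hp)

theorem kcont_prod {u : A × ThomSpace f → Z} (h0 : KCont fun a ↦ u (a, pt))
    (h : KCont fun q : A × ThomPullback f ↦ u (q.1, mk q.2)) : KCont u := by
  refine KQuot.kcont_prod_right (B := A) (A := ThomPullback f ⊕ Unit) ?_
  let e := Homeomorph.prodSumDistrib (X := A) (Y := ThomPullback f) (Z := Unit)
  have hs : KCont fun q : (A × ThomPullback f) ⊕ (A × Unit) ↦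
      u ((e.symm q).1, KQuot.mk (e.symm q).2) :=
    KCont.sum h (KCont.comp h0 (kcont (Prod.fst : A × Unit → A) continuous_fst) :)
  have := (KCont.comp hs (kcont e e.continuous) :)
  simp only [Homeomorph.symm_apply_apply] at this
  exact this

end

end ThomSpace

section
variable {X : ISpace} {l m n : ℕ}

/-- The structure maps on the pullbacks of the spaces `V(n)`. -/
def thomAct (f : X ⟶ BF) (α : Fin m ↪ Fin n) (p : CoSphere α × ThomPullback (f.app (n := m))) :
    ThomPullback (f.app (n := n)) :=
  ⟨(X.map α p.2.1.1, V.act α (p.1, p.2.1.2)), by rw [f.naturality, p.2.2, V.proj_act]⟩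

theorem kcont_thomAct (f : X ⟶ BF) (α : Fin m ↪ Fin n) : KCont (thomAct f α) := by
  refine KCont.subtypeMk (KCont.prodMk (kcont _ ?_) ?_) _
  · exact (X.continuous_map α).comp (by fun_prop)
  · exact (KCont.comp (V.kcont_act α) (kcont (fun q : CoSphere α × ThomPullback (f.app (n := m)) ↦
      (q.1, q.2.1.2)) (by fun_prop)) :)

theorem thomAct_sec (f : X ⟶ BF) (α : Fin m ↪ Fin n) (s : CoSphere α)
    (q : ThomPullback (f.app (n := m))) (h : q.1.2 = V.sec (f.app q.1.1)) :
    ThomSpace.mk (thomAct f α (s, q)) = ThomSpace.pt :=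
  ThomSpace.mk_sec _ (by
    change V.act α (s, q.1.2) = V.sec (f.app (X.map α q.1.1))
    rw [f.naturality, h, V.act_sec])

/-- The structure maps of the Thom spectrum. -/
def thomSpectrumAct (f : X ⟶ BF) (α : Fin m ↪ Fin n)
    (p : CoSphere α × ThomSpace (f.app (n := m))) : ThomSpace (f.app (n := n)) :=
  ThomSpace.lift ThomSpace.pt (fun q ↦ ThomSpace.mk (thomAct f α (p.1, q)))
    (KCont.comp ThomSpace.kcont_mk (KCont.comp (kcont_thomAct f α)
      (kcont (fun q : ThomPullback (f.app (n := m)) ↦ (p.1, q)) (by fun_prop)) :) :)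
    (thomAct_sec f α p.1) p.2

/-- The symmetric Thom spectrum of a map of `ℐ`-spaces `f : X → BF`. Its structure maps are the
maps `S^{n-α} ∧ T(f_m) → T(f_n)`, `s ∧ [x, v] ↦ [α_* x, s ∧ v]`. -/
def thomSpectrum (f : X ⟶ BF) : SymSpectrum where
  obj n := ThomSpace (f.app (n := n))
  pt := ThomSpace.pt
  act := thomSpectrumAct f
  kcont_act α := ThomSpace.kcont_prod (kcont _ continuous_const)
    (KCont.comp ThomSpace.kcont_mk (kcont_thomAct f α) :)
  act_infty α t := by
    induction t using ThomSpace.ind with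
    | h0 => rfl
    | h p =>
      refine ThomSpace.mk_sec _ ?_
      change V.act α (.infty α, p.1.2) = V.sec (f.app (X.map α p.1.1))
      rw [V.act_infty, f.naturality, p.2]
  act_pt _ _ := rfl
  act_zero t := by
    induction t using ThomSpace.ind with
    | h0 => rfl
    | h p => exact congrArg ThomSpace.mk (Subtype.ext (Prod.ext (X.map_refl _) (V.act_zero _)))
  act_comp β α s r t := by
    induction t using ThomSpace.ind with
    | h0 => rfl
    | h p =>
      exact congrArg ThomSpace.mk
        (Subtype.ext (Prod.ext (X.map_trans β α _) (V.act_comp β α s r _)))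

theorem thom_ind {f : X ⟶ BF} {P : (thomSpectrum f).obj n → Prop} (h0 : P ThomSpace.pt)
    (h : ∀ p : ThomPullback (f.app (n := n)), P (ThomSpace.mk p)) (t : (thomSpectrum f).obj n) :
    P t := ThomSpace.ind h0 h t

end

/-- The map of pullbacks induced by a map over `BF`. -/
def thomPullbackMap {f g : Over BF} (φ : f ⟶ g) {n : ℕ} (p : ThomPullback (f.hom.app (n := n))) :
    ThomPullback (g.hom.app (n := n)) :=
  ⟨(φ.left.app p.1.1, p.1.2),
    (congrArg (fun u ↦ ISpace.Hom.app u p.1.1) (Over.w φ)).trans p.2⟩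

theorem thomPullbackMap_sec {f g : Over BF} (φ : f ⟶ g) {n : ℕ}
    (p : ThomPullback (f.hom.app (n := n))) (h : p.1.2 = V.sec (f.hom.app p.1.1)) :
    ThomSpace.mk (thomPullbackMap φ p) = ThomSpace.pt :=
  ThomSpace.mk_sec _ (h.trans (congrArg (fun u ↦ V.sec (ISpace.Hom.app u p.1.1)) (Over.w φ).symm))

/-- The symmetric Thom spectrum functor, from `ℐ`-spaces over `BF` to symmetric spectra. -/
def thomFunctor : Over BF ⥤ SymSpectrum where
  obj f := thomSpectrum f.hom
  map {_ g} φ :=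
    { app := ThomSpace.lift (Z := ThomSpace g.hom.app) ThomSpace.pt
        (fun p ↦ ThomSpace.mk (thomPullbackMap φ p))
        (KCont.comp ThomSpace.kcont_mk (KCont.subtypeMk (kcont _
          ((φ.left.continuous_app.comp (continuous_fst.comp continuous_subtype_val)).prodMk
            (continuous_snd.comp continuous_subtype_val))) _) :)
        (thomPullbackMap_sec φ)
      continuous_app := KQuot.continuous_lift _ _ _
      app_pt := rfl
      app_act := fun α s t ↦ by
        induction t using thom_ind with
        | h0 => rfl
        | h p =>
          exact congrArg ThomSpace.mk
            (Subtype.ext (Prod.ext (φ.left.naturality α _) rfl)) }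
  map_id _ := SymSpectrum.hom_ext fun t ↦ by
    induction t using thom_ind with
    | h0 => rfl
    | h p => rfl
  map_comp _ _ := SymSpectrum.hom_ext fun t ↦ by
    induction t using thom_ind with
    | h0 => rfl
    | h p => rfl

end

end SymThom

/-!
# The Thom spectrum functor is strong symmetric monoidal

The map `T(f) ∧ T(g) → T(f ⊠ g)` (`smashHom`) takes `s ∧ [x, v] ∧ [y, w]` to
`[t α x y, mulV α s v w]`, where `mulV α : S^{n-α} × V(a) × V(b) → V(n)` unites the times of two
words of the bar constructions, multiplies their labels, and smashes their sphere coordinates.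
The coherence conditions are equations between such expressions, and they are checked on
representatives. The work is in the inverse of `smashHom`, and everything rests on two facts.

*Equality in the bar construction.* The points of `V(n) = B(*, F(n), Sⁿ)` represented by two words
and two points of `Sⁿ` agree if and only if the labels of the words agree at the times in `(0, 1)` and
the last coordinates agree after the labels at the time `1` have been applied to them
(`V.mk_eq_iff`). The quotient is formed in weak Hausdorff spaces, so that this needs an argument: the
relation so described is closed (`Bar.kclosed_labelSetoid`, `Bar.kclosed_smulSetoid`), and points
that become equal in a quotient `KQuot r` are related by every closed equivalence relation that
contains `r` (`KQuot.rel_of_mk_eq`).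

*Surjectivity.* A base point preserving self homotopy equivalence of `Sⁿ` is surjective
(`F.surjective_smul`), since the sphere is not contractible; this is proved by the argument of Milnor
and Rogers, which compares volumes. Hence, for a word `l` that represents a point of `BF(n)`, every
point of `V(n)` over it has the form `[l, ξ]` with `ξ ∈ Sⁿ` (`V.exists_mk`): although `V(n) → BF(n)`
is only a quasifibration, its pullbacks to words are quotients of the trivial bundle.

It follows that, for fixed `x`, `y` and `α`, each point `v` of `V(n)` over `f(x) g(y)` is
`mulV α s v₁ v₂` for points `v₁`, `v₂` over `f(x)`, `g(y)`, and that the class `s ∧ [x, v₁] ∧ [y, v₂]` is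
determined by `v`. This defines the inverse `invAux` on representatives. It is continuous because
continuity may be tested after pulling back along quotient maps (`KQuot.kcont_of_kcont_pullback`) and
after adding a compact space of solutions `(s, ξ, η)` (`kcont_of_compact_lift`). It descends to the
box product because having the same values of the inverse is a closed equivalence relation on the
representatives of points of `X ⊠ Y` (`kclosed_invSetoid`), and the result is continuous because
quotient maps are stable under pullback (`KQuot.kcont_of_pullback`).
-/

namespace SymThom

noncomputable section

set_option linter.unusedSectionVars false

/-! ### Closed subsets and quotient maps in compactly generated spaces -/

section KClosed

variable {A B Z : Type} [TopologicalSpace A] [TopologicalSpace B] [TopologicalSpace Z]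

/-- The set `s` is closed in the compactly generated topology of `A`: its preimage under every
map from a compact Hausdorff space is closed. -/
def KClosed (s : Set A) : Prop :=
  ∀ (K : CompHaus.{0}) (k : C(CH K, A)), IsClosed (k ⁻¹' s)

/-- Closed sets are classified by maps to the Sierpiński space `Prop`. -/
theorem kclosed_iff_kcont {s : Set A} : KClosed s ↔ KCont (fun a ↦ a ∉ s) := by
  refine forall_congr' fun K ↦ forall_congr' fun k ↦ ?_
  rw [← isOpen_compl_iff]
  exact continuous_Prop.symm

theorem KClosed.preimage {s : Set B} (hs : KClosed s) {f : A → B} (hf : KCont f) :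
    KClosed (f ⁻¹' s) :=
  kclosed_iff_kcont.2 (KCont.comp (kclosed_iff_kcont.1 hs) hf :)

theorem kcont_of_kclosed {u : A → Z} (h : ∀ C, IsClosed C → KClosed (u ⁻¹' C)) : KCont u :=
  fun K k ↦ continuous_iff_isClosed.2 fun C hC ↦ h C hC K k

theorem kclosed_eq [CGWH Z] {p q : A → Z} (hp : KCont p) (hq : KCont q) :
    KClosed {a | p a = q a} := fun K k ↦
  (CGWH.isClosed_eq K K ⟨_, hp k⟩ ⟨_, hq k⟩).preimage
    (by fun_prop : Continuous fun x : CH K ↦ ((x, x) : CH K × CH K))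

theorem KClosed.iInter {ι : Sort*} {s : ι → Set A}
    (h : ∀ i, KClosed (s i)) : KClosed (⋂ i, s i) := fun K k ↦ by
  rw [Set.preimage_iInter]
  exact isClosed_iInter fun i ↦ h i K k

/-- A closed condition on the points of a closed subset defines a closed subset of the whole
space. -/
theorem KClosed.sep {E : Set A} (hE : KClosed E) {u : E → Z} (hu : KCont u) {C : Set Z}
    (hC : IsClosed C) : KClosed {a | ∃ h : a ∈ E, u ⟨a, h⟩ ∈ C} := by
  intro K k
  have hK := hE K k
  have hc : CompactSpace (k ⁻¹' E) := isCompact_iff_compactSpace.1 hK.isCompact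
  have h1 : Continuous (fun x : k ⁻¹' E ↦ u ⟨k x.1, x.2⟩) :=
    @hu (CompHaus.of (k ⁻¹' E)) ⟨fun x ↦ ⟨k x.1, x.2⟩, by fun_prop⟩
  convert hK.isClosedEmbedding_subtypeVal.isClosedMap _ (hC.preimage h1) using 1
  ext x
  simp

theorem kclosed_sigma_prod {ι : Type} {A : ι → Type} [∀ i, TopologicalSpace (A i)]
    {s : Set ((Σ i, A i) × B)} (h : ∀ i, KClosed {p : A i × B | (⟨i, p.1⟩, p.2) ∈ s}) :
    KClosed s :=
  kclosed_iff_kcont.2 (ISpace.kcont_sigma_prod fun i ↦ kclosed_iff_kcont.1 (h i))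

/-- If `u` is determined, on each point `p`, by a solution `ξ` in a compact space `S` of the
equation `ψ (p, ξ) = v p`, then it is continuous as soon as it is so as a function of `p`
and `ξ`. -/
theorem kcont_of_compact_lift {S W : Type} [TopologicalSpace S] [CompactSpace S] [T2Space S]
    [TopologicalSpace W] [CGWH W] {ψ : A × S → W} (hψ : KCont ψ) {v : A → W} (hv : KCont v)
    (hex : ∀ a, ∃ ξ, ψ (a, ξ) = v a) {u : A → Z}
    (hu : KCont fun q : {q : A × S // ψ q = v q.1} ↦ u q.1.1) : KCont u := by
  refine kcont_of_kclosed fun C hC K k ↦ ?_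
  have hE : KClosed {q : A × S | ψ q = v q.1} :=
    kclosed_eq hψ (KCont.comp hv (kcont _ continuous_fst))
  have h := hE.sep hu hC (CompHaus.of (K × S)) ⟨fun q ↦ (k q.1, q.2), by fun_prop⟩
  convert isClosedMap_fst_of_compactSpace _ h using 1
  ext x
  constructor
  · intro hx
    obtain ⟨ξ, hξ⟩ := hex (k x)
    exact ⟨(x, ξ), ⟨hξ, hx⟩, rfl⟩
  · rintro ⟨⟨y, ξ⟩, ⟨hξ, hy⟩, rfl⟩
    exact hy

namespace KQuot

variable {r : A → A → Prop}

/-- Quotient maps are stable under pullback: continuity of a map out of `B` may be tested on the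
pullback of `A` to `B`. -/
theorem kcont_of_pullback {h : B → KQuot r} (hh : KCont h) {u : B → Z}
    (hu : ∀ C, IsClosed C → KClosed {p : A × B | mk p.1 = h p.2 ∧ u p.2 ∈ C}) : KCont u := by
  refine kcont_of_kclosed fun C hC ↦ ?_
  -- The quotient map times `B` is a quotient map, and the graph of `h` is closed.
  have h1 : KClosed {q : KQuot r × B | q.1 = h q.2 ∧ u q.2 ∈ C} :=
    kclosed_iff_kcont.2 (kcont_prod (kclosed_iff_kcont.1 (hu C hC)))
  have h2 := h1.preimage (hh.prodMk (kcont (fun b ↦ b) continuous_id))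
  convert h2 using 1
  ext b
  simp

theorem kclosed_pullback {h : B → KQuot r} (hh : KCont h) :
    KClosed {p : A × B | mk p.1 = h p.2} :=
  kclosed_eq (KCont.comp kcont_mk (kcont (Prod.fst : A × B → A) continuous_fst) :)
    (KCont.comp hh (kcont (Prod.snd : A × B → B) continuous_snd) :)

theorem kcont_of_kcont_pullback {h : B → KQuot r} (hh : KCont h) {u : B → Z}
    (hu : KCont fun p : {p : A × B // mk p.1 = h p.2} ↦ u p.1.2) : KCont u :=
  kcont_of_pullback hh fun C hC ↦ by
    convert (kclosed_pullback hh).sep (A := A × B) hu hC using 1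
    ext p
    simp

end KQuot

section Exact

variable (R : Setoid A)

/-- The quotient by an equivalence relation, with the compactly generated quotient topology. -/
def ClosedQuot : Type := Quotient R

namespace ClosedQuot

variable {R} in
/-- The class of a point. -/
def mk (a : A) : ClosedQuot R := Quotient.mk R a

instance : TopologicalSpace (ClosedQuot R) :=
  TopologicalSpace.coinduced
    (fun a : WithGeneratedByTopology CH A ↦
      (mk (WithGeneratedByTopology.equiv a) : ClosedQuot R)) inferInstance

variable {R}

theorem mk_eq {a b : A} : (mk a : ClosedQuot R) = mk b ↔ R a b := Quotient.eq

theorem mk_surjective : Function.Surjective (mk : A → ClosedQuot R) := Quotient.mk_surjective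

theorem kcont_mk : KCont (mk : A → ClosedQuot R) := by
  have h : Continuous (fun a : WithGeneratedByTopology CH A ↦
      (mk (WithGeneratedByTopology.equiv a) : ClosedQuot R)) := continuous_coinduced_rng
  exact (WithGeneratedByTopology.continuous_from_iff _).1 h

theorem continuous_dom {f : ClosedQuot R → Z} (h : KCont (fun a ↦ f (mk a))) :
    Continuous f := by
  rw [continuous_coinduced_dom]
  exact (WithGeneratedByTopology.continuous_from_iff _).2 h

instance : IsGeneratedBy CH (ClosedQuot R) := IsGeneratedBy.coinduced _

/-- A compactly generated quotient by a closed equivalence relation is weak Hausdorff: the image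
of a compact Hausdorff space `K` pulls back, along `L → A`, to the projection of a closed subset
of `K × L`. -/
theorem cgwh (hR : KClosed {p : A × A | R p.1 p.2}) : CGWH (ClosedQuot R) where
  compactlyGenerated := uCompactlyGeneratedSpace_of_isOpen fun s hs ↦
    (IsGeneratedBy.isOpen_iff CH).2 fun K f ↦ hs K f
  isClosed_range K g := by
    have h1 : ∀ (L : CompHaus.{0}) (l : C(CH L, A)),
        IsClosed {p : CH K × CH L | g p.1 = mk (l p.2)} := by
      intro L l
      -- The points `x` with `q ≠ [l x]` form an open set that depends continuously on `q`.
      let G : ClosedQuot R → C(CH L, Prop) := fun q ↦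
        ⟨fun x ↦ q ≠ mk (l x), by
          obtain ⟨a, rfl⟩ := mk_surjective q
          have := hR L ⟨fun x ↦ (a, l x), by fun_prop⟩
          rw [continuous_Prop, ← isClosed_compl_iff]
          convert this using 1
          ext x
          simp [mk_eq]⟩
      have hG : Continuous G := by
        refine continuous_dom fun M m ↦ ?_
        refine ContinuousMap.continuous_of_continuous_uncurry _ ?_
        have := hR (CompHaus.of (M × L)) ⟨fun x ↦ (m x.1, l x.2), by fun_prop⟩
        rw [continuous_Prop, ← isClosed_compl_iff]
        convert this using 1
        ext x
        simp [mk_eq, G, Function.uncurry]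
      have h2 : Continuous fun p : CH K × CH L ↦ G (g p.1) p.2 := by
        have := hG.comp g.continuous
        fun_prop
      rw [← isOpen_compl_iff]
      exact continuous_Prop.1 h2
    have h2 : KClosed {a : A | (mk a : ClosedQuot R) ∈ Set.range g} := by
      intro L l
      convert isClosedMap_snd_of_compactSpace _ (h1 L l) using 1
      ext x
      simp only [Set.mem_preimage, Set.mem_ofPred_eq, Set.mem_range, Set.mem_image, Prod.exists,
        exists_eq_right]
    have h3 : Continuous fun q : ClosedQuot R ↦ q ∉ Set.range g :=
      continuous_dom (kclosed_iff_kcont.1 h2)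
    rw [← isOpen_compl_iff]
    exact continuous_Prop.1 h3

end ClosedQuot

/-- Points that become equal in the quotient by `r` are related by every closed equivalence
relation that contains `r`. -/
theorem KQuot.rel_of_mk_eq {r : A → A → Prop} (hR : KClosed {p : A × A | R p.1 p.2})
    (hr : ∀ a b, r a b → R a b) {a b : A} (h : (mk a : KQuot r) = mk b) : R a b := by
  have := ClosedQuot.cgwh hR
  exact ClosedQuot.mk_eq.1 (Quotient.exact h (ClosedQuot R) ClosedQuot.mk ClosedQuot.kcont_mk
    fun a b hab ↦ ClosedQuot.mk_eq.2 (hr a b hab))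

end Exact

end KClosed

/-! ### Spheres are not contractible -/

section NoRetraction

open MeasureTheory Metric

variable {E : Type*} [NormedAddCommGroup E] [InnerProductSpace ℝ E] [FiniteDimensional ℝ E]

/-- `det (1 + t D)` is a polynomial in `t` of degree at most `dim E`. -/
theorem exists_polynomial_det (D : E →L[ℝ] E) : ∃ P : Polynomial ℝ,
    P.natDegree ≤ Module.finrank ℝ E ∧ ∀ t, P.eval t = (1 + t • D).det := by
  let b := Module.finBasis ℝ E
  let M := LinearMap.toMatrix b b (D : E →ₗ[ℝ] E)
  refine ⟨((Polynomial.X : Polynomial ℝ) • M.map Polynomial.C +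
    (1 : Matrix _ _ ℝ).map Polynomial.C).det, ?_, fun t ↦ ?_⟩
  · simpa using Polynomial.natDegree_det_X_add_C_le M 1
  · rw [ContinuousLinearMap.det, ← LinearMap.det_toMatrix b, ← Polynomial.coe_evalRingHom,
      RingHom.map_det]
    congr 1
    ext i j
    have : LinearMap.toMatrix b b ((1 + t • D : E →L[ℝ] E) : E →ₗ[ℝ] E) = 1 + t • M := by
      have h : ((1 + t • D : E →L[ℝ] E) : E →ₗ[ℝ] E) = LinearMap.id + t • (D : E →ₗ[ℝ] E) := by
        ext x; simp
      rw [h, map_add, map_smul, LinearMap.toMatrix_id]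
    rw [this]
    simp only [RingHom.mapMatrix_apply, Matrix.map_apply, Matrix.add_apply, Matrix.smul_apply,
      smul_eq_mul, Polynomial.coe_evalRingHom, Polynomial.eval_add, Polynomial.eval_mul,
      Polynomial.eval_X, Polynomial.eval_C]
    ring

/-- Interpolation: the values at `1` of polynomials of degree at most `N` are given by fixed
affine combinations of their values at points of `(0, δ)`. -/
theorem exists_interpolation (N : ℕ) {δ : ℝ} (hδ : 0 < δ) : ∃ w τ : Fin (N + 1) → ℝ,
    (∀ i, 0 < τ i ∧ τ i < δ) ∧ ∑ i, w i = 1 ∧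
      ∀ P : Polynomial ℝ, P.natDegree ≤ N → P.eval 1 = ∑ i, w i * P.eval (τ i) := by
  let τ : Fin (N + 1) → ℝ := fun i ↦ δ / (i + 2)
  have hτ : Function.Injective τ := by
    intro i j hij
    have h1 : (i : ℝ) + 2 ≠ 0 := by positivity
    have h2 : (j : ℝ) + 2 ≠ 0 := by positivity
    have h3 : (i : ℝ) = j := by
      simp only [τ] at hij
      field_simp at hij
      linarith
    exact Fin.ext (by exact_mod_cast h3)
  have hs : Set.InjOn τ (Finset.univ : Finset (Fin (N + 1))) := hτ.injOn
  refine ⟨fun i ↦ (Lagrange.basis Finset.univ τ i).eval 1, τ, fun i ↦ ⟨by positivity, ?_⟩, ?_, ?_⟩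
  · exact div_lt_self hδ (by have : (0 : ℝ) ≤ i := by positivity
                             linarith)
  · rw [← Polynomial.eval_finsetSum, Lagrange.sum_basis hs Finset.univ_nonempty,
      Polynomial.eval_one]
  · intro P hP
    have hd : P.degree < (Finset.univ : Finset (Fin (N + 1))).card := by
      rw [Finset.card_univ, Fintype.card_fin]
      exact lt_of_le_of_lt Polynomial.degree_le_natDegree (by exact_mod_cast Nat.lt_succ_of_le hP)
    conv_lhs => rw [Lagrange.eq_interpolate hs hd, Lagrange.interpolate_apply,
      Polynomial.eval_finsetSum]
    exact Finset.sum_congr rfl fun i _ ↦ by rw [Polynomial.eval_mul, Polynomial.eval_C, mul_comm]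

theorem isUnit_one_add_smul {D : E →L[ℝ] E} {C t : ℝ} (hD : ‖D‖ ≤ C) (ht : 0 ≤ t)
    (htC : t * C < 1) : IsUnit (1 + t • D) := by
  have h : ‖-(t • D)‖ < 1 := by
    rw [norm_neg, norm_smul, Real.norm_of_nonneg ht]
    exact lt_of_le_of_lt (mul_le_mul_of_nonneg_left hD ht) htC
  simpa using isUnit_one_sub_of_norm_lt_one h

theorem det_one_add_smul_pos {D : E →L[ℝ] E} {C t : ℝ} (hD : ‖D‖ ≤ C) (ht : 0 ≤ t)
    (htC : t * C < 1) : 0 < (1 + t • D).det := by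
  obtain ⟨P, -, hP⟩ := exists_polynomial_det D
  have hC : 0 ≤ C := (norm_nonneg _).trans hD
  by_contra hneg
  have hneg' : P.eval t ≤ 0 := by rw [hP]; exact not_lt.1 hneg
  have h0 : P.eval 0 = 1 := by
    rw [hP, zero_smul, add_zero]
    exact LinearMap.det_id
  obtain ⟨s, ⟨hs0, hst⟩, hs⟩ := intermediate_value_Icc' ht P.continuous.continuousOn
    (⟨hneg', by rw [h0]; exact zero_le_one⟩ : (0 : ℝ) ∈ Set.Icc (P.eval t) (P.eval 0))
  have hu := isUnit_one_add_smul hD hs0 (lt_of_le_of_lt (mul_le_mul_of_nonneg_right hst hC) htC)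
  have hu' : IsUnit (1 + s • D : E →L[ℝ] E).det := by
    refine LinearMap.isUnit_det _ ?_
    exact hu.map (ContinuousLinearMap.toLinearMapRingHom : (E →L[ℝ] E) →+* E →ₗ[ℝ] E)
  rw [← hP, show P.eval s = 0 from hs] at hu'
  exact not_isUnit_zero hu'

variable [MeasurableSpace E] [BorelSpace E]

/-- There is no `C¹` map of a closed ball to its boundary that is the identity on the boundary. For
small `t`, the maps `x ↦ x + t (f x - x)` are diffeomorphisms of the ball, so that the integral of
their Jacobian determinants is the volume of the ball. This integral is a polynomial in `t`, and
hence it is the volume of the ball for `t = 1` as well. But the Jacobian determinant of `f`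
vanishes. -/
theorem no_smooth_retraction {f : E → E} (hf : ContDiff ℝ 1 f) {R : ℝ} (hR : 0 < R)
    (h1 : ∀ x, ‖x‖ ≤ R → ‖f x‖ = R) (h2 : ∀ x, ‖x‖ = R → f x = x) : False := by
  let g : E → E := fun x ↦ f x - x
  have hg : ContDiff ℝ 1 g := hf.sub contDiff_id
  have hgd : ∀ x, DifferentiableAt ℝ g x := fun x ↦ hg.differentiable one_ne_zero x
  let D : E → E →L[ℝ] E := fderiv ℝ g
  have hDc : Continuous D := hg.continuous_fderiv one_ne_zero
  obtain ⟨C, hC⟩ := (isCompact_closedBall (0 : E) R).exists_bound_of_continuousOn hDc.continuousOn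
  have hC0 : 0 ≤ C := (norm_nonneg _).trans (hC 0 (by simpa using hR.le))
  have hlip : LipschitzOnWith C.toNNReal g (closedBall 0 R) :=
    Convex.lipschitzOnWith_of_nnnorm_fderiv_le (𝕜 := ℝ) (fun x _ ↦ hgd x) (fun x hx ↦ by
      rw [← NNReal.coe_le_coe, coe_nnnorm, Real.coe_toNNReal _ hC0]
      exact hC x hx) (convex_closedBall 0 R)
  let F : ℝ → E → E := fun t x ↦ x + t • g x
  have hF : ∀ t x, HasStrictFDerivAt (F t) (1 + t • D x) x := fun t x ↦
    (hasStrictFDerivAt_id x).add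
      ((hg.contDiffAt.hasStrictFDerivAt one_ne_zero).const_smul t)
  have hFc : ∀ t, Continuous (F t) := fun t ↦
    continuous_id.add (hg.continuous.const_smul t)
  set δ : ℝ := 1 / (C + 1) with hδ
  have hδ0 : 0 < δ := by positivity
  have hδC : ∀ t, 0 < t → t < δ → t * C < 1 := fun t _ h ↦ by
    have h3 : δ * (C + 1) = 1 := by rw [hδ]; field_simp
    nlinarith
  have hδ1 : δ ≤ 1 := by
    rw [hδ, div_le_one (by positivity)]
    linarith
  have hinj : ∀ t, 0 < t → t < δ → Set.InjOn (F t) (closedBall 0 R) := by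
    intro t ht0 ht x hx y hy hxy
    have h3 : x - y = t • (g y - g x) := by
      have : x + t • g x = y + t • g y := hxy
      rw [smul_sub, sub_eq_sub_iff_add_eq_add, this, add_comm]
    have h4 : ‖g y - g x‖ ≤ C * ‖y - x‖ := by
      have := hlip.dist_le_mul y hy x hx
      rwa [dist_eq_norm, dist_eq_norm, Real.coe_toNNReal _ hC0] at this
    have h5 : ‖x - y‖ ≤ t * C * ‖x - y‖ := by
      calc ‖x - y‖ = t * ‖g y - g x‖ := by rw [h3, norm_smul, Real.norm_of_nonneg ht0.le]
        _ ≤ t * (C * ‖y - x‖) := mul_le_mul_of_nonneg_left h4 ht0.le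
        _ = t * C * ‖x - y‖ := by rw [norm_sub_rev y x, mul_assoc]
    have h6 := hδC t ht0 ht
    have h7 : ‖x - y‖ = 0 := by nlinarith [norm_nonneg (x - y)]
    exact sub_eq_zero.1 (norm_eq_zero.1 h7)
  have hbdry : ∀ t x, ‖x‖ = R → F t x = x := fun t x hx ↦ by simp [F, g, h2 x hx]
  -- The image of the open ball is open by the inverse function theorem, and it is closed in the
  -- ball since the sphere is fixed; the ball is connected.
  have himage : ∀ t, 0 < t → t < δ → F t '' ball 0 R = ball 0 R := by
    intro t ht0 ht
    have hmaps : ∀ x ∈ ball (0 : E) R, F t x ∈ ball (0 : E) R := by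
      intro x hx
      rw [mem_ball_zero_iff] at hx ⊢
      have h3 : F t x = (1 - t) • x + t • f x := by
        simp only [F, g, smul_sub, sub_smul, one_smul]
        abel
      have ht1 : t < 1 := ht.trans_le hδ1
      calc ‖F t x‖ ≤ ‖(1 - t) • x‖ + ‖t • f x‖ := h3 ▸ norm_add_le _ _
        _ = (1 - t) * ‖x‖ + t * R := by
          rw [norm_smul, norm_smul, Real.norm_of_nonneg (by linarith), Real.norm_of_nonneg ht0.le,
            h1 x hx.le]
        _ < R := by nlinarith
    refine Set.Subset.antisymm (Set.image_subset_iff.2 hmaps) ?_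
    refine (convex_ball (0 : E) R).isPreconnected.subset_of_closure_inter_subset ?_ ?_ ?_
    · rw [isOpen_iff_mem_nhds]
      rintro _ ⟨x, hx, rfl⟩
      have hu := isUnit_one_add_smul (hC x (ball_subset_closedBall hx)) ht0.le (hδC t ht0 ht)
      have hs := (ContinuousLinearMap.isUnit_iff_bijective.1 hu).2
      have hm := (hF t x).map_nhds_eq_of_surj (LinearMap.range_eq_top.2 hs)
      rw [← hm]
      exact Filter.image_mem_map (isOpen_ball.mem_nhds hx)
    · have h0 : (0 : E) ∈ ball (0 : E) R := mem_ball_self hR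
      exact ⟨F t 0, hmaps 0 h0, 0, h0, rfl⟩
    · rintro y ⟨hy, hyR⟩
      have hcl : closure (F t '' ball 0 R) ⊆ F t '' closedBall 0 R :=
        closure_minimal (Set.image_mono ball_subset_closedBall)
          ((isCompact_closedBall 0 R).image (hFc t)).isClosed
      obtain ⟨x, hx, rfl⟩ := hcl hy
      refine ⟨x, ?_, rfl⟩
      rw [mem_closedBall_zero_iff] at hx
      rw [mem_ball_zero_iff] at hyR ⊢
      refine lt_of_le_of_ne hx fun hxR ↦ ?_
      rw [hbdry t x hxR] at hyR
      exact hyR.ne hxR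
  have hdetc : ∀ t : ℝ, Continuous fun x ↦ (1 + t • D x : E →L[ℝ] E).det := fun t ↦
    ContinuousLinearMap.continuous_det.comp (continuous_const.add (hDc.const_smul t))
  have hint : ∀ t : ℝ, IntegrableOn (fun x ↦ (1 + t • D x : E →L[ℝ] E).det) (ball 0 R) := fun t ↦
    ((hdetc t).continuousOn.integrableOn_compact (isCompact_closedBall 0 R)).mono_set
      ball_subset_closedBall
  have hvol : ∀ t, 0 < t → t < δ → ∫ x in ball (0 : E) R, (1 + t • D x : E →L[ℝ] E).det =
      volume.real (ball (0 : E) R) := by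
    intro t ht0 ht
    have h3 := integral_image_eq_integral_abs_det_fderiv_smul (volume : Measure E)
      (measurableSet_ball (x := (0 : E)) (ε := R))
      (fun x _ ↦ (hF t x).hasFDerivAt.hasFDerivWithinAt)
      ((hinj t ht0 ht).mono ball_subset_closedBall) (fun _ ↦ (1 : ℝ))
    rw [himage t ht0 ht] at h3
    simp only [smul_eq_mul, mul_one, integral_const, Measure.real, Measure.restrict_apply_univ]
      at h3
    rw [Measure.real, h3]
    refine setIntegral_congr_fun measurableSet_ball fun x hx ↦ (abs_of_pos ?_).symm
    exact det_one_add_smul_pos (hC x (ball_subset_closedBall hx)) ht0.le (hδC t ht0 ht)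
  obtain ⟨w, τ, hτ, hw, hP⟩ := exists_interpolation (Module.finrank ℝ E) hδ0
  have hone : ∫ x in ball (0 : E) R, (1 + (1 : ℝ) • D x : E →L[ℝ] E).det =
      volume.real (ball (0 : E) R) := by
    have h3 : ∀ x, (1 + (1 : ℝ) • D x : E →L[ℝ] E).det =
        ∑ i, w i * (1 + τ i • D x : E →L[ℝ] E).det := fun x ↦ by
      obtain ⟨P, hPd, hPe⟩ := exists_polynomial_det (D x)
      simp only [← hPe]
      exact hP P hPd
    simp only [h3]
    rw [integral_finsetSum _ fun i _ ↦ (hint (τ i)).const_mul (w i)]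
    simp only [integral_const_mul]
    rw [Finset.sum_congr rfl fun i _ ↦ by rw [hvol (τ i) (hτ i).1 (hτ i).2], ← Finset.sum_mul, hw,
      one_mul]
  -- As `‖f x‖` is constant, the image of the derivative of `f` at `x` is orthogonal to `f x`.
  have hzero : ∀ x ∈ ball (0 : E) R, (1 + (1 : ℝ) • D x : E →L[ℝ] E).det = 0 := by
    intro x hx
    have hd : HasFDerivAt f (1 + (1 : ℝ) • D x) x := by
      have := (hF 1 x).hasFDerivAt
      have e : F 1 = f := by
        funext y
        simp [F, g]
      rwa [e] at this
    have hconst : (fun y ↦ inner ℝ (f y) (f y)) =ᶠ[𝓝 x] fun _ ↦ R ^ 2 := by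
      filter_upwards [isOpen_ball.mem_nhds hx] with y hy
      rw [real_inner_self_eq_norm_sq, h1 y (mem_ball_zero_iff.1 hy).le]
    have hd0 := (hd.inner ℝ hd).congr_of_eventuallyEq hconst.symm
    have hz := hd0.unique (hasFDerivAt_const (R ^ 2) x)
    by_contra hne
    let e := LinearMap.equivOfDetNeZero _ hne
    obtain ⟨v, hv⟩ := e.surjective (f x)
    have hv' : (1 + (1 : ℝ) • D x : E →L[ℝ] E) v = f x := hv
    have h5 := congrArg (fun L : E →L[ℝ] ℝ ↦ L v) hz
    simp only [ContinuousLinearMap.comp_apply, fderivInnerCLM_apply,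
      ContinuousLinearMap.prod_apply, hv', zero_apply,
      real_inner_self_eq_norm_sq, h1 x (mem_ball_zero_iff.1 hx).le] at h5
    nlinarith
  rw [setIntegral_congr_fun measurableSet_ball hzero] at hone
  simp only [integral_zero] at hone
  have : 0 < volume.real (ball (0 : E) R) :=
    ENNReal.toReal_pos (measure_ball_pos volume _ hR).ne' measure_ball_lt_top.ne
  linarith

end NoRetraction

/-! ### Self homotopy equivalences of spheres are surjective -/

section Surjective

open MeasureTheory Metric

variable {E : Type*} [NormedAddCommGroup E] [InnerProductSpace ℝ E] [FiniteDimensional ℝ E]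
  [MeasurableSpace E] [BorelSpace E]

/-- Smoothing of a map that is the identity outside the unit ball. -/
theorem exists_smooth_approx {Φ : E → E} (hΦ : Continuous Φ) (h1 : ∀ x, 1 ≤ ‖x‖ → Φ x = x)
    {ε : ℝ} (hε : 0 < ε) : ∃ h : E → E, ContDiff ℝ 1 h ∧ (∀ x, dist (h x) (Φ x) ≤ ε) ∧
      ∀ x, ‖x‖ = 2 → h x = x := by
  let u : E → E := fun x ↦ Φ x - x
  have hu : Continuous u := hΦ.sub continuous_id
  have hu0 : ∀ x, 1 ≤ ‖x‖ → u x = 0 := fun x hx ↦ by simp [u, h1 x hx]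
  have hus : HasCompactSupport u :=
    HasCompactSupport.intro (isCompact_closedBall (0 : E) 1) fun x hx ↦ hu0 x (by
      rw [mem_closedBall_zero_iff, not_le] at hx
      exact hx.le)
  obtain ⟨r, hr, hrε⟩ := Metric.uniformContinuous_iff.1
    (hus.uniformContinuous_of_continuous hu) ε hε
  let φ : ContDiffBump (0 : E) :=
    ⟨min r 1 / 2, min r 1, by positivity, half_lt_self (by positivity)⟩
  let U : E → E := convolution (φ.normed volume) u (ContinuousLinearMap.lsmul ℝ ℝ) volume
  have hU : ∀ x, dist (U x) (u x) ≤ ε := fun x ↦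
    φ.dist_normed_convolution_le hu.aestronglyMeasurable fun y hy ↦
      (hrε (lt_of_lt_of_le hy (min_le_left _ _))).le
  have hU0 : ∀ x, ‖x‖ = 2 → U x = 0 := fun x hx ↦ by
    have h3 : ∀ y ∈ ball x φ.rOut, u y = 0 := fun y hy ↦ hu0 y (by
      have h4 : dist y x < 1 := lt_of_lt_of_le hy (min_le_right _ _)
      rw [dist_eq_norm] at h4
      have := norm_sub_norm_le x y
      rw [norm_sub_rev] at h4
      linarith)
    rw [show U x = u x from φ.normed_convolution_eq_right fun y hy ↦ by
      rw [h3 y hy, hu0 x (by rw [hx]; norm_num)], hu0 x (by rw [hx]; norm_num)]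
  have hUd : ContDiff ℝ 1 U := by
    have := HasCompactSupport.contDiff_convolution_left (𝕜 := ℝ) (n := 1) (μ := volume)
      (ContinuousLinearMap.lsmul ℝ ℝ : ℝ →L[ℝ] E →L[ℝ] E)
      (φ.hasCompactSupport_normed (μ := volume)) φ.contDiff_normed hu.locallyIntegrable
    exact_mod_cast this
  refine ⟨fun x ↦ U x + x, hUd.add contDiff_id, fun x ↦ ?_, fun x hx ↦ by simp [hU0 x hx]⟩
  have := hU x
  rw [dist_eq_norm] at this ⊢
  convert this using 2
  simp only [u]
  abel

/-- A continuous map that is the identity outside the unit ball has a zero. -/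
theorem exists_zero {Φ : E → E} (hΦ : Continuous Φ) (h1 : ∀ x, 1 ≤ ‖x‖ → Φ x = x) :
    ∃ x, Φ x = 0 := by
  by_contra! h0
  obtain ⟨c, hc, hcΦ⟩ : ∃ c > 0, ∀ x, c ≤ ‖Φ x‖ := by
    obtain ⟨x₀, -, hx₀⟩ := (isCompact_closedBall (0 : E) 1).exists_isMinOn
      ⟨0, by simp⟩ hΦ.norm.continuousOn
    refine ⟨min ‖Φ x₀‖ 1, lt_min (norm_pos_iff.2 (h0 x₀)) one_pos, fun x ↦ ?_⟩
    by_cases hx : ‖x‖ ≤ 1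
    · exact (min_le_left _ _).trans (hx₀ (mem_closedBall_zero_iff.2 hx))
    · rw [h1 x (not_le.1 hx).le]
      exact (min_le_right _ _).trans (not_le.1 hx).le
  obtain ⟨h, hh, happ, hid⟩ := exists_smooth_approx hΦ h1 (half_pos hc)
  have hne : ∀ x, h x ≠ 0 := fun x hx ↦ by
    have := happ x
    rw [hx, dist_zero_left] at this
    linarith [hcΦ x]
  -- The radial projection of `h` to the sphere of radius `2` fixes this sphere, as `h` does.
  refine no_smooth_retraction (f := fun x ↦ (2 * ‖h x‖⁻¹) • h x) ?_ two_pos (fun x _ ↦ ?_)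
    fun x hx ↦ ?_
  · exact (contDiff_const.mul ((hh.norm ℝ hne).inv fun x ↦ norm_ne_zero_iff.2 (hne x))).smul hh
  · rw [norm_smul, norm_mul, norm_inv, norm_norm, mul_assoc,
      inv_mul_cancel₀ (norm_ne_zero_iff.2 (hne x))]
    norm_num
  · simp [hid x hx, hx]

/-- A self map of the unit sphere that is homotopic to the identity is surjective. Otherwise, the
homotopy and the straight lines from the map to the antipode of a point that it misses define an
extension of the identity of the sphere to a map from the ball to `E \ {0}`. -/
theorem surjective_of_homotopy {k : ℝ → sphere (0 : E) 1 → sphere (0 : E) 1}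
    (hk : Continuous fun p : ℝ × sphere (0 : E) 1 ↦ k p.1 p.2) (h1 : ∀ x, k 1 x = x) :
    Function.Surjective (k 0) := by
  classical
  intro p
  by_contra! hp
  let ν : {x : E // x ≠ 0} → sphere (0 : E) 1 := fun x ↦ ⟨‖x.1‖⁻¹ • x.1, by
    rw [mem_sphere_zero_iff_norm, norm_smul, norm_inv, norm_norm,
      inv_mul_cancel₀ (norm_ne_zero_iff.2 x.2)]⟩
  have hν : Continuous ν := by
    refine Continuous.subtype_mk (Continuous.smul (Continuous.inv₀ (by fun_prop) fun x ↦ ?_)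
      continuous_subtype_val) _
    exact norm_ne_zero_iff.2 x.2
  -- `Ψ` is the cone of `k 0` on the ball of radius `1 / 2`, runs through the homotopy on the shell
  -- `1 / 2 ≤ ‖x‖ ≤ 1`, and is the identity outside the unit ball.
  let m : ℝ → ℝ := fun r ↦ max (min 1 (2 * r)) r
  let Ψ : E → E := fun x ↦
    if h : x = 0 then 0 else m ‖x‖ • (k (max 0 (min 1 (2 * ‖x‖ - 1))) (ν ⟨x, h⟩)).1
  have hΨ : Continuous Ψ := by
    rw [continuous_iff_continuousAt]
    intro x
    by_cases hx : x = 0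
    · subst hx
      have hb : ∀ y, ‖Ψ y‖ ≤ 2 * ‖y‖ := fun y ↦ by
        by_cases hy : y = 0
        · simp [Ψ, hy]
        · have hm : 0 ≤ m ‖y‖ := (norm_nonneg y).trans (le_max_right _ _)
          have hm' : m ‖y‖ ≤ 2 * ‖y‖ :=
            max_le (min_le_right _ _) (by linarith [norm_nonneg y])
          simpa [Ψ, hy, norm_smul, abs_of_nonneg hm] using hm'
      rw [ContinuousAt, show Ψ 0 = 0 from dif_pos rfl]
      refine squeeze_zero_norm hb ?_
      have : Continuous fun y : E ↦ 2 * ‖y‖ := by fun_prop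
      simpa using this.tendsto 0
    · have hon : ContinuousOn Ψ {x | x ≠ 0} := by
        rw [continuousOn_iff_continuous_domRestrict]
        have e : ({x : E | x ≠ 0}.domRestrict Ψ) = fun x : {x : E // x ≠ 0} ↦
            m ‖x.1‖ • (k (max 0 (min 1 (2 * ‖x.1‖ - 1))) (ν x)).1 := by
          funext x
          exact dif_neg x.2
        rw [e]
        have hm : Continuous fun x : {x : E // x ≠ 0} ↦ m ‖x.1‖ := by fun_prop
        have hk' := hk.comp ((by fun_prop : Continuous fun x : {x : E // x ≠ 0} ↦
          max 0 (min 1 (2 * ‖x.1‖ - 1))).prodMk hν)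
        exact hm.smul (continuous_subtype_val.comp hk')
      exact hon.continuousAt (isOpen_ne.mem_nhds hx)
  -- On the ball of radius `1 / 2`, this is the segment from `k 0` to `-p`, which misses the origin
  -- as `k 0` misses `p`.
  have hΦ : Continuous fun x ↦ Ψ x - max 0 (1 - 2 * ‖x‖) • p.1 := by fun_prop
  obtain ⟨x, hx⟩ := exists_zero hΦ fun x hx ↦ by
    have hx0 : x ≠ 0 := by
      rintro rfl
      norm_num at hx
    have e1 : max 0 (min 1 (2 * ‖x‖ - 1)) = 1 := by
      rw [min_eq_left (by linarith)]
      norm_num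
    have e2 : m ‖x‖ = ‖x‖ := max_eq_right ((min_le_left _ _).trans hx)
    have e3 : max 0 (1 - 2 * ‖x‖) = 0 := max_eq_left (by linarith)
    simp only [Ψ, dif_neg hx0, e1, e2, e3, h1, zero_smul, sub_zero, ν]
    rw [smul_smul, mul_inv_cancel₀ (norm_ne_zero_iff.2 hx0), one_smul]
  have hpn : ‖p.1‖ = 1 := mem_sphere_zero_iff_norm.1 p.2
  by_cases hx0 : x = 0
  · subst hx0
    have : Ψ 0 = 0 := dif_pos rfl
    rw [this] at hx
    simp only [norm_zero, mul_zero, sub_zero, zero_sub, neg_eq_zero] at hx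
    rw [max_eq_right zero_le_one, one_smul] at hx
    rw [hx] at hpn
    norm_num at hpn
  · set τ := max 0 (min 1 (2 * ‖x‖ - 1)) with hτ
    set q := k τ (ν ⟨x, hx0⟩) with hq
    have hx' : m ‖x‖ • q.1 = max 0 (1 - 2 * ‖x‖) • p.1 := by
      rw [← sub_eq_zero]
      refine Eq.trans ?_ hx
      simp only [Ψ, dif_neg hx0, hq, hτ]
    have hqn : ‖q.1‖ = 1 := mem_sphere_zero_iff_norm.1 q.2
    have hxp : 0 < ‖x‖ := norm_pos_iff.2 hx0
    have hm0 : 0 < m ‖x‖ := hxp.trans_le (le_max_right _ _)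
    have hn := congrArg norm hx'
    rw [norm_smul, norm_smul, hqn, hpn, Real.norm_of_nonneg hm0.le,
      Real.norm_of_nonneg (le_max_left _ _), mul_one, mul_one] at hn
    have hlt : 0 < 1 - 2 * ‖x‖ := by
      by_contra hle
      rw [max_eq_left (not_lt.1 hle)] at hn
      linarith
    have hτ0 : τ = 0 := by
      rw [hτ, min_eq_right (by linarith), max_eq_left (by linarith)]
    rw [← hn] at hx'
    have := smul_right_injective E hm0.ne' hx'
    exact hp (ν ⟨x, hx0⟩) (Subtype.ext (by rw [← this, hq, hτ0]))

end Surjective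

/-- Base point preserving self homotopy equivalences of `Sⁿ` are surjective. -/
theorem F.surjective_smul {n : ℕ} (f : F n) :
    Function.Surjective fun x : Sphere n ↦ (f • x : Sphere n) := by
  obtain ⟨g, -, ⟨H⟩, -⟩ := f.exists_inverse
  let e : Sphere n ≃ₜ Metric.sphere (0 : EuclideanSpace ℝ (Fin (n + 1))) 1 :=
    onePointEquivSphereOfFinrankEq (V := Fin n → ℝ) (by simp)
  let k : ℝ → Metric.sphere (0 : EuclideanSpace ℝ (Fin (n + 1))) 1 →
      Metric.sphere (0 : EuclideanSpace ℝ (Fin (n + 1))) 1 := fun t x ↦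
    e (H (Set.projIcc 0 1 zero_le_one t, e.symm x))
  have hk := surjective_of_homotopy (k := k) (by
    have : Continuous (Set.projIcc (0 : ℝ) 1 zero_le_one) := continuous_projIcc
    fun_prop) (fun x ↦ by simp [k])
  intro y
  obtain ⟨x, hx⟩ := hk (e y)
  refine ⟨g (e.symm x), ?_⟩
  simpa [k, F.smul_def] using hx

/-! ### Equality of points of bar constructions -/

namespace Bar

variable {G X : Type} [Monoid G] [TopologicalSpace G] [TopologicalSpace X]

/-- The product of the labels at the times in `J`. -/
def labelOn (J : Set unitInterval) (l : List (unitInterval × G)) : G :=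
  open Classical in (l.map fun p ↦ if p.1 ∈ J then p.2 else 1).prod

theorem labelOn_append (J : Set unitInterval) (l l' : List (unitInterval × G)) :
    labelOn J (l ++ l') = labelOn J l * labelOn J l' := by simp [labelOn]

theorem labelOn_cons_mem {J : Set unitInterval} {t : unitInterval} (h : t ∈ J) (g : G)
    (l : List (unitInterval × G)) : labelOn J ((t, g) :: l) = g * labelOn J l := by
  simp [labelOn, h]

theorem labelOn_cons_notMem {J : Set unitInterval} {t : unitInterval} (h : t ∉ J) (g : G)
    (l : List (unitInterval × G)) : labelOn J ((t, g) :: l) = labelOn J l := by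
  simp [labelOn, h]

theorem labelOn_nil (J : Set unitInterval) : labelOn J ([] : List (unitInterval × G)) = 1 := rfl

theorem labelOn_congr {J J' : Set unitInterval} {l : List (unitInterval × G)}
    (h : ∀ p ∈ l, (p.1 ∈ J ↔ p.1 ∈ J')) : labelOn J l = labelOn J' l := by
  refine congrArg List.prod (List.map_congr_left fun p hp ↦ ?_)
  by_cases hJ : p.1 ∈ J
  · rw [if_pos hJ, if_pos ((h p hp).1 hJ)]
  · rw [if_neg hJ, if_neg fun h' ↦ hJ ((h p hp).2 h')]

theorem labelOn_singleton (l : List (unitInterval × G)) (τ : unitInterval) :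
    labelOn {τ} l = label l τ := by
  simp [labelOn, label]

/-- Products of labels vary continuously as long as no time enters or leaves `J`. -/
theorem continuousAt_labelOn [ContinuousMul G] {J : Set unitInterval} :
    ∀ {l : List (unitInterval × G)}
      (_ : ∀ p ∈ l, (∀ᶠ x in 𝓝 p.1, x ∈ J) ∨ ∀ᶠ x in 𝓝 p.1, x ∉ J),
      ContinuousAt (labelOn J) l
  | [], _ => by
    rw [ContinuousAt, nhds_nil]
    exact tendsto_pure_nhds _ _
  | (t, g) :: l, h => by
    have ih : ContinuousAt (labelOn J) l := continuousAt_labelOn fun p hp ↦ h p (by simp [hp])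
    have hfst : Filter.Tendsto (fun x : (unitInterval × G) × List (unitInterval × G) ↦ x.1.1)
        (𝓝 (t, g) ×ˢ 𝓝 l) (𝓝 t) := (continuous_fst.tendsto (t, g)).comp Filter.tendsto_fst
    have hl : Filter.Tendsto (fun x : (unitInterval × G) × List (unitInterval × G) ↦
        labelOn J x.2) (𝓝 (t, g) ×ˢ 𝓝 l) (𝓝 (labelOn J l)) := ih.tendsto.comp Filter.tendsto_snd
    rw [ContinuousAt, List.tendsto_cons_iff]
    rcases h (t, g) (by simp) with h | h
    · rw [labelOn_cons_mem h.self_of_nhds]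
      have hg : Filter.Tendsto (fun x : (unitInterval × G) × List (unitInterval × G) ↦ x.1.2)
          (𝓝 (t, g) ×ˢ 𝓝 l) (𝓝 g) := (continuous_snd.tendsto (t, g)).comp Filter.tendsto_fst
      refine (hg.mul hl).congr' ?_
      filter_upwards [hfst.eventually h] with x hx
      exact (labelOn_cons_mem hx _ _).symm
    · rw [labelOn_cons_notMem h.self_of_nhds]
      refine hl.congr' ?_
      filter_upwards [hfst.eventually h] with x hx
      exact (labelOn_cons_notMem hx _ _).symm

theorem exists_gt_separating (T : Set unitInterval) (hT : T.Finite) {s : unitInterval}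
    (hs : s < 1) : ∃ s', s < s' ∧ ∀ x ∈ T, x ≤ s ∨ s' < x := by
  have : (𝓝[>] s).NeBot := nhdsGT_neBot_of_exists_gt ⟨1, hs⟩
  have h : ∀ᶠ s' in 𝓝[>] s, ∀ x ∈ T, x ≤ s ∨ s' < x := by
    rw [Filter.eventually_all_finite hT]
    intro x _
    by_cases hx : x ≤ s
    · exact .of_forall fun _ ↦ .inl hx
    · filter_upwards [mem_nhdsWithin_of_mem_nhds (Iio_mem_nhds (not_le.1 hx))] with s' hs'
      exact .inr hs'
  obtain ⟨s', h1, h2⟩ := (h.and self_mem_nhdsWithin).exists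
  exact ⟨s', h2, h1⟩

theorem exists_lt_separating (T : Set unitInterval) (hT : T.Finite) {t : unitInterval}
    (ht : 0 < t) : ∃ t', t' < t ∧ ∀ x ∈ T, t ≤ x ∨ x < t' := by
  have : (𝓝[<] t).NeBot := nhdsLT_neBot_of_exists_lt ⟨0, ht⟩
  have h : ∀ᶠ t' in 𝓝[<] t, ∀ x ∈ T, t ≤ x ∨ x < t' := by
    rw [Filter.eventually_all_finite hT]
    intro x _
    by_cases hx : t ≤ x
    · exact .of_forall fun _ ↦ .inl hx
    · filter_upwards [mem_nhdsWithin_of_mem_nhds (Ioi_mem_nhds (not_le.1 hx))] with t' ht'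
      exact .inr ht'
  obtain ⟨t', h1, h2⟩ := (h.and self_mem_nhdsWithin).exists
  exact ⟨t', h2, h1⟩

theorem finite_times (l l' : List (unitInterval × G)) : {x | ∃ p ∈ l ++ l', p.1 = x}.Finite :=
  ((List.finite_toSet (l ++ l')).image Prod.fst).subset fun _ ⟨p, hp, h⟩ ↦ ⟨p, hp, h⟩

theorem labelOn_eq_of_rel {J : Set unitInterval} (h0 : 0 ∉ J) (h1 : 1 ∉ J) [SMul G X]
    {p q : List (unitInterval × G) × X} (h : BarRel G X p q) :
    labelOn J p.1 = labelOn J q.1 := by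
  cases h with
  | degeneracy l₁ l₂ s x =>
    by_cases hs : s ∈ J
    · simp [labelOn_append, labelOn_cons_mem hs]
    · simp [labelOn_append, labelOn_cons_notMem hs]
  | face l₁ l₂ s g g' x =>
    by_cases hs : s ∈ J
    · simp [labelOn_append, labelOn_cons_mem hs, mul_assoc]
    · simp [labelOn_append, labelOn_cons_notMem hs]
  | first l g x => exact labelOn_cons_notMem h0 _ _
  | last l g x => simp [labelOn_append, labelOn_cons_notMem h1, labelOn_nil]

theorem labelOn_smul_eq_of_rel [MulAction G X] {J : Set unitInterval} (h0 : 0 ∉ J) (h1 : 1 ∈ J)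
    {p q : List (unitInterval × G) × X} (h : BarRel G X p q) :
    labelOn J p.1 • p.2 = labelOn J q.1 • q.2 := by
  cases h with
  | degeneracy l₁ l₂ s x =>
    by_cases hs : s ∈ J
    · simp [labelOn_append, labelOn_cons_mem hs]
    · simp [labelOn_append, labelOn_cons_notMem hs]
  | face l₁ l₂ s g g' x =>
    by_cases hs : s ∈ J
    · simp [labelOn_append, labelOn_cons_mem hs, mul_assoc]
    · simp [labelOn_append, labelOn_cons_notMem hs]
  | first l g x => exact congrArg (· • x) (labelOn_cons_notMem h0 _ _)
  | last l g x => simp [labelOn_append, labelOn_cons_mem h1, labelOn_nil, mul_smul]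

/-- Words with the same products of labels over the open subintervals of the unit interval. -/
def labelSetoid (G X : Type) [Monoid G] : Setoid (BarWord G × X) where
  r p q := ∀ s t, s < 1 → 0 < t → labelOn (Set.Ioo s t) p.1.1 = labelOn (Set.Ioo s t) q.1.1
  iseqv :=
    { refl := fun _ _ _ _ _ ↦ rfl
      symm := fun h s t hs ht ↦ (h s t hs ht).symm
      trans := fun h h' s t hs ht ↦ (h s t hs ht).trans (h' s t hs ht) }

/-- Pairs of a word and a point of `X` with the same products of labels over the intervals `(s, 1]`,
applied to the point. -/
def smulSetoid (G X : Type) [Monoid G] [MulAction G X] : Setoid (BarWord G × X) where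
  r p q := ∀ s, s < 1 → labelOn (Set.Ioi s) p.1.1 • p.2 = labelOn (Set.Ioi s) q.1.1 • q.2
  iseqv :=
    { refl := fun _ _ _ ↦ rfl
      symm := fun h s hs ↦ (h s hs).symm
      trans := fun h h' s hs ↦ (h s hs).trans (h' s hs) }

/-- The relation is closed because an interval over which the products differ may be shrunk until no
time is an end point. -/
theorem kclosed_labelSetoid [ContinuousMul G] [T2Space G] :
    KClosed {p : (BarWord G × X) × (BarWord G × X) | labelSetoid G X p.1 p.2} := by
  refine fun K k ↦ IsClosed.preimage k.continuous ?_
  rw [← isOpen_compl_iff, isOpen_iff_mem_nhds]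
  rintro ⟨⟨l, x⟩, ⟨l', x'⟩⟩ hne
  obtain ⟨s, t, hs, ht, hst⟩ : ∃ s t, s < 1 ∧ 0 < t ∧
      labelOn (Set.Ioo s t) l.1 ≠ labelOn (Set.Ioo s t) l'.1 := by
    by_contra! h
    exact hne h
  obtain ⟨s', hs', hsT⟩ := exists_gt_separating _ (finite_times l.1 l'.1) hs
  obtain ⟨t', ht', htT⟩ := exists_lt_separating _ (finite_times l.1 l'.1) ht
  have hmem : ∀ p ∈ l.1 ++ l'.1, (p.1 ∈ Set.Ioo s t ↔ p.1 ∈ Set.Ioo s' t') := fun p hp ↦ by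
    have h1 := hsT p.1 ⟨p, hp, rfl⟩
    have h2 := htT p.1 ⟨p, hp, rfl⟩
    constructor
    · rintro ⟨h3, h4⟩
      exact ⟨h1.resolve_left (not_le.2 h3), h2.resolve_left (not_le.2 h4)⟩
    · rintro ⟨h3, h4⟩
      exact ⟨hs'.trans h3, h4.trans ht'⟩
  have hnhds : ∀ p ∈ l.1 ++ l'.1, (∀ᶠ x in 𝓝 p.1, x ∈ Set.Ioo s' t') ∨
      ∀ᶠ x in 𝓝 p.1, x ∉ Set.Ioo s' t' := fun p hp ↦ by
    rcases hsT p.1 ⟨p, hp, rfl⟩ with h1 | h1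
    · refine .inr ?_
      filter_upwards [Iio_mem_nhds (h1.trans_lt hs')] with x hx hx'
      exact lt_asymm hx hx'.1
    · rcases htT p.1 ⟨p, hp, rfl⟩ with h2 | h2
      · refine .inr ?_
        filter_upwards [Ioi_mem_nhds (ht'.trans_le h2)] with x hx hx'
        exact lt_asymm hx hx'.2
      · exact .inl (Ioo_mem_nhds h1 h2)
  rw [labelOn_congr fun p hp ↦ hmem p (by simp [hp]),
    labelOn_congr fun p hp ↦ hmem p (by simp [hp])] at hst
  have c1 : ContinuousAt (labelOn (Set.Ioo s' t')) l.1 :=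
    continuousAt_labelOn fun p hp ↦ hnhds p (by simp [hp])
  have c2 : ContinuousAt (labelOn (Set.Ioo s' t')) l'.1 :=
    continuousAt_labelOn fun p hp ↦ hnhds p (by simp [hp])
  have d1 : Continuous fun q : (BarWord G × X) × (BarWord G × X) ↦ q.1.1.1 := by fun_prop
  have d2 : Continuous fun q : (BarWord G × X) × (BarWord G × X) ↦ q.2.1.1 := by fun_prop
  have key := (c1.tendsto.comp (d1.tendsto ((l, x), (l', x')))).prodMk_nhds
    (c2.tendsto.comp (d2.tendsto ((l, x), (l', x'))))
  filter_upwards [key.eventually (isClosed_diagonal.isOpen_compl.mem_nhds hst)] with q hq hR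
  -- If `s' = 1` or `t' = 0`, the interval is empty.
  by_cases h : s' < 1 ∧ 0 < t'
  · exact hq (hR s' t' h.1 h.2)
  · have he : Set.Ioo s' t' = ∅ := Set.Ioo_eq_empty fun hlt ↦ h
      ⟨hlt.trans_le (unitInterval.le_one t'), (unitInterval.nonneg s').trans_lt hlt⟩
    exact hq (by simp [he, labelOn])

theorem kclosed_smulSetoid [ContinuousMul G] [MulAction G X] [ContinuousSMul G X] [T2Space X] :
    KClosed {p : (BarWord G × X) × (BarWord G × X) | smulSetoid G X p.1 p.2} := by
  refine fun K k ↦ IsClosed.preimage k.continuous ?_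
  rw [← isOpen_compl_iff, isOpen_iff_mem_nhds]
  rintro ⟨⟨l, x⟩, ⟨l', x'⟩⟩ hne
  obtain ⟨s, hs, hst⟩ : ∃ s, s < 1 ∧
      labelOn (Set.Ioi s) l.1 • x ≠ labelOn (Set.Ioi s) l'.1 • x' := by
    by_contra! h
    exact hne h
  obtain ⟨s₁, hs₁, hsT⟩ := exists_gt_separating _ (finite_times l.1 l'.1) hs
  obtain ⟨s', hs', hs1⟩ := exists_between hs₁
  have hmem : ∀ p ∈ l.1 ++ l'.1, (p.1 ∈ Set.Ioi s ↔ p.1 ∈ Set.Ioi s') := fun p hp ↦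
    ⟨fun h ↦ hs1.trans ((hsT p.1 ⟨p, hp, rfl⟩).resolve_left (not_le.2 h)), hs'.trans⟩
  have hnhds : ∀ p ∈ l.1 ++ l'.1, (∀ᶠ x in 𝓝 p.1, x ∈ Set.Ioi s') ∨
      ∀ᶠ x in 𝓝 p.1, x ∉ Set.Ioi s' := fun p hp ↦ by
    rcases hsT p.1 ⟨p, hp, rfl⟩ with h1 | h1
    · refine .inr ?_
      filter_upwards [Iio_mem_nhds (h1.trans_lt hs')] with x hx hx'
      exact lt_asymm hx (Set.mem_Ioi.1 hx')
    · exact .inl (Ioi_mem_nhds (hs1.trans h1))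
  rw [labelOn_congr fun p hp ↦ hmem p (by simp [hp]),
    labelOn_congr fun p hp ↦ hmem p (by simp [hp])] at hst
  have c1 : ContinuousAt (labelOn (Set.Ioi s')) l.1 :=
    continuousAt_labelOn fun p hp ↦ hnhds p (by simp [hp])
  have c2 : ContinuousAt (labelOn (Set.Ioi s')) l'.1 :=
    continuousAt_labelOn fun p hp ↦ hnhds p (by simp [hp])
  have d1 : Continuous fun q : (BarWord G × X) × (BarWord G × X) ↦ q.1.1.1 := by fun_prop
  have d2 : Continuous fun q : (BarWord G × X) × (BarWord G × X) ↦ q.2.1.1 := by fun_prop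
  have d3 : Continuous fun q : (BarWord G × X) × (BarWord G × X) ↦ q.1.2 := by fun_prop
  have d4 : Continuous fun q : (BarWord G × X) × (BarWord G × X) ↦ q.2.2 := by fun_prop
  have key := ((c1.tendsto.comp (d1.tendsto ((l, x), (l', x')))).smul
      (d3.tendsto ((l, x), (l', x')))).prodMk_nhds
    ((c2.tendsto.comp (d2.tendsto ((l, x), (l', x')))).smul (d4.tendsto ((l, x), (l', x'))))
  filter_upwards [key.eventually (isClosed_diagonal.isOpen_compl.mem_nhds hst)] with q hq hR
  exact hq (hR s' (hs1.trans_le (unitInterval.le_one _)))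

/-- The labels in the open unit interval are determined by the point of the bar construction. -/
theorem label_eq_of_mk_eq [SMul G X] [ContinuousMul G] [T2Space G] {l l' : BarWord G} {x x' : X}
    (h : (mk l x : Bar G X) = mk l' x') (τ : unitInterval) (h0 : 0 < τ) (h1 : τ < 1) :
    label l.1 τ = label l'.1 τ := by
  have hR := KQuot.rel_of_mk_eq (labelSetoid G X) kclosed_labelSetoid (fun _ _ hr s t _ _ ↦
    labelOn_eq_of_rel (J := Set.Ioo s t) (fun h ↦ absurd h.1 (not_lt.2 (unitInterval.nonneg _)))
      (fun h ↦ absurd h.2 (not_lt.2 (unitInterval.le_one _))) hr) h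
  obtain ⟨t, ht, htT⟩ := exists_gt_separating _ (finite_times l.1 l'.1) h1
  obtain ⟨s, hs, hsT⟩ := exists_lt_separating _ (finite_times l.1 l'.1) h0
  have hmem : ∀ p ∈ l.1 ++ l'.1, (p.1 ∈ Set.Ioo s t ↔ p.1 ∈ ({τ} : Set unitInterval)) := by
    intro p hp
    constructor
    · rintro ⟨h3, h4⟩
      exact le_antisymm ((htT p.1 ⟨p, hp, rfl⟩).resolve_right (lt_asymm h4))
        ((hsT p.1 ⟨p, hp, rfl⟩).resolve_right (lt_asymm h3))
    · rintro h
      rw [Set.mem_singleton_iff.1 h]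
      exact ⟨hs, ht⟩
  have := hR s t (hs.trans h1) (h0.trans ht)
  rwa [labelOn_congr fun p hp ↦ hmem p (by simp [hp]),
    labelOn_congr fun p hp ↦ hmem p (by simp [hp]), labelOn_singleton, labelOn_singleton] at this

theorem label_one_smul_eq_of_mk_eq [MulAction G X] [ContinuousMul G] [ContinuousSMul G X]
    [T2Space X] {l l' : BarWord G} {x x' : X} (h : (mk l x : Bar G X) = mk l' x') :
    label l.1 1 • x = label l'.1 1 • x' := by
  have hR := KQuot.rel_of_mk_eq (smulSetoid G X) kclosed_smulSetoid (fun _ _ hr s hs ↦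
    labelOn_smul_eq_of_rel (J := Set.Ioi s) (fun h ↦ absurd h (not_lt.2 (unitInterval.nonneg _)))
      hs hr) h
  obtain ⟨s, hs, hsT⟩ := exists_lt_separating _ (finite_times l.1 l'.1) zero_lt_one
  have hmem : ∀ p ∈ l.1 ++ l'.1, (p.1 ∈ Set.Ioi s ↔ p.1 ∈ ({1} : Set unitInterval)) := by
    intro p hp
    constructor
    · intro h3
      exact le_antisymm (unitInterval.le_one _)
        ((hsT p.1 ⟨p, hp, rfl⟩).resolve_right (lt_asymm h3))
    · rintro h
      rw [Set.mem_singleton_iff.1 h]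
      exact hs
  have := hR s hs
  dsimp only at this
  rwa [labelOn_congr fun p hp ↦ hmem p (by simp [hp]),
    labelOn_congr fun p hp ↦ hmem p (by simp [hp]), labelOn_singleton, labelOn_singleton] at this

/-- A point of the bar construction is determined by its labels in the open unit interval and by
its last coordinate after the last face has been applied. -/
theorem mk_eq_of_label_smul [SMul G X] {l l' : BarWord G} {x x' : X}
    (h : ∀ t, 0 < t → t < 1 → label l.1 t = label l'.1 t)
    (h' : label l.1 1 • x = label l'.1 1 • x') : (mk l x : Bar G X) = mk l' x' := by
  classical
  let S : Finset unitInterval :=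
    ((l.1.map Prod.fst).toFinset ∪ (l'.1.map Prod.fst).toFinset) \ {0, 1}
  let T := S.sort (· ≤ ·)
  have hmem : ∀ t, t ∈ T ↔ t ∈ S := fun t ↦ Finset.mem_sort _
  have hT : T.Pairwise (· < ·) := S.sortedLT_sort.pairwise
  have hT0 : ∀ t ∈ T, 0 < t ∧ t < 1 := fun t ht ↦ by
    have := (Finset.mem_sdiff.1 ((hmem t).1 ht)).2
    simp only [Finset.mem_insert, Finset.mem_singleton, not_or] at this
    exact ⟨lt_of_le_of_ne (unitInterval.nonneg t) (Ne.symm this.1),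
      lt_of_le_of_ne (unitInterval.le_one t) this.2⟩
  have hT1 : (T ++ [1]).Pairwise (· < ·) :=
    List.pairwise_append.2 ⟨hT, by simp, fun t ht s hs ↦ by
      rw [List.mem_singleton.1 hs]
      exact (hT0 t ht).2⟩
  have hT2 : (0 :: (T ++ [1])).Pairwise (· < ·) := by
    refine List.pairwise_cons.2 ⟨fun t ht ↦ ?_, hT1⟩
    rcases List.mem_append.1 ht with ht | ht
    · exact (hT0 t ht).1
    · rw [List.mem_singleton.1 ht]
      exact zero_lt_one
  have hs : ∀ {T : List unitInterval} (_ : T.Pairwise (· < ·)) (f : unitInterval → G),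
      Sorted (word T f) := fun hT f ↦ by
    simpa using sorted_append_word (l₁ := []) List.Pairwise.nil hT (by simp) f
  have key : ∀ (l : BarWord G) (x : X), (∀ p ∈ l.1, p.1 ∈ 0 :: (T ++ [1])) →
      (mk l x : Bar G X) = mk ⟨word T (label l.1), hs hT _⟩ (label l.1 1 • x) := by
    intro l x hl
    have e1 := mk_eq_mk_word x _ hT2 l.1 [] hl (by simp) l.2 (hs hT2 _)
    have e2 : (mk ⟨word (0 :: (T ++ [1])) (label l.1), hs hT2 _⟩ x : Bar G X) =
        mk ⟨word (T ++ [1]) (label l.1), hs hT1 _⟩ x := sound (.first _ _ _)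
    refine (e1.trans e2).trans (sound ?_)
    simp only [word, List.map_append, List.map_cons, List.map_nil]
    exact .last _ _ _
  rw [key l x, key l' x', h']
  · congr 2
    exact word_congr fun t ht ↦ h t (hT0 t ht).1 (hT0 t ht).2
  all_goals
    intro p hp
    by_cases h0 : p.1 = 0
    · simp [h0]
    by_cases h1 : p.1 = 1
    · simp [h1]
    refine List.mem_cons_of_mem _ (List.mem_append_left _ ((hmem _).2 (Finset.mem_sdiff.2
      ⟨Finset.mem_union.2 ?_, by simp [h0, h1]⟩)))
    simp only [List.mem_toFinset]
  · exact .inr (List.mem_map_of_mem hp)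
  · exact .inl (List.mem_map_of_mem hp)

end Bar

/-! ### The topological monoids `F(n)` -/

namespace F

variable {n : ℕ}

instance : MulAction (F n) (Sphere n) where
  one_smul _ := rfl
  mul_smul _ _ _ := rfl

theorem continuous_toMap : Continuous (toMap : F n → C(Sphere n, Sphere n)) :=
  continuous_induced_dom

instance : T2Space (F n) :=
  T2Space.of_injective_continuous (f := toMap) (fun _ _ h ↦ F.ext h) continuous_toMap

instance : ContinuousSMul (F n) (Sphere n) where
  continuous_smul := ContinuousEval.continuous_eval.comp (continuous_toMap.prodMap continuous_id)

instance : ContinuousMul (F n) where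
  continuous_mul := continuous_induced_rng.2
    ((ContinuousMap.continuous_comp').comp ((continuous_toMap.comp continuous_snd).prodMk
      (continuous_toMap.comp continuous_fst)))

end F

/-! ### Products of points of the spaces `V(n)` -/

namespace Bar

variable {G H M X : Type} [Monoid G] [Monoid H] [Monoid M] [SMul M X]
  [TopologicalSpace G] [TopologicalSpace H] [TopologicalSpace M] [TopologicalSpace X]

/-- The product of words is continuous as a map to the bar construction: it is so on the closed
sets on which the times are shuffled in a fixed way. -/
theorem kcont_merge_point (i : G →* M) (j : H →* M) (hi : Continuous i) (hj : Continuous j)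
    (hc : ∀ g h, Commute (i g) (j h)) :
    KCont fun p : (BarWord G × BarWord H) × X ↦
      (mk (mergeWord (mapWord i p.1.1) (mapWord j p.1.2)) p.2 : Bar M X) := by
  intro K k
  let u : CH K → List (unitInterval × M) := fun x ↦ (mapWord i (k x).1.1).1
  let v : CH K → List (unitInterval × M) := fun x ↦ (mapWord j (k x).1.2).1
  have hu : Continuous u := continuous_subtype_val.comp ((continuous_mapWord hi).comp
    (continuous_fst.comp (continuous_fst.comp k.continuous)))
  have hv : Continuous v := continuous_subtype_val.comp ((continuous_mapWord hj).comp
    (continuous_snd.comp (continuous_fst.comp k.continuous)))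
  have hlen : Continuous (List.length : List (unitInterval × M) → ℕ) :=
    continuous_iff_continuousAt.2 List.continuousAt_length
  -- `C π` consists of the points at which shuffling the two words according to `π` sorts the times.
  let C : List Bool → Set (CH K) := fun π ↦ {x | Fits π (u x) (v x) ∧ Sorted (shuf π (u x) (v x))}
  have hsh : ∀ π, Continuous fun x ↦ shuf π (u x) (v x) := fun π ↦
    (continuous_shuf π).comp (hu.prodMk hv)
  have hC : ∀ π, IsClosed (C π) := fun π ↦
    ((isClosed_eq continuous_const (hlen.comp hu)).inter
      (isClosed_eq continuous_const (hlen.comp hv))).inter (isClosed_sorted.preimage (hsh π))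
  have hfin : LocallyFinite C := by
    intro x
    refine ⟨{y | (u y).length = (u x).length} ∩ {y | (v y).length = (v x).length}, ?_, ?_⟩
    · exact Filter.inter_mem
        ((hlen.comp hu).continuousAt (IsOpen.mem_nhds (isOpen_discrete {(u x).length}) rfl))
        ((hlen.comp hv).continuousAt (IsOpen.mem_nhds (isOpen_discrete {(v x).length}) rfl))
    · refine (List.finite_length_eq Bool ((u x).length + (v x).length)).subset ?_
      rintro π ⟨y, ⟨⟨h1, h2⟩, -⟩, h3, h4⟩
      have := List.count_true_add_count_false π
      simp only [Set.mem_ofPred_eq] at h3 h4 ⊢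
      omega
  refine hfin.continuous ?_ hC ?_
  · refine Set.eq_univ_of_forall fun x ↦ Set.mem_iUnion.2 ?_
    obtain ⟨π, h1, h2, -⟩ := exists_shuf (u x) (v x) (mapWord i (k x).1.1).2
      (mapWord j (k x).1.2).2
    exact ⟨π, h1, h2⟩
  · intro π
    rw [continuousOn_iff_continuous_domRestrict]
    have : CompactSpace (C π) := isCompact_iff_compactSpace.1 (hC π).isCompact
    let w : C(C π, BarWord M × X) := ⟨fun x ↦ (⟨shuf π (u x) (v x), x.2.2⟩, (k x).2),
      (((hsh π).comp continuous_subtype_val).subtype_mk _).prodMk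
        (continuous_snd.comp (k.continuous.comp continuous_subtype_val))⟩
    have h := @kcont_mk M X _ _ _ _ (CompHaus.of (C π)) w
    convert h using 1
    funext x
    have hl : ∀ τ, label (mergeWord (mapWord i (k x).1.1) (mapWord j (k x).1.2)).1 τ =
        label (shuf π (u x) (v x)) τ := fun τ ↦ by
      rw [label_mergeWord i j hc, ← label_map, ← label_map]
      exact (label_shuf π _ _ x.2.1 (commute_map i j hc _ _) τ).symm
    exact mk_eq_of_label_smul (fun t _ _ ↦ hl t) (congrArg (· • (k x).2) (hl 1))

theorem label_filter (l : BarWord G) (τ : unitInterval) (hτ : τ < 1) :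
    label (l.1.filter (·.1 < 1)) τ = label l.1 τ := by
  induction l.1 with
  | nil => rfl
  | cons p l ih =>
    obtain ⟨t, g⟩ := p
    by_cases h : t < 1
    · rw [List.filter_cons_of_pos (by simpa using h)]
      by_cases ht : t = τ
      · subst ht
        rw [label_cons_self, label_cons_self, ih]
      · rw [label_cons_ne _ _ ht, label_cons_ne _ _ ht, ih]
    · rw [List.filter_cons_of_neg (by simpa using h), ih, label_cons_ne]
      rintro rfl
      exact h hτ

/-- Every point of `BG` has a representative without the time `1`. -/
theorem exists_label_one_eq_one (b : Bar G Unit) : ∃ l : BarWord G,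
    label l.1 1 = 1 ∧ b = mk l () := by
  induction b using ind with | h l x
  refine ⟨⟨l.1.filter (·.1 < 1), l.2.sublist List.filter_sublist⟩, label_eq_one fun p hp ↦ ?_,
    mk_eq_of_label fun t _ ht ↦ (label_filter l t ht).symm⟩
  have := (List.mem_filter.1 hp).2
  simp only [decide_eq_true_eq] at this
  exact this.ne

end Bar

/-- The homeomorphism `S^{n-α} ∧ Sᵃ ∧ Sᵇ ≅ Sⁿ` specified by `α : a ⊔ b → n`. -/
def Sphere.smash₂ {a b n : ℕ} (α : Fin a ⊕ Fin b ↪ Fin n) (s : CoSphere α) (x : Sphere a)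
    (y : Sphere b) : Sphere n :=
  s.1 + Sphere.push (Function.Embedding.inl.trans α) x +
    Sphere.push (Function.Embedding.inr.trans α) y

namespace Sphere

variable {a b a' b' m n : ℕ} (α : Fin a ⊕ Fin b ↪ Fin n)

theorem continuous_smash₂ :
    Continuous fun p : CoSphere α × (Sphere a × Sphere b) ↦ smash₂ α p.1 p.2.1 p.2.2 := by
  have h := (continuous_smash (Function.Embedding.inr.trans α)).comp
    (((SymSpectrum.continuous_unitCoord α).comp (by fun_prop : Continuous fun p : CoSphere α ×
      (Sphere a × Sphere b) ↦ (p.1, p.2.1))).prodMk (by fun_prop : Continuous fun p : CoSphere α ×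
      (Sphere a × Sphere b) ↦ p.2.2))
  exact h

theorem smul_smash₂ (f : F a) (g : F b) (s : CoSphere α) (x : Sphere a) (y : Sphere b) :
    (F.map (Function.Embedding.inl.trans α) f * F.map (Function.Embedding.inr.trans α) g) •
      smash₂ α s x y = smash₂ α s (f • x : Sphere a) (g • y : Sphere b) := by
  have h1 := F.map_smul_smash (Function.Embedding.inr.trans α) g
    (SymSpectrum.unitCoord α s x, y)
  -- The sphere coordinate that is complementary to `a`.
  let r : CoSphere (Function.Embedding.inl.trans α) :=
    ⟨s.1 + Sphere.push (Function.Embedding.inr.trans α) (g • y : Sphere b), by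
      refine (s.2.mono ?_).add ((Sphere.suppOn_push _ _).mono ?_)
      · rw [Set.compl_subset_compl]
        rintro _ ⟨i, rfl⟩
        exact ⟨_, rfl⟩
      · rintro _ ⟨i, rfl⟩ ⟨j, hj⟩
        exact absurd (α.injective hj) (by simp)⟩
  have h2 := F.map_smul_smash (Function.Embedding.inl.trans α) f (r, x)
  have e : ∀ x : Sphere a, smash₂ α s x (g • y : Sphere b) =
      smash (Function.Embedding.inl.trans α) (r, x) := fun x ↦ add_right_comm _ _ _
  rw [F.mul_smul', e, ← h2, ← e]
  exact congrArg _ h1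

variable {α}

theorem smash₂_infty {s : CoSphere α} (h : s.1 = infty) (x : Sphere a) (y : Sphere b) :
    smash₂ α s x y = infty := by
  simp only [smash₂, h, infty_add]

theorem smash₂_infty_left (s : CoSphere α) (y : Sphere b) : smash₂ α s infty y = infty := by
  simp only [smash₂, push_infty, infty_add, add_infty]

theorem smash₂_infty_right (s : CoSphere α) (x : Sphere a) : smash₂ α s x infty = infty := by
  simp only [smash₂, push_infty, add_infty]

end Sphere

namespace V

variable {a b a' b' m n : ℕ}

theorem mk_eq_iff {l l' : BarWord (F n)} {x x' : Sphere n} :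
    (Bar.mk l x : VObj n) = Bar.mk l' x' ↔
      (∀ t, 0 < t → t < 1 → Bar.label l.1 t = Bar.label l'.1 t) ∧
        (Bar.label l.1 1 • x : Sphere n) = Bar.label l'.1 1 • x' :=
  ⟨fun h ↦ ⟨Bar.label_eq_of_mk_eq h, Bar.label_one_smul_eq_of_mk_eq h⟩,
    fun h ↦ Bar.mk_eq_of_label_smul h.1 h.2⟩

/-- Over a point of `BF(n)`, the space `V(n)` consists of the points with a given representing
word, because the elements of `F(n)` are surjective. -/
theorem exists_mk (l : BarWord (F n)) (v : VObj n) (h : proj v = BF.mk l) :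
    ∃ x, v = Bar.mk l x := by
  induction v using Bar.ind with | h l' x'
  rw [proj_mk] at h
  obtain ⟨x, hx⟩ := (Bar.label l.1 1).surjective_smul (Bar.label l'.1 1 • x')
  exact ⟨x, mk_eq_iff.2 ⟨Bar.label_eq_of_mk_eq h, hx.symm⟩⟩

theorem mk_mulWord_congr (α : Fin a ⊕ Fin b ↪ Fin n) (s : CoSphere α) {l l' : BarWord (F a)}
    {m m' : BarWord (F b)} {x x' : Sphere a} {y y' : Sphere b}
    (h : (Bar.mk l x : VObj a) = Bar.mk l' x') (h' : (Bar.mk m y : VObj b) = Bar.mk m' y') :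
    (Bar.mk (BF.mulWord α l m) (Sphere.smash₂ α s x y) : VObj n) =
      Bar.mk (BF.mulWord α l' m') (Sphere.smash₂ α s x' y') := by
  rw [mk_eq_iff] at h h' ⊢
  refine ⟨fun t h0 h1 ↦ ?_, ?_⟩
  · rw [BF.label_mulWord, BF.label_mulWord, h.1 t h0 h1, h'.1 t h0 h1]
  · rw [BF.label_mulWord, BF.label_mulWord, Sphere.smul_smash₂, Sphere.smul_smash₂, h.2, h'.2]

theorem exists_rep (v : VObj n) : ∃ p : BarWord (F n) × Sphere n, Bar.mk p.1 p.2 = v :=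
  Quotient.exists_rep v

/-- For `α : a ⊔ b → n`, the map `S^{n-α} × V(a) × V(b) → V(n)` that is induced by
`F(a) × F(b) → F(n)` and `S^{n-α} ∧ Sᵃ ∧ Sᵇ ≅ Sⁿ`. It is defined by a choice of
representatives. -/
def mulV (α : Fin a ⊕ Fin b ↪ Fin n) (s : CoSphere α) (v : VObj a) (w : VObj b) : VObj n :=
  Bar.mk (BF.mulWord α (exists_rep v).choose.1 (exists_rep w).choose.1)
    (Sphere.smash₂ α s (exists_rep v).choose.2 (exists_rep w).choose.2)

theorem mulV_mk (α : Fin a ⊕ Fin b ↪ Fin n) (s : CoSphere α) (l : BarWord (F a)) (x : Sphere a)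
    (m : BarWord (F b)) (y : Sphere b) : mulV α s (Bar.mk l x) (Bar.mk m y) =
      Bar.mk (BF.mulWord α l m) (Sphere.smash₂ α s x y) :=
  mk_mulWord_congr α s (exists_rep (Bar.mk l x)).choose_spec (exists_rep (Bar.mk m y)).choose_spec

theorem kcont_mk_mulWord (α : Fin a ⊕ Fin b ↪ Fin n) :
    KCont fun p : (BarWord (F a) × BarWord (F b)) × Sphere n ↦
      (Bar.mk (BF.mulWord α p.1.1 p.1.2) p.2 : VObj n) :=
  Bar.kcont_merge_point _ _ (F.continuous_map _) (F.continuous_map _) (BF.commute α)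

theorem kcont_mulV (α : Fin a ⊕ Fin b ↪ Fin n) :
    KCont fun p : CoSphere α × (VObj a × VObj b) ↦ mulV α p.1 p.2.1 p.2.2 := by
  have h1 : KCont fun p : VObj a × (CoSphere α × VObj b) ↦ mulV α p.2.1 p.1 p.2.2 := by
    refine KQuot.kcont_prod (A := BarWord (F a) × Sphere a) ?_
    have h2 : KCont fun p : VObj b × (CoSphere α × (BarWord (F a) × Sphere a)) ↦
        mulV α p.2.1 (Bar.mk p.2.2.1 p.2.2.2) p.1 := by
      refine KQuot.kcont_prod (A := BarWord (F b) × Sphere b) ?_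
      have hc : Continuous fun p : (BarWord (F b) × Sphere b) ×
          (CoSphere α × (BarWord (F a) × Sphere a)) ↦
            ((p.2.2.1, p.1.1), Sphere.smash₂ α p.2.1 p.2.2.2 p.1.2) :=
        (by fun_prop : Continuous fun p : (BarWord (F b) × Sphere b) ×
          (CoSphere α × (BarWord (F a) × Sphere a)) ↦ (p.2.2.1, p.1.1)).prodMk
          ((Sphere.continuous_smash₂ α).comp (by fun_prop : Continuous fun p :
            (BarWord (F b) × Sphere b) × (CoSphere α × (BarWord (F a) × Sphere a)) ↦
              (p.2.1, (p.2.2.2, p.1.2))))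
      convert (KCont.comp (kcont_mk_mulWord α) (kcont _ hc) :) using 2 with p
      exact mulV_mk α _ _ _ _ _
    exact (KCont.comp h2 (kcont (fun p : (BarWord (F a) × Sphere a) × (CoSphere α × VObj b) ↦
      (p.2.2, (p.2.1, p.1))) (by fun_prop)) :)
  exact (KCont.comp h1 (kcont (fun p : CoSphere α × (VObj a × VObj b) ↦
    (p.2.1, (p.1, p.2.2))) (by fun_prop)) :)

section

variable (α : Fin a ⊕ Fin b ↪ Fin n) (s : CoSphere α) (v : VObj a) (w : VObj b)

theorem proj_mulV : proj (mulV α s v w) = BF.mulAux α (proj v) (proj w) := by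
  induction v using Bar.ind with | h l x
  induction w using Bar.ind with | h m y
  rw [mulV_mk, proj_mk, proj_mk, proj_mk, BF.mulAux_mk]

theorem mulV_infty (h : s.1 = Sphere.infty) :
    mulV α s v w = sec (BF.mulAux α (proj v) (proj w)) := by
  induction v using Bar.ind with | h l x
  induction w using Bar.ind with | h m y
  rw [mulV_mk, Sphere.smash₂_infty h, proj_mk, proj_mk, BF.mulAux_mk, sec_mk]

theorem mulV_sec_left (x : BF.obj a) :
    mulV α s (sec x) w = sec (BF.mulAux α x (proj w)) := by
  induction x using BF.ind with | h l
  induction w using Bar.ind with | h m y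
  rw [sec_mk, mulV_mk, Sphere.smash₂_infty_left, proj_mk, BF.mulAux_mk, sec_mk]

theorem mulV_sec_right (y : BF.obj b) :
    mulV α s v (sec y) = sec (BF.mulAux α (proj v) y) := by
  induction v using Bar.ind with | h l x
  induction y using BF.ind with | h m
  rw [sec_mk, mulV_mk, Sphere.smash₂_infty_right, proj_mk, BF.mulAux_mk, sec_mk]

end

theorem mulV_shift (β : Fin a ↪ Fin a') (γ : Fin b ↪ Fin b') (α : Fin a' ⊕ Fin b' ↪ Fin n)
    (s : CoSphere α) (s₁ : CoSphere β) (s₂ : CoSphere γ) (v : VObj a) (w : VObj b) :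
    mulV ((β.sumMap γ).trans α) (CoSphere.comp₂ α β γ s s₁ s₂) v w =
      mulV α s (act β (s₁, v)) (act γ (s₂, w)) := by
  induction v using Bar.ind with | h l x
  induction w using Bar.ind with | h m y
  rw [act_mk, act_mk, mulV_mk, mulV_mk]
  have hl : ∀ t, Bar.label (BF.mulWord ((β.sumMap γ).trans α) l m).1 t =
      Bar.label (BF.mulWord α (Bar.mapWord (F.map β) l) (Bar.mapWord (F.map γ) m)).1 t :=
    fun t ↦ by
      rw [BF.label_mulWord, BF.label_mulWord, Bar.label_mapWord, Bar.label_mapWord, ← F.map_trans,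
        ← F.map_trans]
      rfl
  refine Bar.mk_eq_of_label_smul (fun t _ _ ↦ hl t) (congrArg₂ _ (hl 1) ?_)
  simp only [Sphere.smash₂, Sphere.smash, SymSpectrum.comp₂_val, map_add, ← Sphere.push_trans,
    inl_sumMap, inr_sumMap]
  abel

theorem mulV_act (α : Fin a ⊕ Fin b ↪ Fin m) (δ : Fin m ↪ Fin n) (r : CoSphere δ)
    (s : CoSphere α) (v : VObj a) (w : VObj b) :
    mulV (α.trans δ) (.comp δ r s) v w = act δ (r, mulV α s v w) := by
  induction v using Bar.ind with | h l x
  induction w using Bar.ind with | h m y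
  rw [mulV_mk, mulV_mk, act_mk]
  have hl : ∀ t, Bar.label (BF.mulWord (α.trans δ) l m).1 t =
      Bar.label (Bar.mapWord (F.map δ) (BF.mulWord α l m)).1 t := fun t ↦ by
    rw [BF.label_mulWord, Bar.label_mapWord, BF.label_mulWord, map_mul, ← F.map_trans,
      ← F.map_trans]
    rfl
  refine Bar.mk_eq_of_label_smul (fun t _ _ ↦ hl t) (congrArg₂ _ (hl 1) ?_)
  simp only [Sphere.smash₂, Sphere.smash, CoSphere.comp_val, map_add, ← Sphere.push_trans,
    emb_assoc]
  abel

end V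

/-! ### The map from the smash product of Thom spectra to the Thom spectrum of the product -/

section

variable {X Y : ISpace} (f : X ⟶ BF) (g : Y ⟶ BF) {a b a' b' m n : ℕ}

/-- The product `X ⊠ Y → BF ⊠ BF → BF` of `f : X → BF` and `g : Y → BF`. -/
abbrev prodHom : ISpace.box X Y ⟶ BF := (f ⊗ₘ g) ≫ BF.mul

theorem prodHom_t (α : Fin a ⊕ Fin b ↪ Fin n) (x : X.obj a) (y : Y.obj b) :
    (prodHom f g).app (ISpace.t α x y) = BF.mulAux α (f.app x) (g.app y) := rfl

variable {f g}

/-- The map of pullbacks `S^{n-α} × f^*V(a) × g^*V(b) → (f ⊠ g)^*V(n)`. -/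
def thomMul (α : Fin a ⊕ Fin b ↪ Fin n) (s : CoSphere α) (p : ThomPullback (f.app (n := a)))
    (q : ThomPullback (g.app (n := b))) : ThomPullback ((prodHom f g).app (n := n)) :=
  ⟨(ISpace.t α p.1.1 q.1.1, V.mulV α s p.1.2 q.1.2), by
    rw [prodHom_t, V.proj_mulV, p.2, q.2]⟩

theorem kcont_thomMul (α : Fin a ⊕ Fin b ↪ Fin n) :
    KCont fun p : (CoSphere α × ThomPullback (f.app (n := a))) × ThomPullback (g.app (n := b)) ↦
      thomMul α p.1.1 p.1.2 p.2 := by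
  refine KCont.subtypeMk (KCont.prodMk ?_ ?_) _
  · exact ISpace.kcont_t_comp α (kcont _ (by fun_prop)) (kcont _ (by fun_prop))
  · exact (KCont.comp (V.kcont_mulV α) (kcont (fun p : (CoSphere α × ThomPullback (f.app (n := a))) ×
      ThomPullback (g.app (n := b)) ↦ (p.1.1, (p.1.2.1.2, p.2.1.2))) (by fun_prop)) :)

theorem thomMul_infty (α : Fin a ⊕ Fin b ↪ Fin n) (s : CoSphere α) (h : s.1 = Sphere.infty)
    (p : ThomPullback (f.app (n := a))) (q : ThomPullback (g.app (n := b))) :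
    ThomSpace.mk (thomMul α s p q) = ThomSpace.pt :=
  ThomSpace.mk_sec _ (by
    change V.mulV α s p.1.2 q.1.2 = V.sec (BF.mulAux α (f.app p.1.1) (g.app q.1.1))
    rw [V.mulV_infty _ _ _ _ h, p.2, q.2])

theorem thomMul_sec_left (α : Fin a ⊕ Fin b ↪ Fin n) (s : CoSphere α)
    (p : ThomPullback (f.app (n := a))) (q : ThomPullback (g.app (n := b)))
    (h : p.1.2 = V.sec (f.app p.1.1)) : ThomSpace.mk (thomMul α s p q) = ThomSpace.pt :=
  ThomSpace.mk_sec _ (by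
    change V.mulV α s p.1.2 q.1.2 = V.sec (BF.mulAux α (f.app p.1.1) (g.app q.1.1))
    rw [h, V.mulV_sec_left, q.2])

theorem thomMul_sec_right (α : Fin a ⊕ Fin b ↪ Fin n) (s : CoSphere α)
    (p : ThomPullback (f.app (n := a))) (q : ThomPullback (g.app (n := b)))
    (h : q.1.2 = V.sec (g.app q.1.1)) : ThomSpace.mk (thomMul α s p q) = ThomSpace.pt :=
  ThomSpace.mk_sec _ (by
    change V.mulV α s p.1.2 q.1.2 = V.sec (BF.mulAux α (f.app p.1.1) (g.app q.1.1))
    rw [h, V.mulV_sec_right, p.2])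

/-- The map `S^{n-α} ∧ T(f)(a) ∧ T(g)(b) → T(f ⊠ g)(n)`. -/
def thomSmash (α : Fin a ⊕ Fin b ↪ Fin n) (s : CoSphere α) (x : (thomSpectrum f).obj a)
    (y : (thomSpectrum g).obj b) : (thomSpectrum (prodHom f g)).obj n :=
  ThomSpace.lift (Z := ThomSpace (prodHom f g).app) ThomSpace.pt
    (fun p ↦ ThomSpace.lift (Z := ThomSpace (prodHom f g).app) ThomSpace.pt
      (fun q ↦ ThomSpace.mk (thomMul α s p q))
      (KCont.comp ThomSpace.kcont_mk (KCont.comp (kcont_thomMul α)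
        (kcont (fun q : ThomPullback (g.app (n := b)) ↦ ((s, p), q)) (by fun_prop)) :) :)
      (thomMul_sec_right α s p) y)
    (by
      induction y using thom_ind with
      | h0 => exact kcont _ continuous_const
      | h q =>
        exact (KCont.comp ThomSpace.kcont_mk (KCont.comp (kcont_thomMul α)
          (kcont (fun p : ThomPullback (f.app (n := a)) ↦ ((s, p), q)) (by fun_prop)) :) :))
    (fun p hp ↦ by
      induction y using thom_ind with
      | h0 => rfl
      | h q => exact thomMul_sec_left α s p q hp) x

theorem thomSmash_pt_left (α : Fin a ⊕ Fin b ↪ Fin n) (s : CoSphere α)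
    (y : (thomSpectrum g).obj b) :
    thomSmash α s (thomSpectrum f).pt y = (thomSpectrum (prodHom f g)).pt := rfl

theorem thomSmash_pt_right (α : Fin a ⊕ Fin b ↪ Fin n) (s : CoSphere α)
    (x : (thomSpectrum f).obj a) :
    thomSmash α s x (thomSpectrum g).pt = (thomSpectrum (prodHom f g)).pt := by
  induction x using thom_ind with
  | h0 => rfl
  | h p => rfl

theorem kcont_thomSmash (α : Fin a ⊕ Fin b ↪ Fin n) :
    KCont fun p : CoSphere α × ((thomSpectrum f).obj a × (thomSpectrum g).obj b) ↦
      thomSmash α p.1 p.2.1 p.2.2 := by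
  have h : KCont fun p : (CoSphere α × (thomSpectrum f).obj a) × (thomSpectrum g).obj b ↦
      thomSmash α p.1.1 p.1.2 p.2 := by
    refine ThomSpace.kcont_prod ?_ ?_
    · convert kcont (fun _ : CoSphere α × (thomSpectrum f).obj a ↦
        (thomSpectrum (prodHom f g)).pt (n := n)) continuous_const with p
      exact thomSmash_pt_right α p.1 p.2
    · have h2 : KCont fun p : (CoSphere α × ThomPullback (g.app (n := b))) × (thomSpectrum f).obj a ↦
          thomSmash (g := g) α p.1.1 p.2 (ThomSpace.mk p.1.2) := by
        refine ThomSpace.kcont_prod (kcont _ continuous_const) ?_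
        exact (KCont.comp ThomSpace.kcont_mk (KCont.comp (kcont_thomMul α)
          (kcont (fun p : (CoSphere α × ThomPullback (g.app (n := b))) ×
            ThomPullback (f.app (n := a)) ↦ ((p.1.1, p.2), p.1.2)) (by fun_prop)) :) :)
      exact (KCont.comp h2 (kcont (fun p : (CoSphere α × (thomSpectrum f).obj a) ×
        ThomPullback (g.app (n := b)) ↦ ((p.1.1, p.2), p.1.2)) (by fun_prop)) :)
  exact (KCont.comp h (kcont (fun p : CoSphere α × ((thomSpectrum f).obj a ×
    (thomSpectrum g).obj b) ↦ ((p.1, p.2.1), p.2.2)) (by fun_prop)) :)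

variable (f g)

/-- The map `T(f) ∧ T(g) → T(f ⊠ g)`. -/
def smashHom : SymSpectrum.smash (thomSpectrum f) (thomSpectrum g) ⟶ thomSpectrum (prodHom f g) :=
  SymSpectrum.smashDesc thomSmash kcont_thomSmash
    (fun α x y ↦ by
      induction x using thom_ind with
      | h0 => rfl
      | h p =>
        induction y using thom_ind with
        | h0 => rfl
        | h q => exact thomMul_infty α _ rfl p q)
    thomSmash_pt_left thomSmash_pt_right
    (fun β γ α s s₁ s₂ x y ↦ by
      induction x using thom_ind with
      | h0 => rfl
      | h p =>
        induction y using thom_ind with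
        | h0 => rfl
        | h q =>
          exact congrArg ThomSpace.mk (Subtype.ext (Prod.ext (ISpace.t_shift β γ α _ _)
            (V.mulV_shift β γ α s s₁ s₂ _ _))))
    (fun α δ r s x y ↦ by
      induction x using thom_ind with
      | h0 => rfl
      | h p =>
        induction y using thom_ind with
        | h0 => rfl
        | h q =>
          exact congrArg ThomSpace.mk (Subtype.ext (Prod.ext rfl (V.mulV_act α δ r s _ _))))

theorem smashHom_t (α : Fin a ⊕ Fin b ↪ Fin n) (s : CoSphere α)
    (p : ThomPullback (f.app (n := a))) (q : ThomPullback (g.app (n := b))) :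
    (smashHom f g).app (SymSpectrum.t (X := thomSpectrum f) (Y := thomSpectrum g) α s
      (ThomSpace.mk p) (ThomSpace.mk q)) = ThomSpace.mk (thomMul α s p q) := rfl

end

/-! ### Coordinates of smash products of spheres -/

namespace Sphere

variable {a b a' b' m n : ℕ} (α : Fin a ⊕ Fin b ↪ Fin n)

theorem smash₂_of {u : Fin n → ℝ} (hu : SuppOn (Set.range α)ᶜ (of u)) (v : Fin a → ℝ)
    (w : Fin b → ℝ) : smash₂ α ⟨of u, hu⟩ (of v) (of w) =
      of (u + extend (Function.Embedding.inl.trans α) v +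
        extend (Function.Embedding.inr.trans α) w) := rfl

theorem extend_inl_inr (v : Fin a → ℝ) (i : Fin b) :
    extend (Function.Embedding.inl.trans α) v (α (.inr i)) = 0 :=
  extend_apply' _ _ _ (by rintro ⟨j, hj⟩; exact absurd (α.injective hj) (by simp))

theorem extend_inr_inl (v : Fin b → ℝ) (i : Fin a) :
    extend (Function.Embedding.inr.trans α) v (α (.inl i)) = 0 :=
  extend_apply' _ _ _ (by rintro ⟨j, hj⟩; exact absurd (α.injective hj) (by simp))

theorem extend_inl_inl (v : Fin a → ℝ) (i : Fin a) :
    extend (Function.Embedding.inl.trans α) v (α (.inl i)) = v i :=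
  extend_apply (Function.Embedding.inl.trans α) v i

theorem extend_inr_inr (v : Fin b → ℝ) (i : Fin b) :
    extend (Function.Embedding.inr.trans α) v (α (.inr i)) = v i :=
  extend_apply (Function.Embedding.inr.trans α) v i

theorem exists_smash₂_of (v : Fin n → ℝ) : ∃ s : CoSphere α,
    smash₂ α s (of fun i ↦ v (α (.inl i))) (of fun i ↦ v (α (.inr i))) = of v := by
  classical
  refine ⟨⟨of fun j ↦ if j ∈ Set.range α then 0 else v j, suppOn_of.2 fun i hi ↦
    if_pos (not_not.1 hi)⟩, ?_⟩
  rw [smash₂_of]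
  congr 1
  funext j
  by_cases h : j ∈ Set.range α
  · obtain ⟨i | i, rfl⟩ := h
    · simp [extend_inl_inl, extend_inr_inl]
    · simp [extend_inr_inr, extend_inl_inr]
  · have h1 : j ∉ Set.range (Function.Embedding.inl.trans α) := fun ⟨i, hi⟩ ↦ h ⟨_, hi⟩
    have h2 : j ∉ Set.range (Function.Embedding.inr.trans α) := fun ⟨i, hi⟩ ↦ h ⟨_, hi⟩
    rw [Pi.add_apply, Pi.add_apply, extend_apply' _ _ _ h1, extend_apply' _ _ _ h2, if_neg h,
      add_zero, add_zero]

theorem exists_smash₂ (z : Sphere n) : ∃ s x y, smash₂ α s x y = z := by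
  induction z using cases with
  | h => exact ⟨.infty α, infty, infty, rfl⟩
  | h' v =>
    obtain ⟨s, hs⟩ := exists_smash₂_of α v
    exact ⟨s, _, _, hs⟩

/-- The smash product has no identifications except at the base point. -/
theorem eq_of_smash₂_eq {s s' : CoSphere α} {x x' : Sphere a} {y y' : Sphere b}
    (h : smash₂ α s x y = smash₂ α s' x' y') : (s = s' ∧ x = x' ∧ y = y') ∨
      ((s.1 = infty ∨ x = infty ∨ y = infty) ∧ (s'.1 = infty ∨ x' = infty ∨ y' = infty)) := by
  have key : ∀ (s : CoSphere α) (x : Sphere a) (y : Sphere b),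
      ((s.1 = infty ∨ x = infty ∨ y = infty) ∧ smash₂ α s x y = infty) ∨
      ∃ (u : Fin n → ℝ) (hu : SuppOn (Set.range α)ᶜ (of u)) (v : Fin a → ℝ) (w : Fin b → ℝ),
        s = ⟨of u, hu⟩ ∧ x = of v ∧ y = of w := by
    rintro ⟨s, hs⟩ x y
    induction s using cases with
    | h => exact .inl ⟨.inl rfl, smash₂_infty rfl _ _⟩
    | h' u =>
      induction x using cases with
      | h => exact .inl ⟨.inr (.inl rfl), smash₂_infty_left _ _⟩
      | h' v =>
        induction y using cases with
        | h => exact .inl ⟨.inr (.inr rfl), smash₂_infty_right _ _⟩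
        | h' w => exact .inr ⟨u, hs, v, w, rfl, rfl, rfl⟩
  rcases key s x y with ⟨h1, h2⟩ | ⟨u, hu, v, w, rfl, rfl, rfl⟩ <;>
  rcases key s' x' y' with ⟨h3, h4⟩ | ⟨u', hu', v', w', rfl, rfl, rfl⟩
  · exact .inr ⟨h1, h3⟩
  · rw [h2, smash₂_of] at h
    exact absurd h (infty_ne_of _)
  · rw [h4, smash₂_of] at h
    exact absurd h (of_ne_infty _)
  · rw [smash₂_of, smash₂_of] at h
    have h := of_injective h
    have hin : ∀ (u : Fin n → ℝ) (_ : SuppOn (Set.range α)ᶜ (of u)) i, u (α i) = 0 :=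
      fun u hu i ↦ suppOn_of.1 hu _ (not_not.2 ⟨i, rfl⟩)
    have hv : v = v' := funext fun i ↦ by
      have := congrFun h (α (.inl i))
      simpa [hin u hu, hin u' hu', extend_inl_inl, extend_inr_inl] using this
    have hw : w = w' := funext fun i ↦ by
      have := congrFun h (α (.inr i))
      simpa [hin u hu, hin u' hu', extend_inr_inr, extend_inl_inr] using this
    subst hv hw
    have huu : u = u' := add_right_cancel (add_right_cancel h)
    subst huu
    exact .inl ⟨rfl, rfl, rfl⟩

end Sphere

theorem CoSphere.exists_comp₂ {a b a' b' n : ℕ} (α : Fin a' ⊕ Fin b' ↪ Fin n)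
    (β : Fin a ↪ Fin a') (γ : Fin b ↪ Fin b') (r : CoSphere ((β.sumMap γ).trans α)) :
    ∃ s s₁ s₂, r = CoSphere.comp₂ α β γ s s₁ s₂ := by
  obtain ⟨r, hr⟩ := r
  induction r using Sphere.cases with
  | h => exact ⟨.infty _, .infty _, .infty _, rfl⟩
  | h' v =>
    obtain ⟨s, hs⟩ := Sphere.exists_smash₂_of α v
    have h0 := Sphere.suppOn_of.1 hr
    refine ⟨s, ⟨_, Sphere.suppOn_of.2 fun i hi ↦ h0 (α (.inl i)) ?_⟩,
      ⟨_, Sphere.suppOn_of.2 fun i hi ↦ h0 (α (.inr i)) ?_⟩, Subtype.ext hs.symm⟩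
    · obtain ⟨j, rfl⟩ := not_not.1 hi
      exact not_not.2 ⟨.inl j, rfl⟩
    · obtain ⟨j, rfl⟩ := not_not.1 hi
      exact not_not.2 ⟨.inr j, rfl⟩

/-! ### The inverse map on representatives -/

section

variable {X Y : ISpace} {f : X ⟶ BF} {g : Y ⟶ BF} {a b a' b' m n : ℕ}

theorem mk_eq_pt_of_infty {x : X.obj a} {l : BarWord (F a)} {ξ : Sphere a} (hξ : ξ = Sphere.infty)
    (h : f.app x = V.proj (Bar.mk l ξ)) :
    (ThomSpace.mk ⟨(x, Bar.mk l ξ), h⟩ : ThomSpace (f.app (n := a))) = ThomSpace.pt :=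
  ThomSpace.mk_sec _ (by
    subst hξ
    dsimp only
    rw [h, V.proj_mk, V.sec_mk])

variable (f g) in
/-- The point of `T(f) ∧ T(g)` represented by `s`, `(x, v)` and `(y, w)`. -/
abbrev thomT (α : Fin a ⊕ Fin b ↪ Fin n) (s : CoSphere α) (p : ThomPullback (f.app (n := a)))
    (q : ThomPullback (g.app (n := b))) :
    (SymSpectrum.smash (thomSpectrum f) (thomSpectrum g)).obj n :=
  SymSpectrum.t (X := thomSpectrum f) (Y := thomSpectrum g) α s (ThomSpace.mk p) (ThomSpace.mk q)

theorem thomT_eq_pt (α : Fin a ⊕ Fin b ↪ Fin n) (s : CoSphere α) (x : X.obj a) (y : Y.obj b)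
    {l : BarWord (F a)} {ξ : Sphere a} {m : BarWord (F b)} {η : Sphere b}
    (hp : f.app x = V.proj (Bar.mk l ξ)) (hq : g.app y = V.proj (Bar.mk m η))
    (h : s.1 = Sphere.infty ∨ ξ = Sphere.infty ∨ η = Sphere.infty) :
    thomT f g α s ⟨(x, Bar.mk l ξ), hp⟩ ⟨(y, Bar.mk m η), hq⟩ =
      (SymSpectrum.smash (thomSpectrum f) (thomSpectrum g)).pt := by
  rcases h with h | h | h
  · exact SymSpectrum.t_infty _ _ h _ _
  · rw [thomT, mk_eq_pt_of_infty h hp]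
    exact SymSpectrum.t_pt_left (X := thomSpectrum f) (Y := thomSpectrum g) _ _ _
  · rw [thomT, mk_eq_pt_of_infty h hq]
    exact SymSpectrum.t_pt_right (X := thomSpectrum f) (Y := thomSpectrum g) _ _ _

/-- On representatives, `T(f) ∧ T(g) → T(f ⊠ g)` is injective. -/
theorem thomT_eq_of_mulV_eq (α : Fin a ⊕ Fin b ↪ Fin n) {s s' : CoSphere α}
    {p p' : ThomPullback (f.app (n := a))} {q q' : ThomPullback (g.app (n := b))}
    (hp : p.1.1 = p'.1.1) (hq : q.1.1 = q'.1.1)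
    (h : V.mulV α s p.1.2 q.1.2 = V.mulV α s' p'.1.2 q'.1.2) :
    thomT f g α s p q = thomT f g α s' p' q' := by
  obtain ⟨⟨x, v⟩, hv⟩ := p
  obtain ⟨⟨x', v'⟩, hv'⟩ := p'
  obtain ⟨⟨y, w⟩, hw⟩ := q
  obtain ⟨⟨y', w'⟩, hw'⟩ := q'
  dsimp only at hp hq h hv hv' hw hw'
  subst hp hq
  -- Represent the points by words that have no label at the time `1`.
  obtain ⟨l, hl, hfl⟩ := Bar.exists_label_one_eq_one (f.app x)
  obtain ⟨m, hm, hgm⟩ := Bar.exists_label_one_eq_one (g.app y)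
  obtain ⟨ξ, rfl⟩ := V.exists_mk l v (hv.symm.trans hfl)
  obtain ⟨ξ', rfl⟩ := V.exists_mk l v' (hv'.symm.trans hfl)
  obtain ⟨η, rfl⟩ := V.exists_mk m w (hw.symm.trans hgm)
  obtain ⟨η', rfl⟩ := V.exists_mk m w' (hw'.symm.trans hgm)
  rw [V.mulV_mk, V.mulV_mk, V.mk_eq_iff] at h
  have h1 := h.2
  rw [BF.label_mulWord, hl, hm, map_one, map_one, mul_one, one_smul, one_smul] at h1
  rcases Sphere.eq_of_smash₂_eq α h1 with ⟨rfl, rfl, rfl⟩ | ⟨h2, h3⟩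
  · rfl
  · rw [thomT_eq_pt α s x y hv hw h2, thomT_eq_pt α s' x y hv' hw' h3]

/-- On representatives, `T(f) ∧ T(g) → T(f ⊠ g)` is surjective. -/
theorem exists_mulV_eq (α : Fin a ⊕ Fin b ↪ Fin n) (x : X.obj a) (y : Y.obj b) (v : VObj n)
    (h : BF.mulAux α (f.app x) (g.app y) = V.proj v) :
    ∃ (s : CoSphere α) (p : ThomPullback (f.app (n := a))) (q : ThomPullback (g.app (n := b))),
      p.1.1 = x ∧ q.1.1 = y ∧ V.mulV α s p.1.2 q.1.2 = v := by
  obtain ⟨l, hl⟩ : ∃ l, f.app x = BF.mk l := by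
    induction f.app x using BF.ind with | h l
    exact ⟨l, rfl⟩
  obtain ⟨m, hm⟩ : ∃ m, g.app y = BF.mk m := by
    induction g.app y using BF.ind with | h m
    exact ⟨m, rfl⟩
  rw [hl, hm, BF.mulAux_mk] at h
  obtain ⟨z, rfl⟩ := V.exists_mk _ v h.symm
  obtain ⟨s, ξ, η, rfl⟩ := Sphere.exists_smash₂ α z
  exact ⟨s, ⟨(x, Bar.mk l ξ), hl.trans (V.proj_mk l ξ).symm⟩,
    ⟨(y, Bar.mk m η), hm.trans (V.proj_mk m η).symm⟩, rfl, rfl, V.mulV_mk α s l ξ m η⟩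

variable (f g) in
open Classical in
/-- The point of `T(f) ∧ T(g)` that is represented by points over `x` and `y` and maps to `v`. The
value is meaningful if `v` lies over the product of `f(x)` and `g(y)`. -/
def invAux (α : Fin a ⊕ Fin b ↪ Fin n) (x : X.obj a) (y : Y.obj b) (v : VObj n) :
    (SymSpectrum.smash (thomSpectrum f) (thomSpectrum g)).obj n :=
  if h : BF.mulAux α (f.app x) (g.app y) = V.proj v then
    thomT f g α (exists_mulV_eq α x y v h).choose
      (exists_mulV_eq α x y v h).choose_spec.choose
      (exists_mulV_eq α x y v h).choose_spec.choose_spec.choose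
  else (SymSpectrum.smash (thomSpectrum f) (thomSpectrum g)).pt

theorem invAux_mulV (α : Fin a ⊕ Fin b ↪ Fin n) (s : CoSphere α)
    (p : ThomPullback (f.app (n := a))) (q : ThomPullback (g.app (n := b))) :
    invAux f g α p.1.1 q.1.1 (V.mulV α s p.1.2 q.1.2) = thomT f g α s p q := by
  have h : BF.mulAux α (f.app p.1.1) (g.app q.1.1) = V.proj (V.mulV α s p.1.2 q.1.2) := by
    rw [V.proj_mulV, p.2, q.2]
  rw [invAux, dif_pos h]
  obtain ⟨h1, h2, h3⟩ :=
    (exists_mulV_eq α p.1.1 q.1.1 _ h).choose_spec.choose_spec.choose_spec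
  exact thomT_eq_of_mulV_eq α h1 h2 h3

theorem invAux_sec (α : Fin a ⊕ Fin b ↪ Fin n) (x : X.obj a) (y : Y.obj b) :
    invAux f g α x y (V.sec (BF.mulAux α (f.app x) (g.app y))) =
      (SymSpectrum.smash (thomSpectrum f) (thomSpectrum g)).pt := by
  have h := invAux_mulV (f := f) (g := g) α (.infty α)
    ⟨(x, V.sec (f.app x)), (V.proj_sec _).symm⟩ ⟨(y, V.sec (g.app y)), (V.proj_sec _).symm⟩
  have h' := V.mulV_sec_left α (.infty α) (V.sec (g.app y)) (f.app x)
  rw [V.proj_sec] at h'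
  rw [← h']
  exact h.trans (SymSpectrum.t_infty _ _ rfl _ _)

theorem invAux_shift (β : Fin a ↪ Fin a') (γ : Fin b ↪ Fin b') (α : Fin a' ⊕ Fin b' ↪ Fin n)
    (x : X.obj a) (y : Y.obj b) (v : VObj n)
    (h : BF.mulAux ((β.sumMap γ).trans α) (f.app x) (g.app y) = V.proj v) :
    invAux f g ((β.sumMap γ).trans α) x y v = invAux f g α (X.map β x) (Y.map γ y) v := by
  obtain ⟨r, p, q, rfl, rfl, rfl⟩ := exists_mulV_eq _ x y v h
  obtain ⟨s, s₁, s₂, rfl⟩ := CoSphere.exists_comp₂ α β γ r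
  rw [invAux_mulV, V.mulV_shift]
  refine Eq.trans ?_ (invAux_mulV α s (thomAct f β (s₁, p)) (thomAct g γ (s₂, q))).symm
  exact SymSpectrum.t_shift (X := thomSpectrum f) (Y := thomSpectrum g) β γ α s s₁ s₂
    (ThomSpace.mk p) (ThomSpace.mk q)

/-- The inverse map is continuous on representatives: it is so as a function of representing words
and of points of `S^{n-α}`, `Sᵃ` and `Sᵇ`. -/
theorem kcont_invAux (α : Fin a ⊕ Fin b ↪ Fin n) :
    KCont fun p : {p : (X.obj a × Y.obj b) × VObj n //
      BF.mulAux α (f.app p.1.1) (g.app p.1.2) = V.proj p.2} ↦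
        invAux f g α p.1.1.1 p.1.1.2 p.1.2 := by
  let B := {p : (X.obj a × Y.obj b) × VObj n //
      BF.mulAux α (f.app p.1.1) (g.app p.1.2) = V.proj p.2}
  have hf : KCont fun p : B ↦ f.app p.1.1.1 :=
    kcont _ (f.continuous_app.comp (continuous_fst.comp (continuous_fst.comp
      continuous_subtype_val)))
  refine KQuot.kcont_of_kcont_pullback (A := BarWord (F a) × Unit) hf ?_
  let B₁ := {p : (BarWord (F a) × Unit) × B // Bar.mk p.1.1 p.1.2 = f.app p.2.1.1.1}
  have c₁ : Continuous fun p : B₁ ↦ p.1.2.1 :=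
    continuous_subtype_val.comp (continuous_snd.comp continuous_subtype_val)
  have hg : KCont fun p : B₁ ↦ g.app p.1.2.1.1.2 :=
    kcont _ (g.continuous_app.comp (continuous_snd.comp (continuous_fst.comp c₁)))
  refine KQuot.kcont_of_kcont_pullback (A := BarWord (F b) × Unit) (B := B₁) hg ?_
  let B₂ := {p : (BarWord (F b) × Unit) × B₁ // Bar.mk p.1.1 p.1.2 = g.app p.2.1.2.1.1.2}
  have c₂ : Continuous fun p : B₂ ↦ p.1.2.1.2.1 :=
    c₁.comp (continuous_snd.comp continuous_subtype_val)
  have cl : Continuous fun p : B₂ ↦ p.1.2.1.1.1 :=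
    continuous_fst.comp (continuous_fst.comp (continuous_subtype_val.comp
      (continuous_snd.comp continuous_subtype_val)))
  have cm : Continuous fun p : B₂ ↦ p.1.1.1 :=
    continuous_fst.comp (continuous_fst.comp continuous_subtype_val)
  let ψ : B₂ × (CoSphere α × (Sphere a × Sphere b)) → VObj n := fun q ↦
    Bar.mk (BF.mulWord α q.1.1.2.1.1.1 q.1.1.1.1) (Sphere.smash₂ α q.2.1 q.2.2.1 q.2.2.2)
  have hψ : KCont ψ := by
    have hc : Continuous fun q : B₂ × (CoSphere α × (Sphere a × Sphere b)) ↦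
        ((q.1.1.2.1.1.1, q.1.1.1.1), Sphere.smash₂ α q.2.1 q.2.2.1 q.2.2.2) :=
      ((cl.comp continuous_fst).prodMk (cm.comp continuous_fst)).prodMk ((Sphere.continuous_smash₂ α).comp continuous_snd)
    exact (KCont.comp (V.kcont_mk_mulWord α) (kcont _ hc) :)
  have hv : KCont fun q : B₂ ↦ q.1.2.1.2.1.2 := kcont _ (continuous_snd.comp c₂)
  refine kcont_of_compact_lift (A := B₂) hψ hv ?_ ?_
  · rintro ⟨⟨⟨m, ⟨⟩⟩, ⟨⟨⟨l, ⟨⟩⟩, ⟨⟨⟨x, y⟩, v⟩, h⟩⟩, hl⟩⟩, hm⟩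
    dsimp only at h hl hm
    rw [← hl, ← hm] at h
    obtain ⟨z, rfl⟩ := V.exists_mk (BF.mulWord α l m) v h.symm
    obtain ⟨s, ξ, η, rfl⟩ := Sphere.exists_smash₂ α z
    exact ⟨(s, (ξ, η)), rfl⟩
  · let D := {q : B₂ × (CoSphere α × (Sphere a × Sphere b)) // ψ q = q.1.1.2.1.2.1.2}
    have c₃ : Continuous fun q : D ↦ q.1.1 := continuous_fst.comp continuous_subtype_val
    have c₄ : Continuous fun q : D ↦ q.1.2 := continuous_snd.comp continuous_subtype_val
    let P : D → ThomPullback (f.app (n := a)) := fun q ↦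
      ⟨(q.1.1.1.2.1.2.1.1.1, Bar.mk q.1.1.1.2.1.1.1 q.1.2.2.1),
        q.1.1.1.2.2.symm.trans (V.proj_mk _ _).symm⟩
    let Q : D → ThomPullback (g.app (n := b)) := fun q ↦
      ⟨(q.1.1.1.2.1.2.1.1.2, Bar.mk q.1.1.1.1.1 q.1.2.2.2),
        q.1.1.2.symm.trans (V.proj_mk _ _).symm⟩
    have hP : KCont P := KCont.subtypeMk (KCont.prodMk
      (kcont _ (continuous_fst.comp (continuous_fst.comp (c₂.comp c₃))))
      (KCont.comp Bar.kcont_mk (kcont (fun q : D ↦ (q.1.1.1.2.1.1.1, q.1.2.2.1))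
        ((cl.comp c₃).prodMk (continuous_fst.comp (continuous_snd.comp c₄)))) :)) _
    have hQ : KCont Q := KCont.subtypeMk (KCont.prodMk
      (kcont _ (continuous_snd.comp (continuous_fst.comp (c₂.comp c₃))))
      (KCont.comp Bar.kcont_mk (kcont (fun q : D ↦ (q.1.1.1.1.1, q.1.2.2.2))
        ((cm.comp c₃).prodMk (continuous_snd.comp (continuous_snd.comp c₄)))) :)) _
    have ht : KCont fun q : D ↦ thomT f g α q.1.2.1 (P q) (Q q) :=
      SymSpectrum.kcont_t_comp (X := thomSpectrum f) (Y := thomSpectrum g) α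
        (kcont _ (continuous_fst.comp c₄)) (KCont.comp ThomSpace.kcont_mk hP :)
        (KCont.comp ThomSpace.kcont_mk hQ :)
    convert ht using 1
    funext q
    rw [← invAux_mulV]
    refine congrArg (invAux f g α _ _) (q.2.symm.trans ?_)
    exact (V.mulV_mk α _ _ _ _ _).symm

end

/-! ### Descent of the inverse map to the box product -/

section

variable {X Y : ISpace} (f : X ⟶ BF) (g : Y ⟶ BF) {n : ℕ}

/-- Points of the disjoint union `∐ X(a) × Y(b)` over the maps `a ⊔ b → n` that lie over the same
point of `BF(n)` and at which the inverse map takes the same values. -/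
def invSetoid (n : ℕ) : Setoid (ISpace.BoxPre X Y n) where
  r p q := BF.mulAux p.1.emb (f.app p.2.1) (g.app p.2.2) =
      BF.mulAux q.1.emb (f.app q.2.1) (g.app q.2.2) ∧
    ∀ v, BF.mulAux p.1.emb (f.app p.2.1) (g.app p.2.2) = V.proj v →
      invAux f g p.1.emb p.2.1 p.2.2 v = invAux f g q.1.emb q.2.1 q.2.2 v
  iseqv :=
    { refl := fun _ ↦ ⟨rfl, fun _ _ ↦ rfl⟩
      symm := fun h ↦ ⟨h.1.symm, fun v hv ↦ (h.2 v (h.1.trans hv)).symm⟩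
      trans := fun h h' ↦ ⟨h.1.trans h'.1, fun v hv ↦
        (h.2 v hv).trans (h'.2 v (h.1.symm.trans hv))⟩ }

variable {f g}

theorem kcont_mulAux {a b : ℕ} (α : Fin a ⊕ Fin b ↪ Fin n) :
    KCont fun p : X.obj a × Y.obj b ↦ BF.mulAux α (f.app p.1) (g.app p.2) :=
  (KCont.comp (kcont _ (prodHom f g).continuous_app) (ISpace.kcont_t α) :)

/-- The relation is closed: over a word representing the common image in `BF(n)`, the points of
`V(n)` are parametrized by `Sⁿ`, so that the second condition is a family of equations. -/
theorem kclosed_invSetoid :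
    KClosed {p : ISpace.BoxPre X Y n × ISpace.BoxPre X Y n | invSetoid f g n p.1 p.2} := by
  refine kclosed_sigma_prod fun i ↦ ?_
  have hs : KClosed {p : ISpace.BoxPre X Y n × (X.obj i.left × Y.obj i.right) |
      invSetoid f g n ⟨i, p.2⟩ p.1} := by
    refine kclosed_sigma_prod fun j ↦ ?_
    let P := (X.obj j.left × Y.obj j.right) × (X.obj i.left × Y.obj i.right)
    have h1 : KCont fun p : P ↦ BF.mulAux i.emb (f.app p.2.1) (g.app p.2.2) :=
      (KCont.comp (kcont_mulAux i.emb) (kcont (Prod.snd : P → _) continuous_snd) :)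
    have h2 : KCont fun p : P ↦ BF.mulAux j.emb (f.app p.1.1) (g.app p.1.2) :=
      (KCont.comp (kcont_mulAux j.emb) (kcont (Prod.fst : P → _) continuous_fst) :)
    let E : Set P := {p | BF.mulAux i.emb (f.app p.2.1) (g.app p.2.2) =
      BF.mulAux j.emb (f.app p.1.1) (g.app p.1.2)}
    have hE : KClosed E := kclosed_eq h1 h2
    let W : Set E := {p | ∀ v, BF.mulAux i.emb (f.app p.1.2.1) (g.app p.1.2.2) = V.proj v →
      invAux f g i.emb p.1.2.1 p.1.2.2 v = invAux f g j.emb p.1.1.1 p.1.1.2 v}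
    have hW : KCont fun p : E ↦ p ∉ W := by
      have h3 : KCont fun p : E ↦ BF.mulAux i.emb (f.app p.1.2.1) (g.app p.1.2.2) :=
        (KCont.comp h1 (kcont _ continuous_subtype_val) :)
      refine KQuot.kcont_of_kcont_pullback (A := BarWord (F n) × Unit) h3 ?_
      let D := {p : (BarWord (F n) × Unit) × E //
        Bar.mk p.1.1 p.1.2 = BF.mulAux i.emb (f.app p.2.1.2.1) (g.app p.2.1.2.2)}
      have c₁ : Continuous fun p : D ↦ p.1.2.1 :=
        continuous_subtype_val.comp (continuous_snd.comp continuous_subtype_val)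
      have c₂ : Continuous fun p : D ↦ p.1.1.1 :=
        continuous_fst.comp (continuous_fst.comp continuous_subtype_val)
      have hD : ∀ p : D, BF.mulAux i.emb (f.app p.1.2.1.2.1) (g.app p.1.2.1.2.2) =
          BF.mk p.1.1.1 := fun p ↦ p.2.symm
      have hm : ∀ z : Sphere n, KCont fun p : D ↦ (Bar.mk p.1.1.1 z : VObj n) := fun z ↦
        (KCont.comp Bar.kcont_mk (kcont (fun p : D ↦ (p.1.1.1, z))
          (c₂.prodMk continuous_const)) :)
      have hz : ∀ z : Sphere n, KClosed {p : D |
          invAux f g i.emb p.1.2.1.2.1 p.1.2.1.2.2 (Bar.mk p.1.1.1 z) =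
            invAux f g j.emb p.1.2.1.1.1 p.1.2.1.1.2 (Bar.mk p.1.1.1 z)} := fun z ↦ by
        have e1 : KCont fun p : D ↦ (⟨(p.1.2.1.2, Bar.mk p.1.1.1 z),
            (hD p).trans (V.proj_mk _ _).symm⟩ :
            {p : (X.obj i.left × Y.obj i.right) × VObj n //
              BF.mulAux i.emb (f.app p.1.1) (g.app p.1.2) = V.proj p.2}) :=
          KCont.subtypeMk (KCont.prodMk (kcont _ (continuous_snd.comp c₁)) (hm z)) _
        have e2 : KCont fun p : D ↦ (⟨(p.1.2.1.1, Bar.mk p.1.1.1 z),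
            p.1.2.2.symm.trans ((hD p).trans (V.proj_mk _ _).symm)⟩ :
            {p : (X.obj j.left × Y.obj j.right) × VObj n //
              BF.mulAux j.emb (f.app p.1.1) (g.app p.1.2) = V.proj p.2}) :=
          KCont.subtypeMk (KCont.prodMk (kcont _ (continuous_fst.comp c₁)) (hm z)) _
        exact kclosed_eq (KCont.comp (kcont_invAux i.emb) e1 :)
          (KCont.comp (kcont_invAux j.emb) e2 :)
      refine (kclosed_iff_kcont (s := {p : D | p.1.2 ∈ W})).1 ?_
      convert KClosed.iInter hz using 1
      ext p
      simp only [Set.mem_iInter, Set.mem_ofPred_eq]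
      constructor
      · exact fun h z ↦ h _ ((hD p).trans (V.proj_mk _ _).symm)
      · intro h v hv
        obtain ⟨z, rfl⟩ := V.exists_mk _ v (hv.symm.trans (hD p))
        exact h z
    convert hE.sep hW (C := {False}) ?_ using 1
    · ext p
      simp only [Set.mem_singleton_iff, Set.mem_ofPred_eq]
      constructor
      · exact fun h ↦ ⟨h.1, eq_false (not_not.2 h.2)⟩
      · exact fun ⟨h1, h2⟩ ↦ ⟨h1, not_not.1 (of_eq_false h2)⟩
    · rw [← isOpen_compl_iff]
      convert isOpen_singleton_true using 1
      ext p
      simp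
  exact hs.preimage (kcont (fun p : (X.obj i.left × Y.obj i.right) × ISpace.BoxPre X Y n ↦
    (p.2, p.1)) (by fun_prop))

theorem invAux_eq_of_mk_eq {p q : ISpace.BoxPre X Y n}
    (h : (KQuot.mk p : ISpace.BoxObj X Y n) = KQuot.mk q) (v : VObj n)
    (hv : BF.mulAux p.1.emb (f.app p.2.1) (g.app p.2.2) = V.proj v) :
    invAux f g p.1.emb p.2.1 p.2.2 v = invAux f g q.1.emb q.2.1 q.2.2 v := by
  refine (KQuot.rel_of_mk_eq (invSetoid f g n) kclosed_invSetoid ?_ h).2 v hv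
  intro p q hr
  cases hr with
  | shift β γ α x y =>
    exact ⟨congrArg (prodHom f g).app (ISpace.t_shift β γ α x y),
      fun v hv ↦ invAux_shift β γ α x y v hv⟩

/-- The inverse map on the pullback of `V(n)` to the box product. -/
def invPullback (p : ThomPullback ((prodHom f g).app (n := n))) :
    (SymSpectrum.smash (thomSpectrum f) (thomSpectrum g)).obj n :=
  invAux f g (Quotient.exists_rep p.1.1).choose.1.emb (Quotient.exists_rep p.1.1).choose.2.1
    (Quotient.exists_rep p.1.1).choose.2.2 p.1.2

theorem invPullback_t {a b : ℕ} (α : Fin a ⊕ Fin b ↪ Fin n) (x : X.obj a) (y : Y.obj b)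
    (v : VObj n) (h : (prodHom f g).app (ISpace.t α x y) = V.proj v) :
    invPullback ⟨(ISpace.t α x y, v), h⟩ = invAux f g α x y v :=
  (invAux_eq_of_mk_eq (p := ⟨⟨a, b, α⟩, (x, y)⟩)
    (Quotient.exists_rep (ISpace.t α x y)).choose_spec.symm v h).symm

theorem kcont_invPullback :
    KCont (invPullback : ThomPullback ((prodHom f g).app (n := n)) → _) := by
  let T := ThomPullback ((prodHom f g).app (n := n))
  have hp : KCont fun p : T ↦ p.1.1 := kcont _ (continuous_fst.comp continuous_subtype_val)
  refine KQuot.kcont_of_pullback (r := ISpace.BoxRel X Y n) hp fun C hC ↦ ?_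
  refine kclosed_sigma_prod fun i ↦ ?_
  let P := (X.obj i.left × Y.obj i.right) × T
  let E : Set P := {p | ISpace.t i.emb p.1.1 p.1.2 = p.2.1.1}
  have hE : KClosed E := kclosed_eq
    ((KCont.comp (ISpace.kcont_t i.emb) (kcont (Prod.fst : P → _) continuous_fst)) :)
    (KCont.comp hp (kcont (Prod.snd : P → _) continuous_snd) :)
  have h1 : ∀ p : E, BF.mulAux i.emb (f.app p.1.1.1) (g.app p.1.1.2) = V.proj p.1.2.1.2 :=
    fun p ↦ (congrArg (prodHom f g).app p.2).trans p.1.2.2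
  have hu : KCont fun p : E ↦ invPullback p.1.2 := by
    have e : KCont fun p : E ↦ (⟨(p.1.1, p.1.2.1.2), h1 p⟩ :
        {p : (X.obj i.left × Y.obj i.right) × VObj n //
          BF.mulAux i.emb (f.app p.1.1) (g.app p.1.2) = V.proj p.2}) :=
      KCont.subtypeMk (kcont _ ((continuous_fst.comp continuous_subtype_val).prodMk
        (continuous_snd.comp (continuous_subtype_val.comp
          (continuous_snd.comp continuous_subtype_val))))) _
    convert (KCont.comp (kcont_invAux i.emb) e :) using 1
    funext p
    rw [← invPullback_t i.emb _ _ _ (h1 p)]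
    exact congrArg invPullback (Subtype.ext (Prod.ext p.2.symm rfl))
  convert hE.sep hu hC using 1
  ext p
  simp only [Set.mem_ofPred_eq, exists_prop]
  rfl

theorem ThomSpace.continuous_lift {W Z : Type} [TopologicalSpace W] [TopologicalSpace Z] [CGWH Z]
    {h : W → BF.obj n} (z : Z) (u : ThomPullback h → Z) (hu : KCont u)
    (hz : ∀ p, p.1.2 = V.sec (h p.1.1) → u p = z) : Continuous (ThomSpace.lift z u hu hz) :=
  KQuot.continuous_lift _ _ _

/-- The map `T(f ⊠ g)(n) → (T(f) ∧ T(g))(n)`. -/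
def smashInv (n : ℕ) : (thomSpectrum (prodHom f g)).obj n →
    (SymSpectrum.smash (thomSpectrum f) (thomSpectrum g)).obj n :=
  ThomSpace.lift (SymSpectrum.smash (thomSpectrum f) (thomSpectrum g)).pt invPullback
    kcont_invPullback (by
      rintro ⟨⟨w, v⟩, h⟩ hv
      dsimp only at hv
      subst hv
      induction w using ISpace.box_ind with | h α x y
      rw [invPullback_t]
      exact invAux_sec α x y)

theorem continuous_smashInv (n : ℕ) : Continuous (smashInv (f := f) (g := g) n) :=
  ThomSpace.continuous_lift _ _ _ _

theorem smashInv_mk {p : ThomPullback ((prodHom f g).app (n := n))} :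
    smashInv n (ThomSpace.mk p) = invPullback p := rfl

end

/-- A morphism of symmetric spectra with a continuous inverse is an isomorphism. -/
def SymSpectrum.isoOfInverse {X Y : SymSpectrum} (φ : X ⟶ Y) (ψ : ∀ n, Y.obj n → X.obj n)
    (hψ : ∀ n, Continuous (ψ n)) (h : ∀ {n : ℕ} (x : X.obj n), ψ n (φ.app x) = x)
    (h' : ∀ {n : ℕ} (y : Y.obj n), φ.app (ψ n y) = y) : X ≅ Y where
  hom := φ
  inv :=
    { app := fun {n} ↦ ψ n
      continuous_app := fun {n} ↦ hψ n
      app_pt := by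
        intro n
        rw [← φ.app_pt, h]
      app_act := fun α s y ↦ by
        conv_lhs => rw [← h' y, ← φ.app_act, h] }
  hom_inv_id := SymSpectrum.hom_ext h
  inv_hom_id := SymSpectrum.hom_ext h'

/-- The isomorphism `T(f) ∧ T(g) ≅ T(f ⊠ g)`. -/
def smashIso {X Y : ISpace} (f : X ⟶ BF) (g : Y ⟶ BF) :
    SymSpectrum.smash (thomSpectrum f) (thomSpectrum g) ≅ thomSpectrum (prodHom f g) :=
  SymSpectrum.isoOfInverse (smashHom f g) smashInv continuous_smashInv
    (fun x ↦ by
      induction x using SymSpectrum.smash_ind with | h α s x y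
      induction x using thom_ind with
      | h0 =>
        exact (SymSpectrum.t_pt_left (X := thomSpectrum f) (Y := thomSpectrum g) α s y).symm
      | h p =>
        induction y using thom_ind with
        | h0 =>
          exact (SymSpectrum.t_pt_right (X := thomSpectrum f) (Y := thomSpectrum g) α s _).symm
        | h q =>
          rw [smashHom_t, smashInv_mk]
          exact (invPullback_t α _ _ _ _).trans (invAux_mulV α s p q))
    (fun y ↦ by
      induction y using thom_ind with
      | h0 => exact (smashHom f g).app_pt
      | h p =>
        obtain ⟨⟨w, v⟩, h⟩ := p
        dsimp only at h
        induction w using ISpace.box_ind with | h α x y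
        rw [smashInv_mk, invPullback_t]
        obtain ⟨s, p, q, rfl, rfl, rfl⟩ := exists_mulV_eq α x y v h
        rw [invAux_mulV]
        rfl)

/-! ### The unit isomorphism -/

/-- The map from the sphere spectrum to the Thom spectrum of the unit of `BF`. -/
def unitHom : SymSpectrum.sphere ⟶ thomSpectrum BF.one where
  app {n} ξ := ThomSpace.mk (f := BF.one.app (n := n)) ⟨((), Bar.mk (BF.nil n) ξ), rfl⟩
  continuous_app {n} := by
    have h : KCont fun ξ : Sphere n ↦ (⟨((), Bar.mk (BF.nil n) ξ), rfl⟩ :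
        ThomPullback (BF.one.app (n := n))) :=
      KCont.subtypeMk (KCont.prodMk (kcont _ continuous_const)
        (KCont.comp Bar.kcont_mk (kcont (fun ξ : Sphere n ↦ (BF.nil n, ξ)) (by fun_prop)) :)) _
    exact KCont.continuous (A := Sphere n) (KCont.comp ThomSpace.kcont_mk h :)
  app_pt {n} := ThomSpace.mk_sec _ (V.sec_mk (BF.nil n)).symm
  app_act _ _ _ := rfl

theorem V.nil_injective {n : ℕ} {ξ ξ' : Sphere n}
    (h : (Bar.mk (BF.nil n) ξ : VObj n) = Bar.mk (BF.nil n) ξ') : ξ = ξ' := by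
  have := (V.mk_eq_iff.1 h).2
  rwa [BF.label_nil, one_smul, one_smul] at this

/-- The coordinate in `Sⁿ` of a point over the base point of `BF(n)`. -/
def unitInvPullback {n : ℕ} (p : ThomPullback (BF.one.app (n := n))) : Sphere n :=
  (V.exists_mk (BF.nil n) p.1.2 p.2.symm).choose

theorem unitInvPullback_spec {n : ℕ} (p : ThomPullback (BF.one.app (n := n))) :
    p.1.2 = Bar.mk (BF.nil n) (unitInvPullback p) :=
  (V.exists_mk (BF.nil n) p.1.2 p.2.symm).choose_spec

theorem kcont_unitInvPullback {n : ℕ} :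
    KCont (unitInvPullback : ThomPullback (BF.one.app (n := n)) → _) := by
  let T := ThomPullback (BF.one.app (n := n))
  refine kcont_of_compact_lift (A := T) (S := Sphere n) (ψ := fun q ↦ Bar.mk (BF.nil n) q.2)
    (v := fun p ↦ p.1.2)
    (KCont.comp Bar.kcont_mk (kcont (fun q : T × Sphere n ↦ (BF.nil n, q.2)) (by fun_prop)) :)
    (kcont _ (continuous_snd.comp continuous_subtype_val))
    (fun p ↦ ⟨_, (unitInvPullback_spec p).symm⟩) ?_
  convert kcont (fun q : {q : T × Sphere n // (Bar.mk (BF.nil n) q.2 : VObj n) = q.1.1.2} ↦ q.1.2)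
    (continuous_snd.comp continuous_subtype_val) using 1
  funext q
  exact V.nil_injective ((unitInvPullback_spec q.1.1).symm.trans q.2.symm)

/-- The map `T(* → BF)(n) → Sⁿ`. -/
def unitInv (n : ℕ) : (thomSpectrum BF.one).obj n → SymSpectrum.sphere.obj n :=
  ThomSpace.lift (Z := Sphere n) Sphere.infty unitInvPullback kcont_unitInvPullback fun p hp ↦
    V.nil_injective ((unitInvPullback_spec p).symm.trans (hp.trans (V.sec_mk (BF.nil n))))

theorem continuous_unitInv (n : ℕ) : Continuous (unitInv n) := ThomSpace.continuous_lift _ _ _ _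

/-- The isomorphism `S ≅ T(* → BF)`. -/
def unitIso : SymSpectrum.sphere ≅ thomSpectrum BF.one :=
  SymSpectrum.isoOfInverse unitHom unitInv continuous_unitInv
    (fun {n} ξ ↦ V.nil_injective (unitInvPullback_spec
      (⟨((), Bar.mk (BF.nil n) ξ), rfl⟩ : ThomPullback (BF.one.app (n := n)))).symm)
    (fun y ↦ by
      induction y using thom_ind with
      | h0 => exact unitHom.app_pt
      | h p => exact congrArg ThomSpace.mk (Subtype.ext (Prod.ext rfl (unitInvPullback_spec p).symm)))

/-! ### Coherence -/

namespace V

variable {a b c m n : ℕ}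

/-- The products of points of the spaces `V(n)` are associative; `γ` is the injection that the
associator of the smash product attaches to `α` and `β`. -/
theorem mulV_assoc (α : Fin m ⊕ Fin c ↪ Fin n) (s : CoSphere α) (β : Fin a ⊕ Fin b ↪ Fin m)
    (s' : CoSphere β) (γ : Fin a ⊕ Fin (b + c) ↪ Fin n) (r : CoSphere γ)
    (hγ : γ = ((Function.Embedding.refl _).sumMap finSumFinEquiv.symm.toEmbedding).trans
      ((Equiv.sumAssoc _ _ _).symm.toEmbedding.trans
        ((β.sumMap (Function.Embedding.refl _)).trans α)))
    (hr : r.1 = s.1 + Sphere.push (Function.Embedding.inl.trans α) s'.1)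
    (u : VObj a) (v : VObj b) (w : VObj c) :
    mulV α s (mulV β s' u v) w =
      mulV γ r u (mulV finSumFinEquiv.toEmbedding (.zero _) v w) := by
  subst hγ
  induction u using Bar.ind with | h l₁ x
  induction v using Bar.ind with | h l₂ y
  induction w using Bar.ind with | h l₃ z
  rw [mulV_mk, mulV_mk, mulV_mk, mulV_mk]
  have hl : ∀ t, Bar.label (BF.mulWord α (BF.mulWord β l₁ l₂) l₃).1 t =
      Bar.label (BF.mulWord (((Function.Embedding.refl _).sumMap
        finSumFinEquiv.symm.toEmbedding).trans ((Equiv.sumAssoc _ _ _).symm.toEmbedding.trans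
        ((β.sumMap (Function.Embedding.refl _)).trans α))) l₁
        (BF.mulWord finSumFinEquiv.toEmbedding l₂ l₃)).1 t := fun t ↦ by
    simp only [BF.label_mulWord, map_mul, ← F.map_trans, _root_.mul_assoc]
    refine congrArg₂ _ (BF.map_congr (fun i ↦ ?_) _) (congrArg₂ _ (BF.map_congr (fun i ↦ ?_) _)
      (BF.map_congr (fun i ↦ ?_) _)) <;> simp
  refine Bar.mk_eq_of_label_smul (fun t _ _ ↦ hl t) (congrArg₂ _ (hl 1) ?_)
  simp only [Sphere.smash₂, hr, SymSpectrum.zero_val,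
    map_add, zero_add, ← Sphere.push_trans, emb_assoc, refl_emb, inl_sumMap, inr_sumMap,
    inl_sumAssoc_symm, inl_inr_sumAssoc_symm, inr_inr_sumAssoc_symm, equiv_symm_emb]
  abel

/-- The products with the points over the base point of `BF(a)` are the structure maps. -/
theorem nil_mulV (α : Fin a ⊕ Fin b ↪ Fin n) (s : CoSphere α) (ξ : Sphere a) (v : VObj b) :
    mulV α s (Bar.mk (BF.nil a) ξ) v =
      act (Function.Embedding.inr.trans α) (SymSpectrum.unitCoord α s ξ, v) := by
  induction v using Bar.ind with | h l x
  rw [mulV_mk, act_mk]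
  have hl : ∀ t, Bar.label (BF.mulWord α (BF.nil a) l).1 t =
      Bar.label (Bar.mapWord (F.map (Function.Embedding.inr.trans α)) l).1 t := fun t ↦ by
    rw [BF.label_mulWord, Bar.label_mapWord, BF.label_nil, map_one, one_mul]
  exact Bar.mk_eq_of_label_smul (fun t _ _ ↦ hl t) (congrArg₂ _ (hl 1) rfl)

theorem mulV_comm (α : Fin a ⊕ Fin b ↪ Fin n) (s : CoSphere α) (v : VObj a) (w : VObj b) :
    mulV ((Equiv.sumComm _ _).toEmbedding.trans α) (.precomp _ s) w v = mulV α s v w := by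
  induction v using Bar.ind with | h l x
  induction w using Bar.ind with | h m y
  rw [mulV_mk, mulV_mk]
  have hl : ∀ t, Bar.label (BF.mulWord ((Equiv.sumComm _ _).toEmbedding.trans α) m l).1 t =
      Bar.label (BF.mulWord α l m).1 t := fun t ↦ by
    rw [BF.label_mulWord, BF.label_mulWord, (BF.commute α _ _).eq]
    rfl
  exact Bar.mk_eq_of_label_smul (fun t _ _ ↦ hl t) (congrArg₂ _ (hl 1) (add_right_comm _ _ _))

end V

section

variable {X Y Z : ISpace} {f : X ⟶ BF} {g : Y ⟶ BF} {h : Z ⟶ BF} {E : SymSpectrum}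

/-- Maps out of a smash product of Thom spectra are determined by their values on points of the
pullbacks. -/
theorem smash_thom_hom_ext {φ ψ : SymSpectrum.smash (thomSpectrum f) (thomSpectrum g) ⟶ E}
    (H : ∀ {a b n : ℕ} (α : Fin a ⊕ Fin b ↪ Fin n) (s : CoSphere α)
      (p : ThomPullback (f.app (n := a))) (q : ThomPullback (g.app (n := b))),
      φ.app (thomT f g α s p q) = ψ.app (thomT f g α s p q)) : φ = ψ :=
  SymSpectrum.smash_hom_ext fun α s x y ↦ by
    induction x using thom_ind with
    | h0 =>
      refine (congrArg φ.app (SymSpectrum.t_pt_left (X := thomSpectrum f) α s y)).trans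
        (Eq.trans ?_ (congrArg ψ.app (SymSpectrum.t_pt_left (X := thomSpectrum f) α s y)).symm)
      rw [φ.app_pt, ψ.app_pt]
    | h p =>
      induction y using thom_ind with
      | h0 =>
        refine (congrArg φ.app (SymSpectrum.t_pt_right (Y := thomSpectrum g) α s _)).trans
          (Eq.trans ?_ (congrArg ψ.app (SymSpectrum.t_pt_right (Y := thomSpectrum g) α s _)).symm)
        rw [φ.app_pt, ψ.app_pt]
      | h q => exact H α s p q

theorem smash_smash_thom_hom_ext {φ ψ : SymSpectrum.smash
      (SymSpectrum.smash (thomSpectrum f) (thomSpectrum g)) (thomSpectrum h) ⟶ E}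
    (H : ∀ {a b c m n : ℕ} (α : Fin m ⊕ Fin c ↪ Fin n) (s : CoSphere α)
      (β : Fin a ⊕ Fin b ↪ Fin m) (s' : CoSphere β) (p : ThomPullback (f.app (n := a)))
      (q : ThomPullback (g.app (n := b))) (r : ThomPullback (h.app (n := c))),
      φ.app (SymSpectrum.t (Y := thomSpectrum h) α s (thomT f g β s' p q) (ThomSpace.mk r)) =
        ψ.app (SymSpectrum.t (Y := thomSpectrum h) α s (thomT f g β s' p q) (ThomSpace.mk r))) :
    φ = ψ :=
  SymSpectrum.smash_hom_ext fun α s w z ↦ by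
    induction w using SymSpectrum.smash_ind with | h β s' x y
    have e1 : ∀ y, φ.app (SymSpectrum.t (Y := thomSpectrum h) α s
        (SymSpectrum.smash (thomSpectrum f) (thomSpectrum g)).pt y) = ψ.app
        (SymSpectrum.t α s (SymSpectrum.smash (thomSpectrum f) (thomSpectrum g)).pt y) := fun y ↦ by
      rw [SymSpectrum.t_pt_left, φ.app_pt, ψ.app_pt]
    induction z using thom_ind with
    | h0 =>
      refine (congrArg φ.app (SymSpectrum.t_pt_right (Y := thomSpectrum h) α s _)).trans
        (Eq.trans ?_ (congrArg ψ.app (SymSpectrum.t_pt_right (Y := thomSpectrum h) α s _)).symm)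
      rw [φ.app_pt, ψ.app_pt]
    | h r =>
      induction x using thom_ind with
      | h0 =>
        have := e1 (ThomSpace.mk r)
        rwa [← SymSpectrum.t_pt_left (X := thomSpectrum f) β s' y] at this
      | h p =>
        induction y using thom_ind with
        | h0 =>
          have := e1 (ThomSpace.mk r)
          rwa [← SymSpectrum.t_pt_right (Y := thomSpectrum g) β s' (ThomSpace.mk p)] at this
        | h q => exact H α s β s' p q r

end

/-- The structure of a strong monoidal functor on the Thom spectrum functor. -/
def thomCoreMonoidal : thomFunctor.CoreMonoidal where
  εIso := unitIso
  μIso f g := smashIso f.hom g.hom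
  μIso_hom_natural_left φ g := smash_thom_hom_ext fun α s p q ↦ rfl
  μIso_hom_natural_right f φ := smash_thom_hom_ext fun α s p q ↦ rfl
  associativity f g h := smash_smash_thom_hom_ext fun α s β s' p q r ↦
    congrArg ThomSpace.mk (Subtype.ext (Prod.ext rfl
      (V.mulV_assoc α s β s' _ _ rfl rfl p.1.2 q.1.2 r.1.2)))
  left_unitality f := SymSpectrum.smash_hom_ext fun α s u x ↦ by
    induction x using thom_ind with
    | h0 => rfl
    | h p => exact congrArg ThomSpace.mk (Subtype.ext (Prod.ext rfl (V.nil_mulV α s u p.1.2).symm))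
  right_unitality f := SymSpectrum.smash_hom_ext fun α s x u ↦ by
    induction x using thom_ind with
    | h0 => rfl
    | h p =>
      exact congrArg ThomSpace.mk (Subtype.ext (Prod.ext rfl
        ((V.nil_mulV ((Equiv.sumComm _ _).toEmbedding.trans α) (.precomp _ s) u p.1.2).symm.trans
          (V.mulV_comm α s p.1.2 _))))

/-- The Thom spectrum functor as a symmetric monoidal functor. -/
@[reducible]
def thomBraided : thomFunctor.Braided :=
  { thomCoreMonoidal.toMonoidal with
    braided := fun _ _ ↦ smash_thom_hom_ext fun α s p q ↦
      congrArg ThomSpace.mk (Subtype.ext (Prod.ext rfl (V.mulV_comm α s p.1.2 q.1.2).symm)) }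

instance {X : ISpace} [MonObj X] [IsCommMonObj X] (f : X ⟶ BF) [IsMonHom f] :
    IsCommMonObj (Over.mk f) where
  mul_comm := Over.OverMorphism.ext (IsCommMonObj.mul_comm X)

end

end SymThom

/-- The symmetric Thom spectrum functor `T` from `ℐ`-spaces over `BF` to symmetric spectra is strong
symmetric monoidal. Consequently, if `f : X → BF` is a map of `ℐ`-space monoids, then `T(f)` is a
symmetric ring spectrum, with the unit and the multiplication induced by those of `X`, and if `X`
is commutative, then so is `T(f)`. -/
theorem theorem1p1 :
    ∃ _ : SymThom.thomFunctor.Braided,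
      ∀ (X : SymThom.ISpace) [MonObj X] (f : X ⟶ SymThom.BF) [IsMonHom f],
        ∃ R : MonObj (SymThom.thomFunctor.obj (Over.mk f)),
          R.one = Functor.LaxMonoidal.ε SymThom.thomFunctor ≫
            SymThom.thomFunctor.map (MonObj.one (X := Over.mk f)) ∧
          R.mul = Functor.LaxMonoidal.μ SymThom.thomFunctor (Over.mk f) (Over.mk f) ≫
            SymThom.thomFunctor.map (MonObj.mul (X := Over.mk f)) ∧
          (IsCommMonObj X → IsCommMonObj (SymThom.thomFunctor.obj (Over.mk f))) := by
  refine ⟨SymThom.thomBraided, fun X _ f _ ↦ ?_⟩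
  let _ := SymThom.thomBraided
  exact ⟨Functor.monObjObj (F := SymThom.thomFunctor) (Over.mk f), rfl, rfl, fun _ ↦
    Functor.isCommMonObj_obj (F := SymThom.thomFunctor) (M := Over.mk f)⟩
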